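/- Let $n\ge 1$ and work over $\mathbb{Q}(v)$. **The algebra $\hat{\mathcal K}$.** For $d\ge 0$ let $\Theta_d$ be the set of $n\times n$ matrices with entries in $\mathbb N$ and entry sum $d$. For a finite field $\mathbb F_q$ of odd characteristic, $GL(\mathbb F_q^d)$ acts on pairs $(V,V')$ of flags $0=V_0\subseteq V_1\subseteq\dots\subseteq V_n=\mathbb F_q^d$; the orbits are the sets $\mathcal O_A$ $(A\in\Theta_d)$ of the pairs with $\dim\frac{V_{i-1}+V_i\cap V'_j}{V_{i-1}+V_i\cap V'_{j-1}}=a_{ij}$ for all $i,j$. Let $\mathcal S_d$ be the algebra with basis $e_A$ $(A\in\Theta_d)$ and product $e_A*e_B=\sum_C g_{A,B}^C(v^2)\,e_C$, where $g_{A,B}^C$ is the polynomial such that, for every odd prime power $q$ and every $(V,V')\in\mathcal O_C$, $g_{A,B}^C(q)$ is the number of flags $V''$ with $(V,V'')\in\mathcal O_A$ and $(V'',V')\in\mathcal O_B$. Put $[A]=v^{-\sum_{i\ge k,\,j<l}a_{ij}a_{kl}}\,e_A$. Let $\widetilde\Theta$ be the set of integer $n\times n$ matrices with nonnegative off-diagonal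 entries, and ${}_pA=A+pI$. Write $\mathrm{ro}(A)$ and $\mathrm{co}(A)$ for the vectors of row sums and of column sums of $A$. For $A,B\in\widetilde\Theta$ with $\mathrm{co}(A)=\mathrm{ro}(B)$ there is a unique finite family of polynomials $G_Z(v,v')\in\mathbb{Q}(v)[v']$ $(Z\in\widetilde\Theta)$ with $[{}_pA]*[{}_pB]=\sum_Z G_Z(v,v^{-p})[{}_pZ]$ for all large $p$; put $[A]\cdot[B]=\sum_Z G_Z(v,1)[Z]$, and $[A]\cdot[B]=0$ if $\mathrm{co}(A)\neq\mathrm{ro}(B)$. Let $\hat{\mathcal K}$ be the $\mathbb{Q}(v)$-algebra of all formal sums $\sum_{A\in\widetilde\Theta}\xi_A[A]$ which, for every $\mathbf t\in\mathbb Z^n$, have only finitely many nonzero terms with $\mathrm{ro}(A)=\mathbf t$ and only finitely many with $\mathrm{co}(A)=\mathbf t$, with the product extending $[A]\cdot[B]$; its unit is $\sum_{\lambda\in\mathbb Z^n}[D_\lambda]$, where $D_\lambda$ is the diagonal matrix with diagonal $\lambda$. **The subalgebra $\mathcal U$.** For a matrix $\hat A$ with nonnegative integer entries and zero diagonal, and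 $\mathbf j\in\mathbb Z^n$, put $\hat A(\mathbf j)=\sum_{\lambda\in\mathbb Z^n}v^{\lambda_1j_1+\dots+\lambda_nj_n}[\hat A+D_\lambda]$. Let $\underline i$ be the $i$-th unit vector, and in $\hat{\mathcal K}$ put $\overline t_{ij}=-(v^{-1}-v)E_{ij}(\underline i)$ for $i<j$, $\overline t_{ii}=0(\underline i)$, and $\overline t_{ij}=0$ for $i>j$. Let $\mathcal U$ be the unital subalgebra of $\hat{\mathcal K}$ generated by all $\overline t_{ij}$. **The algebra $U_v(gl_n)^+$.** Let $U_v(gl_n)$ be the $\mathbb{Q}(v)$-algebra with generators $t_{ij},\overline t_{ij}$ $(1\le i,j\le n)$ and relations $t_{ij}=\overline t_{ji}=0$ for $i<j$ and, for all $i,a,j,b$ (with $\delta_P=1$ if $P$ holds and $0$ otherwise), $$v^{\delta_{ij}}t_{ia}t_{jb}-v^{\delta_{ab}}t_{jb}t_{ia}=(v-v^{-1})(\delta_{b<a}-\delta_{i<j})\,t_{ja}t_{ib},$$ $$v^{\delta_{ij}}\overline t_{ia}\overline t_{jb}-v^{\delta_{ab}}\overline t_{jb}\overline t_{ia}=(v-v^{-1})(\delta_{b<a}-\delta_{i<j})\,\overline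 t_{ja}\overline t_{ib},$$ $$v^{\delta_{ij}}\overline t_{ia}t_{jb}-v^{\delta_{ab}}t_{jb}\overline t_{ia}=(v-v^{-1})(\delta_{b<a}\,t_{ja}\overline t_{ib}-\delta_{i<j}\,\overline t_{ja}t_{ib}),$$ and let $U_v(gl_n)^+$ be its subalgebra generated by the $\overline t_{ij}$. **Theorem.** $\mathcal U\cong U_v(gl_n)^+$ as unital $\mathbb{Q}(v)$-algebras. More precisely: 1. there is an algebra isomorphism $U_v(gl_n)^+\to\mathcal U$ which sends $\overline t_{ij}$ to $\overline t_{n+1-j,\,n+1-i}$ for all $i,j$; 2. $\mathcal U$ is presented by the generators $\overline t_{ij}$ with the relations $\overline t_{ij}=0$ for $i>j$ and, for all $i,a,j,b$, $$v^{-\delta_{ij}}\overline t_{ia}\overline t_{jb}-v^{-\delta_{ab}}\overline t_{jb}\overline t_{ia}=(v^{-1}-v)(\delta_{b<a}-\delta_{i<j})\,\overline t_{ja}\overline t_{ib}.$$ -/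

import Mathlib

open Polynomial

noncomputable section

/-- The ground field `ℚ(v)`. -/
abbrev Kv : Type := RatFunc ℚ

/-- The indeterminate `v` of `ℚ(v)`. -/
def vv : Kv := RatFunc.X

/-! ### Flags over finite fields and the structure constants of the algebras `S_d` -/

/-- An `n`-step flag `0 = V_0 ⊆ V_1 ⊆ ⋯ ⊆ V_n = F^d`. -/
structure NStepFlag (F : Type) [Field F] (n d : ℕ) where
  space : Fin (n + 1) → Submodule F (Fin d → F)
  mono : Monotone space
  bot : space 0 = ⊥
  top : space (Fin.last n) = ⊤

/-- The matrix of a pair of flags: its `(i, j)` entry is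
`dim (V_{i-1} + V_i ∩ V'_j) / (V_{i-1} + V_i ∩ V'_{j-1})` (with 1-based indices).
Two pairs of flags are in the same `GL(F^d)`-orbit iff they have the same matrix, so that the
orbit `O_A` is the set of the pairs whose matrix is `A`. -/
def relPos {F : Type} [Field F] {n d : ℕ} (V V' : NStepFlag F n d) :
    Matrix (Fin n) (Fin n) ℤ := fun i j =>
  (Module.finrank F
      ↥(V.space i.castSucc ⊔ (V.space i.succ ⊓ V'.space j.succ)) : ℤ) -
    (Module.finrank F
      ↥(V.space i.castSucc ⊔ (V.space i.succ ⊓ V'.space j.castSucc)) : ℤ)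

/-- The vector of row sums `ro(A)`. -/
def rowSum {n : ℕ} (A : Matrix (Fin n) (Fin n) ℤ) : Fin n → ℤ := fun i => ∑ j, A i j

/-- The vector of column sums `co(A)`. -/
def colSum {n : ℕ} (A : Matrix (Fin n) (Fin n) ℤ) : Fin n → ℤ := fun j => ∑ i, A i j

/-- `A ∈ Θ_d`: the entries are natural numbers with sum `d`. -/
def IsTheta {n : ℕ} (d : ℕ) (A : Matrix (Fin n) (Fin n) ℤ) : Prop :=
  (∀ i j, 0 ≤ A i j) ∧ ∑ i, ∑ j, A i j = (d : ℤ)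

/-- `d(A) - r(A) = ∑_{i ≥ k, j < l} a_{ij} a_{kl}`, so that `[A] = v^{-(d(A) - r(A))} e_A`. -/
def dimDiff {n : ℕ} (A : Matrix (Fin n) (Fin n) ℤ) : ℤ :=
  ∑ i, ∑ j, ∑ k, ∑ l, if k ≤ i ∧ j < l then A i j * A k l else 0

/-- `P(q)` is the coefficient of `e_C` in the convolution product `e_A * e_B` over the field with
`q` elements, for every odd prime power `q`: for `(V, V') ∈ O_C` it is the number of the flags
`V''` with `(V, V'') ∈ O_A` and `(V'', V') ∈ O_B`. -/
def IsStructurePoly {n : ℕ} (d : ℕ) (A B C : Matrix (Fin n) (Fin n) ℤ) (P : ℤ[X]) : Prop :=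
  ∀ (F : Type) [Field F] [Finite F], ringChar F ≠ 2 →
    ∀ V V' : NStepFlag F n d, relPos V V' = C →
      P.eval (Nat.card F : ℤ) =
        (Nat.card {V'' : NStepFlag F n d // relPos V V'' = A ∧ relPos V'' V' = B} : ℤ)

/-- `x ∈ ℚ(v)` is the coefficient of `[C]` in the product `[A] * [B]` in `S_d`
(where `q = v²`, and `A`, `B`, `C` are in `Θ_d`). -/
def IsSchurCoeff {n : ℕ} (d : ℕ) (A B C : Matrix (Fin n) (Fin n) ℤ) (x : Kv) : Prop :=
  ∃ P : ℤ[X], IsStructurePoly d A B C P ∧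
    x = vv ^ (dimDiff C - dimDiff A - dimDiff B) * Polynomial.aeval (vv ^ 2) P

/-! ### Stabilization: the algebras `K` and `K̂` -/

/-- The set `Θ̃` of the integer matrices whose off-diagonal entries are nonnegative. -/
def ThetaTilde (n : ℕ) : Type :=
  {A : Matrix (Fin n) (Fin n) ℤ // ∀ i j, i ≠ j → 0 ≤ A i j}

/-- The matrix `_pA = A + p I`. -/
def shift {n : ℕ} (p : ℕ) (A : ThetaTilde n) : Matrix (Fin n) (Fin n) ℤ :=
  A.1 + (p : ℤ) • (1 : Matrix (Fin n) (Fin n) ℤ)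

/-- The finite family `G = (G_Z)` of polynomials in `v'` over `ℚ(v)` satisfies
`[_pA] * [_pB] = ∑_Z G_Z(v, v^{-p}) [_pZ]` (in `S_d`, where `d` is the sum of the entries of
`_pA`) for all large `p`. -/
def IsStableProduct {n : ℕ} (A B : ThetaTilde n) (G : ThetaTilde n →₀ Kv[X]) : Prop :=
  ∃ p₀ : ℕ, ∀ p ≥ p₀, ∃ d : ℕ,
    IsTheta d (shift p A) ∧ IsTheta d (shift p B) ∧
    (∀ Z ∈ G.support, IsTheta d (shift p Z)) ∧
    ∀ Z : ThetaTilde n, IsTheta d (shift p Z) →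
      IsSchurCoeff d (shift p A) (shift p B) (shift p Z) ((G Z).eval (vv ^ (-(p : ℤ))))

open Classical in
/-- The product `[A] · [B] = ∑_Z G_Z(v, 1) [Z]` in `K` if `co(A) = ro(B)`, and `0` otherwise.
(The family `G` exists by the stabilization property and is unique.) -/
def basisMul {n : ℕ} (A B : ThetaTilde n) : ThetaTilde n →₀ Kv :=
  if h : colSum A.1 = rowSum B.1 ∧ ∃ G, IsStableProduct A B G then
    h.2.choose.mapRange (Polynomial.eval 1) Polynomial.eval_zero
  else 0

/-- The bilinear product of `K`, extended to finite `ℚ(v)`-linear combinations of the `[A]`. -/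
def kMul {n : ℕ} :
    (ThetaTilde n →₀ Kv) →ₗ[Kv] (ThetaTilde n →₀ Kv) →ₗ[Kv] (ThetaTilde n →₀ Kv) :=
  Finsupp.lsum Kv fun A => LinearMap.toSpanSingleton Kv _ (Finsupp.lsum Kv fun B =>
    LinearMap.toSpanSingleton Kv (ThetaTilde n →₀ Kv) (basisMul A B))

/-- The space of the formal sums `∑ ξ_A [A]` that have, for every `t ∈ ℤ^n`, only finitely many
terms with `ro(A) = t` and only finitely many terms with `co(A) = t`. -/
def locallyFinite (n : ℕ) : Submodule Kv (ThetaTilde n → Kv) where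
  carrier := {ξ | ∀ t : Fin n → ℤ,
    {A : ThetaTilde n | rowSum A.1 = t ∧ ξ A ≠ 0}.Finite ∧
    {A : ThetaTilde n | colSum A.1 = t ∧ ξ A ≠ 0}.Finite}
  zero_mem' := by intro t; simp
  add_mem' := by
    intro ξ η hξ hη t
    constructor
    · refine ((hξ t).1.union (hη t).1).subset ?_
      rintro A ⟨h1, h2⟩
      by_cases h : ξ A = 0
      · right; refine ⟨h1, fun h' => h2 ?_⟩; simp [h, h']
      · left; exact ⟨h1, h⟩
    · refine ((hξ t).2.union (hη t).2).subset ?_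
      rintro A ⟨h1, h2⟩
      by_cases h : ξ A = 0
      · right; refine ⟨h1, fun h' => h2 ?_⟩; simp [h, h']
      · left; exact ⟨h1, h⟩
  smul_mem' := by
    intro c ξ hξ t
    constructor
    · refine (hξ t).1.subset ?_
      rintro A ⟨h1, h2⟩
      exact ⟨h1, fun h => h2 (by simp [h])⟩
    · refine (hξ t).2.subset ?_
      rintro A ⟨h1, h2⟩
      exact ⟨h1, fun h => h2 (by simp [h])⟩

/-- The completion `K̂` as a type. -/
def KHat (n : ℕ) : Type := ↥(locallyFinite n)

instance (n : ℕ) : AddCommGroup (KHat n) := inferInstanceAs (AddCommGroup ↥(locallyFinite n))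

instance (n : ℕ) : Module Kv (KHat n) := inferInstanceAs (Module Kv ↥(locallyFinite n))

open Classical in
/-- The finite sum of the terms `ξ_A [A]` with `ro(A) = t`. -/
def rowPart {n : ℕ} (t : Fin n → ℤ) : KHat n →ₗ[Kv] (ThetaTilde n →₀ Kv) where
  toFun ξ := Finsupp.onFinset (ξ.2 t).1.toFinset (fun A => if rowSum A.1 = t then ξ.1 A else 0)
    (by intro A h; simp only [ne_eq, ite_eq_right_iff, Classical.not_imp] at h; simpa using h)
  map_add' ξ η := by
    ext A
    change (if _ then ξ.1 A + η.1 A else 0) = (if _ then _ else _) + (if _ then _ else _)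
    split_ifs <;> simp
  map_smul' c ξ := by
    ext A
    change (if _ then c * ξ.1 A else 0) = c * (if _ then _ else _)
    split_ifs <;> simp

open Classical in
/-- The finite sum of the terms `ξ_A [A]` with `co(A) = t`. -/
def colPart {n : ℕ} (t : Fin n → ℤ) : KHat n →ₗ[Kv] (ThetaTilde n →₀ Kv) where
  toFun ξ := Finsupp.onFinset (ξ.2 t).2.toFinset (fun A => if colSum A.1 = t then ξ.1 A else 0)
    (by intro A h; simp only [ne_eq, ite_eq_right_iff, Classical.not_imp] at h; simpa using h)
  map_add' ξ η := by
    ext A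
    change (if _ then ξ.1 A + η.1 A else 0) = (if _ then _ else _) + (if _ then _ else _)
    split_ifs <;> simp
  map_smul' c ξ := by
    ext A
    change (if _ then c * ξ.1 A else 0) = c * (if _ then _ else _)
    split_ifs <;> simp

/-- The coefficient of `[C]` in the product `∑_{A, B} ξ_A η_B [A] · [B]`. As `[A] · [B]` involves
only matrices `C` with `ro(C) = ro(A)` and `co(C) = co(B)`, only the finitely many terms with
`ro(A) = ro(C)` and `co(B) = co(C)` matter. -/
def mulCoeff {n : ℕ} (ξ η : KHat n) (C : ThetaTilde n) : Kv :=
  kMul (rowPart (rowSum C.1) ξ) (colPart (colSum C.1) η) C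

theorem exists_of_mulCoeff_ne_zero {n : ℕ} (ξ η : KHat n) (C : ThetaTilde n)
    (h : mulCoeff ξ η C ≠ 0) :
    ∃ A B : ThetaTilde n, rowSum A.1 = rowSum C.1 ∧ ξ.1 A ≠ 0 ∧ colSum A.1 = rowSum B.1 ∧
      colSum B.1 = colSum C.1 ∧ η.1 B ≠ 0 ∧ C ∈ (basisMul A B).support := by
  classical
  by_contra hne
  apply h
  unfold mulCoeff kMul
  rw [Finsupp.lsum_apply, Finsupp.sum, LinearMap.sum_apply, Finsupp.finsetSum_apply]
  refine Finset.sum_eq_zero fun A hA => ?_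
  simp only [LinearMap.toSpanSingleton_apply, LinearMap.smul_apply, Finsupp.lsum_apply,
    Finsupp.sum, Finsupp.smul_apply, Finsupp.finsetSum_apply]
  rw [Finset.sum_eq_zero, smul_zero]
  intro B hB
  have hA' : (if rowSum A.1 = rowSum C.1 then ξ.1 A else 0) ≠ 0 := Finsupp.mem_support_iff.1 hA
  have hB' : (if colSum B.1 = colSum C.1 then η.1 B else 0) ≠ 0 := Finsupp.mem_support_iff.1 hB
  simp only [ne_eq, ite_eq_right_iff, Classical.not_imp] at hA' hB'
  by_cases hc : basisMul A B C = 0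
  · rw [hc, smul_zero]
  · refine (hne ⟨A, B, hA'.1, hA'.2, ?_, hB'.1, hB'.2, Finsupp.mem_support_iff.2 hc⟩).elim
    by_contra hAB
    exact hc (by rw [basisMul, dif_neg (fun h => hAB h.1)]; rfl)

theorem mulCoeff_mem {n : ℕ} (ξ η : KHat n) : mulCoeff ξ η ∈ locallyFinite n := by
  classical
  intro t
  constructor
  · refine ((ξ.2 t).1.biUnion fun A _ => (η.2 (colSum A.1)).1.biUnion fun B _ =>
      (basisMul A B).support.finite_toSet).subset ?_
    rintro C ⟨h1, h2⟩
    obtain ⟨A, B, a1, a2, a3, a4, a5, a6⟩ := exists_of_mulCoeff_ne_zero ξ η C h2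
    simp only [Set.mem_iUnion]
    exact ⟨A, ⟨a1.trans h1, a2⟩, B, ⟨a3.symm, a5⟩, a6⟩
  · refine ((η.2 t).2.biUnion fun B _ => (ξ.2 (rowSum B.1)).2.biUnion fun A _ =>
      (basisMul A B).support.finite_toSet).subset ?_
    rintro C ⟨h1, h2⟩
    obtain ⟨A, B, a1, a2, a3, a4, a5, a6⟩ := exists_of_mulCoeff_ne_zero ξ η C h2
    simp only [Set.mem_iUnion]
    exact ⟨B, ⟨a4.trans h1, a5⟩, A, ⟨a3, a2⟩, a6⟩

/-- The product of `K̂`. -/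
instance (n : ℕ) : Mul (KHat n) := ⟨fun ξ η => ⟨mulCoeff ξ η, mulCoeff_mem ξ η⟩⟩

theorem KHat.ext {n : ℕ} {ξ η : KHat n} (h : ∀ C, ξ.1 C = η.1 C) : ξ = η :=
  Subtype.ext (funext h)

instance (n : ℕ) : NonUnitalNonAssocRing (KHat n) :=
  { (inferInstance : AddCommGroup (KHat n)), (inferInstance : Mul (KHat n)) with
    left_distrib := fun ξ η ζ => KHat.ext fun C => by
      change mulCoeff ξ (η + ζ) C = mulCoeff ξ η C + mulCoeff ξ ζ C
      simp [mulCoeff]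
    right_distrib := fun ξ η ζ => KHat.ext fun C => by
      change mulCoeff (ξ + η) ζ C = mulCoeff ξ ζ C + mulCoeff η ζ C
      simp [mulCoeff]
    zero_mul := fun ξ => KHat.ext fun C => by
      change mulCoeff 0 ξ C = 0
      simp [mulCoeff]
    mul_zero := fun ξ => KHat.ext fun C => by
      change mulCoeff ξ 0 C = 0
      simp [mulCoeff] }

instance (n : ℕ) : IsScalarTower Kv (KHat n) (KHat n) := ⟨fun c ξ η => KHat.ext fun C => by
  change mulCoeff (c • ξ) η C = c * mulCoeff ξ η C
  simp [mulCoeff]⟩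

instance (n : ℕ) : SMulCommClass Kv (KHat n) (KHat n) := ⟨fun c ξ η => KHat.ext fun C => by
  change c * mulCoeff ξ η C = mulCoeff ξ (c • η) C
  simp [mulCoeff]⟩

/-! ### The elements `Â(j)` and the subalgebra `U` -/

/-- `Θ⁰`: the matrices in `Θ̃` with zero diagonal. -/
def ThetaZero (n : ℕ) : Type := {A : ThetaTilde n // ∀ i, A.1 i i = 0}

theorem hatElem_mem {n : ℕ} (A : ThetaZero n) (j : Fin n → ℤ) :
    (fun B : ThetaTilde n => if B.1 = A.1.1 + Matrix.diagonal (fun i => B.1 i i)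
      then vv ^ (∑ i, B.1 i i * j i) else 0) ∈ locallyFinite n := by
  intro t
  constructor
  · refine Set.Subsingleton.finite ?_
    rintro B ⟨h1, h2⟩ C ⟨h3, h4⟩
    have hB : B.1 = A.1.1 + Matrix.diagonal (fun i => B.1 i i) := by
      by_contra h; exact h2 (if_neg h)
    have hC : C.1 = A.1.1 + Matrix.diagonal (fun i => C.1 i i) := by
      by_contra h; exact h4 (if_neg h)
    have key : ∀ i, B.1 i i = C.1 i i := by
      intro i
      have h5 : rowSum B.1 i = rowSum C.1 i := by rw [h1, h3]
      rw [hB, hC] at h5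
      simpa [rowSum, Finset.sum_add_distrib, Matrix.diagonal_apply] using h5
    exact Subtype.ext (by rw [hB, hC]; simp only [key])
  · refine Set.Subsingleton.finite ?_
    rintro B ⟨h1, h2⟩ C ⟨h3, h4⟩
    have hB : B.1 = A.1.1 + Matrix.diagonal (fun i => B.1 i i) := by
      by_contra h; exact h2 (if_neg h)
    have hC : C.1 = A.1.1 + Matrix.diagonal (fun i => C.1 i i) := by
      by_contra h; exact h4 (if_neg h)
    have key : ∀ i, B.1 i i = C.1 i i := by
      intro i
      have h5 : colSum B.1 i = colSum C.1 i := by rw [h1, h3]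
      rw [hB, hC] at h5
      simpa [colSum, Finset.sum_add_distrib, Matrix.diagonal_apply] using h5
    exact Subtype.ext (by rw [hB, hC]; simp only [key])

/-- `Â(j) = ∑_{λ ∈ ℤ^n} v^{λ_1 j_1 + ⋯ + λ_n j_n} [Â + D_λ]`, for `Â ∈ Θ⁰` and `j ∈ ℤ^n`. -/
def hatElem {n : ℕ} (A : ThetaZero n) (j : Fin n → ℤ) : KHat n :=
  ⟨fun B => if B.1 = A.1.1 + Matrix.diagonal (fun i => B.1 i i)
    then vv ^ (∑ i, B.1 i i * j i) else 0, hatElem_mem A j⟩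

/-- The zero matrix as an element of `Θ⁰`. -/
def zeroMat (n : ℕ) : ThetaZero n := ⟨⟨0, by intro i j _; simp⟩, by intro i; simp⟩

/-- The matrix unit `E_{ij}`, `i ≠ j`, as an element of `Θ⁰`. -/
def unitMat {n : ℕ} (i j : Fin n) (h : i ≠ j) : ThetaZero n :=
  ⟨⟨Matrix.single i j 1, by
    intro a b _
    rw [Matrix.single_apply]
    split_ifs <;> simp⟩, by
    intro a
    change Matrix.single i j (1 : ℤ) a a = 0
    rw [Matrix.single_apply, if_neg]
    rintro ⟨rfl, rfl⟩
    exact h rfl⟩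

/-- The unit `∑_λ [D_λ]` of `K̂`. -/
instance (n : ℕ) : One (KHat n) := ⟨hatElem (zeroMat n) 0⟩

/-- The elements `t̄_{ij} = -(v⁻¹ - v) E_{ij}(i)` for `i < j`, `t̄_{ii} = 0(i)`, and `t̄_{ij} = 0`
for `i > j`, of `K̂`; the argument `(i)` is the `i`-th unit vector of `ℤ^n`. -/
def tBar {n : ℕ} (i j : Fin n) : KHat n :=
  if h : i < j then (-(vv⁻¹ - vv)) • hatElem (unitMat i j h.ne) (Pi.single i 1)
  else if i = j then hatElem (zeroMat n) (Pi.single i 1)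
  else 0

/-- The (unital) subalgebra `U` of `K̂` generated by the `t̄_{ij}`. -/
def calU (n : ℕ) : NonUnitalSubalgebra Kv (KHat n) :=
  NonUnitalAlgebra.adjoin Kv (insert 1 (Set.range fun p : Fin n × Fin n => tBar p.1 p.2))

/-! ### The algebra `U_v(gl_n)` in its RTT presentation and its positive part -/

/-- `δ_p`: equal to `1` if `p` holds, and to `0` otherwise. -/
def delta (p : Prop) [Decidable p] : Kv := if p then 1 else 0

/-- `q^{δ_{ij}}`. -/
def powDelta {n : ℕ} (q : Kv) (i j : Fin n) : Kv := if i = j then q else 1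

/-- The generators `t_{ij}` and `t̄_{ij}` of `U_v(gl_n)`. -/
inductive RTTGen (n : ℕ) : Type
  | t (i j : Fin n) : RTTGen n
  | tbar (i j : Fin n) : RTTGen n

namespace RTTGen

/-- `t_{ij}` in the free algebra. -/
def T {n : ℕ} (i j : Fin n) : FreeAlgebra Kv (RTTGen n) := FreeAlgebra.ι Kv (t i j)

/-- `t̄_{ij}` in the free algebra. -/
def Tb {n : ℕ} (i j : Fin n) : FreeAlgebra Kv (RTTGen n) := FreeAlgebra.ι Kv (tbar i j)

end RTTGen

open RTTGen in
/-- The defining relations of `U_v(gl_n)`. -/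
inductive UvRel (n : ℕ) : FreeAlgebra Kv (RTTGen n) → FreeAlgebra Kv (RTTGen n) → Prop
  | t_zero (i j : Fin n) (h : i < j) : UvRel n (T i j) 0
  | tbar_zero (i j : Fin n) (h : i < j) : UvRel n (Tb j i) 0
  | tt (i a j b : Fin n) : UvRel n
      (powDelta vv i j • (T i a * T j b) - powDelta vv a b • (T j b * T i a))
      (((vv - vv⁻¹) * (delta (b < a) - delta (i < j))) • (T j a * T i b))
  | bb (i a j b : Fin n) : UvRel n
      (powDelta vv i j • (Tb i a * Tb j b) - powDelta vv a b • (Tb j b * Tb i a))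
      (((vv - vv⁻¹) * (delta (b < a) - delta (i < j))) • (Tb j a * Tb i b))
  | bt (i a j b : Fin n) : UvRel n
      (powDelta vv i j • (Tb i a * T j b) - powDelta vv a b • (T j b * Tb i a))
      ((vv - vv⁻¹) • (delta (b < a) • (T j a * Tb i b) - delta (i < j) • (Tb j a * T i b)))

/-- The algebra `U_v(gl_n)` over `ℚ(v)`. -/
abbrev UvGl (n : ℕ) : Type := RingQuot (UvRel n)

/-- The generator `t̄_{ij}` of `U_v(gl_n)`. -/
def UvGl.tbar {n : ℕ} (i j : Fin n) : UvGl n := RingQuot.mkAlgHom Kv (UvRel n) (RTTGen.Tb i j)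

/-- The positive part `U_v(gl_n)⁺`: the subalgebra generated by the `t̄_{ij}`. -/
def UPlus (n : ℕ) : Subalgebra Kv (UvGl n) :=
  Algebra.adjoin Kv (Set.range fun p : Fin n × Fin n => UvGl.tbar p.1 p.2)

/-- `t̄_{ij}` as an element of the positive part. -/
def UPlus.tbar {n : ℕ} (i j : Fin n) : UPlus n :=
  ⟨UvGl.tbar i j, Algebra.subset_adjoin ⟨(i, j), rfl⟩⟩

/-- The RTT relations, with parameter `q`, between generators `x_{ij}` with `x_{ij} = 0` for
`i > j`. -/
inductive RTTPlusRel (n : ℕ) (q : Kv) :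
    FreeAlgebra Kv (Fin n × Fin n) → FreeAlgebra Kv (Fin n × Fin n) → Prop
  | zero (i j : Fin n) (h : i < j) : RTTPlusRel n q (FreeAlgebra.ι Kv (j, i)) 0
  | rtt (i a j b : Fin n) : RTTPlusRel n q
      (powDelta q i j • (FreeAlgebra.ι Kv (i, a) * FreeAlgebra.ι Kv (j, b)) -
        powDelta q a b • (FreeAlgebra.ι Kv (j, b) * FreeAlgebra.ι Kv (i, a)))
      (((q - q⁻¹) * (delta (b < a) - delta (i < j))) •
        (FreeAlgebra.ι Kv (j, a) * FreeAlgebra.ι Kv (i, b)))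

/-- The algebra presented by the RTT relations of the positive part, with parameter `q`. -/
abbrev RTTPlus (n : ℕ) (q : Kv) : Type := RingQuot (RTTPlusRel n q)

/-- The generator `x_{ij}`. -/
def RTTPlus.gen {n : ℕ} (q : Kv) (i j : Fin n) : RTTPlus n q :=
  RingQuot.mkAlgHom Kv (RTTPlusRel n q) (FreeAlgebra.ι Kv (i, j))

end

/-! Everything takes place among upper triangular matrices. If the matrix of a pair of flags (V, V')
is upper triangular, then V'_t ⊆ V_t for all t, and its off-diagonal part A, an element of `Idx n`,
is what multiplication depends on. Over a finite field the 0-1 matrices `relMat F d A`, indexed by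
pairs of flags, multiply like a Hall algebra: the structure constants are integral polynomials in q
that do not depend on d (`relMat_mul`). Only the product with a simple root element E_{h,h+1} is
counted directly, by counting one-dimensional enlargements of one space of a flag
(`relMat_mul_unitIdx`). The other products follow by induction on the right factor
(`hasHall_single`). This requires division by quantum integers, which is possible because these are
monic. Associativity is that of matrix multiplication. For upper triangular matrices stabilization
is trivial. The diagonal of the middle matrices is forced by the row sums, so the counts are the
Hall polynomials for every p. The exponent `dimDiff` is affine in the diagonal with slope `deg`, and
`deg` is additive in products, so the powers of v that depend on p cancel and the G_Z are constant.
In the completion the elements `rElem A m` therefore multiply by Hall polynomials at q = v², up to a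
twist by a power of v (`rElem_mul`). They are linearly independent, by Dedekind's theorem on
characters. So an associative algebra `TwHall`, with basis the pairs (A, m), embeds into the
completion (`TwHall.toKHat_injective`), and each t̄_{ij} is zero or a scalar times a torus element
times a root element. The presentation is then a PBW argument. From E_{i,h+1} = [E_{ih}, E_{h,h+1}]
all commutation relations of root elements follow by induction on the column; after the twist they
become the RTT relations with parameter v⁻¹ (`TwHall.isRTT_tt`). Conversely, the RTT relations alone
sort every word into monomials whose columns decrease from left to right (`IsRTT.span_rttMonomial`).
In `TwHall` each nonvanishing sorted monomial is a nonzero multiple of a basis element of its own,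
because multiplying an element supported in columns ≥ a by E_{ia} on the right gives a single term
(`TwHall.hx_mul_root`). Hence the presented algebra embeds into `TwHall`, and its image in the
completion is U. For U_v(gl_n)⁺, sending all t_{ij} to 0 respects the relations, so the subalgebra
generated by the t̄_{ij} satisfies no relations beyond the RTT relations with parameter v.
Reflection along the antidiagonal exchanges rows and columns and turns the parameter v into v⁻¹
(`IsRTT.reflect`). -/

open Polynomial

noncomputable section
variable {n : ℕ}

/-! ### Off-diagonal data of upper triangular matrices -/

/-- The pairs `i < j` of indices. -/
abbrev UPair (n : ℕ) : Type := {p : Fin n × Fin n // p.1 < p.2}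

/-- The off-diagonal parts of the upper triangular matrices with off-diagonal entries in `ℕ`. -/
abbrev Idx (n : ℕ) : Type := UPair n → ℕ

/-- The `(i, j)` entry of the strictly upper triangular matrix `A`. -/
def ent (A : Idx n) (i j : Fin n) : ℕ := if h : i < j then A ⟨(i, j), h⟩ else 0

/-- The pair `(i, j)`. -/
abbrev upair (i j : Fin n) (h : i < j) : UPair n := ⟨(i, j), h⟩

/-- The matrix unit at the pair `p`. -/
abbrev unitIdx (p : UPair n) : Idx n := Pi.single p 1

theorem ent_of_lt (A : Idx n) {i j : Fin n} (h : i < j) : ent A i j = A (upair i j h) := dif_pos h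

theorem ent_of_not_lt (A : Idx n) {i j : Fin n} (h : ¬ i < j) : ent A i j = 0 := dif_neg h

theorem ent_add (A B : Idx n) (i j : Fin n) : ent (A + B) i j = ent A i j + ent B i j := by
  unfold ent; split_ifs <;> simp

@[simp] theorem ent_zero (i j : Fin n) : ent (0 : Idx n) i j = 0 := by
  unfold ent; split_ifs <;> simp

theorem ent_single (p : UPair n) (c : ℕ) (i j : Fin n) :
    ent (Pi.single p c) i j = if i = p.1.1 ∧ j = p.1.2 then c else 0 := by
  obtain ⟨⟨a, b⟩, hab⟩ := p
  by_cases h : i < j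
  · rw [ent_of_lt _ h, Pi.single_apply]
    simp [upair, Subtype.ext_iff, Prod.ext_iff]
  · rw [ent_of_not_lt _ h, if_neg]
    rintro ⟨rfl, rfl⟩
    exact h hab

theorem Idx.ext_ent {A B : Idx n} (h : ∀ i j, i < j → ent A i j = ent B i j) : A = B := by
  funext p
  have := h p.1.1 p.1.2 p.2
  rwa [ent_of_lt _ p.2, ent_of_lt _ p.2] at this

/-- `Z` is upper triangular with off-diagonal part `A`. -/
def IsOff (Z : Matrix (Fin n) (Fin n) ℤ) (A : Idx n) : Prop := ∀ i j, i ≠ j → Z i j = ent A i j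

theorem IsOff.unique {Z : Matrix (Fin n) (Fin n) ℤ} {A B : Idx n} (hA : IsOff Z A)
    (hB : IsOff Z B) : A = B :=
  Idx.ext_ent fun i j h => by
    have := (hA i j h.ne).symm.trans (hB i j h.ne)
    exact_mod_cast this

/-- The sum of the entries in the rows `< t` and the columns `≥ t`. -/
def deg (A : Idx n) (t : Fin (n + 1)) : ℤ :=
  ∑ k : Fin n, ∑ l : Fin n, if k.castSucc < t ∧ t ≤ l.castSucc then (ent A k l : ℤ) else 0

/-! ### Relative positions of flags -/

theorem Fin.sum_ite_lt_sub (f : Fin (n + 1) → ℤ) (j : Fin (n + 1)) :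
    (∑ l : Fin n, if l.castSucc < j then f l.succ - f l.castSucc else 0) = f j - f 0 := by
  induction n with
  | zero =>
    obtain rfl : j = 0 := Fin.ext (by omega)
    simp
  | succ n ih =>
    rw [Fin.sum_univ_castSucc]
    induction j using Fin.lastCases with
    | last =>
      have := ih (fun t => f t.castSucc) (Fin.last n)
      simp only [Fin.castSucc_lt_last, if_true, Fin.succ_castSucc, Fin.succ_last] at this ⊢
      rw [this]
      simp
    | cast j =>
      have := ih (fun t => f t.castSucc) j
      simp only [Fin.castSucc_lt_castSucc_iff, Fin.succ_castSucc] at this ⊢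
      rw [this, if_neg (by simpa using Fin.le_last j)]
      simp

section Flags

variable {F : Type} [Field F] {d : ℕ}

/-- `dim (V_i ∩ V'_j)`. -/
def rk (V V' : NStepFlag F n d) (i j : Fin (n + 1)) : ℤ :=
  Module.finrank F ↥(V.space i ⊓ V'.space j)

theorem NStepFlag.ext {V V' : NStepFlag F n d} (h : ∀ i, V.space i = V'.space i) : V = V' := by
  obtain ⟨f, _, _, _⟩ := V
  obtain ⟨g, _, _, _⟩ := V'
  obtain rfl : f = g := funext h
  rfl

theorem rk_last_right (V V' : NStepFlag F n d) (i : Fin (n + 1)) :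
    rk V V' i (Fin.last n) = Module.finrank F (V.space i) := by
  rw [rk, V'.top, inf_top_eq]

theorem rk_last_left (V V' : NStepFlag F n d) (i : Fin (n + 1)) :
    rk V V' (Fin.last n) i = Module.finrank F (V'.space i) := by
  rw [rk, V.top, top_inf_eq]

theorem rk_zero_left (V V' : NStepFlag F n d) (i : Fin (n + 1)) : rk V V' 0 i = 0 := by
  rw [rk, V.bot, bot_inf_eq, finrank_bot]; rfl

theorem rk_zero_right (V V' : NStepFlag F n d) (i : Fin (n + 1)) : rk V V' i 0 = 0 := by
  rw [rk, V'.bot, inf_bot_eq, finrank_bot]; rfl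

/-- Inclusion-exclusion for dimensions, together with V_{i-1} ∩ V_i = V_{i-1}, makes the matrix the
second difference of (i, j) ↦ dim (V_i ∩ V'_j). Later computations are done with `rk` and
differenced at the end. -/
theorem relPos_eq (V V' : NStepFlag F n d) (i j : Fin n) :
    relPos V V' i j = (rk V V' i.succ j.succ - rk V V' i.castSucc j.succ) -
      (rk V V' i.succ j.castSucc - rk V V' i.castSucc j.castSucc) := by
  have key : ∀ W : Submodule F (Fin d → F),
      (Module.finrank F ↥(V.space i.castSucc ⊔ (V.space i.succ ⊓ W)) : ℤ) =
        Module.finrank F (V.space i.castSucc) + Module.finrank F ↥(V.space i.succ ⊓ W) -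
          Module.finrank F ↥(V.space i.castSucc ⊓ W) := by
    intro W
    have h := Submodule.finrank_sup_add_finrank_inf_eq (V.space i.castSucc) (V.space i.succ ⊓ W)
    rw [← inf_assoc, inf_eq_left.2 (V.mono (Fin.castSucc_lt_succ).le)] at h
    omega
  rw [relPos, key, key]
  simp only [rk]
  ring

theorem relPos_nonneg (V V' : NStepFlag F n d) (i j : Fin n) : 0 ≤ relPos V V' i j := by
  rw [relPos, sub_nonneg, Nat.cast_le]
  exact Submodule.finrank_mono (sup_le_sup_left
    (inf_le_inf_left _ (V'.mono (Fin.castSucc_lt_succ).le)) _)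

theorem rk_eq_sum (V V' : NStepFlag F n d) (i j : Fin (n + 1)) :
    rk V V' i j = ∑ k : Fin n, ∑ l : Fin n,
      if k.castSucc < i ∧ l.castSucc < j then relPos V V' k l else 0 := by
  have h1 : ∀ k : Fin n, (∑ l : Fin n,
      if k.castSucc < i ∧ l.castSucc < j then relPos V V' k l else 0) =
      if k.castSucc < i then rk V V' k.succ j - rk V V' k.castSucc j else 0 := by
    intro k
    by_cases hk : k.castSucc < i
    · simp only [hk, true_and, if_true, relPos_eq]
      have := Fin.sum_ite_lt_sub (fun l => rk V V' k.succ l - rk V V' k.castSucc l) j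
      rw [this]
      simp [rk_zero_right]
    · simp [hk]
  simp only [h1]
  rw [Fin.sum_ite_lt_sub (fun k => rk V V' k j), rk_zero_left, sub_zero]

theorem finrank_left_eq_sum (V V' : NStepFlag F n d) (t : Fin (n + 1)) :
    (Module.finrank F (V.space t) : ℤ) = ∑ k : Fin n, ∑ l : Fin n,
      if k.castSucc < t then relPos V V' k l else 0 := by
  rw [← rk_last_right V V', rk_eq_sum]
  simp [Fin.castSucc_lt_last]

theorem finrank_right_eq_sum (V V' : NStepFlag F n d) (t : Fin (n + 1)) :
    (Module.finrank F (V'.space t) : ℤ) = ∑ k : Fin n, ∑ l : Fin n,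
      if l.castSucc < t then relPos V V' k l else 0 := by
  rw [← rk_last_left V V', rk_eq_sum]
  simp [Fin.castSucc_lt_last]

theorem rowSum_relPos (V V' : NStepFlag F n d) (i : Fin n) :
    rowSum (relPos V V') i =
      (Module.finrank F (V.space i.succ) : ℤ) - Module.finrank F (V.space i.castSucc) := by
  have := Fin.sum_ite_lt_sub (fun l => rk V V' i.succ l - rk V V' i.castSucc l) (Fin.last n)
  simp only [Fin.castSucc_lt_last, if_true] at this
  simp only [rowSum, relPos_eq]
  rw [this]
  simp [rk_zero_right, rk_last_right]

theorem colSum_relPos (V V' : NStepFlag F n d) (j : Fin n) :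
    colSum (relPos V V') j =
      (Module.finrank F (V'.space j.succ) : ℤ) - Module.finrank F (V'.space j.castSucc) := by
  have := Fin.sum_ite_lt_sub (fun k => rk V V' k j.succ - rk V V' k j.castSucc) (Fin.last n)
  simp only [Fin.castSucc_lt_last, if_true] at this
  simp only [colSum, relPos_eq]
  trans ∑ x : Fin n, (rk V V' x.succ j.succ - rk V V' x.succ j.castSucc -
    (rk V V' x.castSucc j.succ - rk V V' x.castSucc j.castSucc))
  · exact Finset.sum_congr rfl fun _ _ => by ring
  rw [this]
  simp [rk_zero_left, rk_last_left]

/-- Without entries below the diagonal, the columns left of t have entries only in the rows above t,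
so dim (V_t ∩ V'_t) already equals dim V'_t. -/
theorem IsOff.space_le {V V' : NStepFlag F n d} {A : Idx n} (h : IsOff (relPos V V') A)
    (t : Fin (n + 1)) : V'.space t ≤ V.space t := by
  have h1 : (Module.finrank F (V'.space t) : ℤ) = rk V V' t t := by
    rw [finrank_right_eq_sum V V', rk_eq_sum]
    refine Finset.sum_congr rfl fun k _ => Finset.sum_congr rfl fun l _ => ?_
    by_cases hl : l.castSucc < t
    · by_cases hk : k.castSucc < t
      · simp [hl, hk]
      · have hlk : l < k := Fin.castSucc_lt_castSucc_iff.1 (hl.trans_le (not_lt.1 hk))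
        rw [if_pos hl, if_neg (by simp [hk]), h k l hlk.ne', ent_of_not_lt _ hlk.not_gt]
        rfl
    · simp [hl]
  have h2 : V.space t ⊓ V'.space t = V'.space t := by
    apply Submodule.eq_of_le_of_finrank_eq inf_le_right
    rw [rk] at h1
    exact_mod_cast h1.symm
  exact inf_eq_right.1 h2

/-- The codimension of V'_t in V_t is the sum over the upper right block of A at t. Being a
difference of dimensions, it is additive along chains V, V'', V'. -/
theorem IsOff.finrank_eq {V V' : NStepFlag F n d} {A : Idx n} (h : IsOff (relPos V V') A)
    (t : Fin (n + 1)) :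
    (Module.finrank F (V.space t) : ℤ) = Module.finrank F (V'.space t) + deg A t := by
  rw [finrank_right_eq_sum V V', finrank_left_eq_sum V V', deg, ← Finset.sum_add_distrib]
  refine Finset.sum_congr rfl fun k _ => ?_
  rw [← Finset.sum_add_distrib]
  refine Finset.sum_congr rfl fun l _ => ?_
  by_cases hl : l.castSucc < t
  · by_cases hk : k.castSucc < t
    · simp [hl, hk]
    · have hlk : l < k := Fin.castSucc_lt_castSucc_iff.1 (hl.trans_le (not_lt.1 hk))
      rw [if_pos hl, if_neg hk, h k l hlk.ne', ent_of_not_lt _ hlk.not_gt]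
      simp
  · by_cases hk : k.castSucc < t
    · have hlk : k < l := Fin.castSucc_lt_castSucc_iff.1 (hk.trans_le (not_lt.1 hl))
      rw [if_pos hk, if_neg hl, if_pos ⟨hk, not_lt.1 hl⟩, h k l hlk.ne, zero_add]
    · simp [hl, hk]

theorem isOff_zero_iff {V V' : NStepFlag F n d} : IsOff (relPos V V') 0 ↔ V = V' := by
  constructor
  · intro h
    refine NStepFlag.ext fun t => (Submodule.eq_of_le_of_finrank_eq (h.space_le t) ?_).symm
    have := h.finrank_eq t
    simp only [deg, ent_zero] at this
    simp at this
    omega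
  · rintro rfl i j hij
    have hr : ∀ a b, rk V V a b = Module.finrank F (V.space (min a b)) := by
      intro a b
      rw [rk]
      rcases le_total a b with h | h
      · rw [min_eq_left h, inf_eq_left.2 (V.mono h)]
      · rw [min_eq_right h, inf_eq_right.2 (V.mono h)]
    rw [relPos_eq, hr, hr, hr, hr, ent_zero]
    rcases hij.lt_or_gt with h | h
    · have h1 : i.succ ≤ j.castSucc := Fin.succ_le_castSucc_iff.2 h
      have h2 := Fin.castSucc_lt_succ (i := i)
      have h3 := Fin.castSucc_lt_succ (i := j)
      rw [min_eq_left (h1.trans h3.le), min_eq_left (h2.le.trans (h1.trans h3.le)),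
        min_eq_left h1, min_eq_left (h2.le.trans h1)]
      simp
    · have h1 : j.succ ≤ i.castSucc := Fin.succ_le_castSucc_iff.2 h
      have h2 := Fin.castSucc_lt_succ (i := i)
      have h3 := Fin.castSucc_lt_succ (i := j)
      rw [min_eq_right (h1.trans h2.le), min_eq_right h1, min_eq_right (h3.le.trans (h1.trans h2.le)),
        min_eq_right (h3.le.trans h1)]
      simp

end Flags

/-! ### Coordinate flags -/

section Coordinate

variable (F : Type) [Field F] {d : ℕ}

/-- The vectors of `F^d` supported in `S`. -/
def coordSub (S : Set (Fin d)) : Submodule F (Fin d → F) where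
  carrier := {x | ∀ a ∉ S, x a = 0}
  zero_mem' := fun _ _ => rfl
  add_mem' := fun hx hy a ha => by simp [hx a ha, hy a ha]
  smul_mem' := fun c x hx a ha => by simp [hx a ha]

theorem coordSub_inf (S T : Set (Fin d)) : coordSub F S ⊓ coordSub F T = coordSub F (S ∩ T) := by
  ext x
  constructor
  · rintro ⟨h1, h2⟩ a ha
    by_cases h : a ∈ S
    · exact h2 a fun h' => ha ⟨h, h'⟩
    · exact h1 a h
  · intro h
    exact ⟨fun a ha => h a fun h' => ha h'.1, fun a ha => h a fun h' => ha h'.2⟩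

open Classical in
theorem finrank_coordSub (S : Set (Fin d)) :
    (Module.finrank F (coordSub F S) : ℤ) = ∑ a, if a ∈ S then 1 else 0 := by
  have e : coordSub F S ≃ₗ[F] (S → F) :=
    { toFun := fun x a => x.1 a.1
      map_add' := fun _ _ => rfl
      map_smul' := fun _ _ => rfl
      invFun := fun y => ⟨fun a => if h : a ∈ S then y ⟨a, h⟩ else 0, fun a ha => dif_neg ha⟩
      left_inv := fun x => by
        ext a
        by_cases h : a ∈ S
        · simp [h]
        · simp [h, x.2 a h]
      right_inv := fun y => by
        ext a
        simp }
  rw [e.finrank_eq, Module.finrank_fintype_fun_eq_card, Finset.sum_boole]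
  simp [Fintype.card_subtype]

/-- The flag of coordinate subspaces given by a map `Fin d → Fin n`. -/
def coordFlag (f : Fin d → Fin n) : NStepFlag F n d where
  space t := coordSub F {a | (f a).castSucc < t}
  mono s t hst x hx a ha := hx a fun h => ha (lt_of_lt_of_le h hst)
  bot := by
    rw [eq_bot_iff]
    intro x hx
    rw [Submodule.mem_bot]
    funext a
    exact hx a (by simp)
  top := by
    rw [eq_top_iff]
    intro x _ a ha
    exact (ha (Fin.castSucc_lt_last _)).elim

/-- The dimension of an intersection counts the coordinates a with f a < s and g a < t; the second
difference of this product of indicators is the indicator of f a = i, g a = j. -/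
theorem relPos_coordFlag (f g : Fin d → Fin n) (i j : Fin n) :
    relPos (coordFlag F f) (coordFlag F g) i j =
      Fintype.card {a // f a = i ∧ g a = j} := by
  classical
  have key : ∀ s t, rk (coordFlag F f) (coordFlag F g) s t =
      ∑ a, (if (f a).castSucc < s then 1 else 0) * (if (g a).castSucc < t then 1 else 0) := by
    intro s t
    rw [rk]
    change (Module.finrank F ↥(coordSub F _ ⊓ coordSub F _) : ℤ) = _
    rw [coordSub_inf, finrank_coordSub]
    refine Finset.sum_congr rfl fun a _ => ?_
    simp only [Set.mem_inter_iff, Set.mem_ofPred_eq, ite_and, mul_ite, mul_one, mul_zero]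
    split_ifs <;> rfl
  have h1 : ∀ a i : Fin n, (if a.castSucc < i.succ then (1 : ℤ) else 0) -
      (if a.castSucc < i.castSucc then 1 else 0) = if a = i then 1 else 0 := by
    intro a i
    simp only [Fin.castSucc_lt_castSucc_iff, Fin.castSucc_lt_succ_iff]
    rcases lt_trichotomy a i with h | h | h
    · simp [h, h.le, h.ne]
    · simp [h]
    · simp [h.not_ge, h.not_gt, h.ne']
  rw [relPos_eq, key, key, key, key, ← Finset.sum_sub_distrib, ← Finset.sum_sub_distrib,
    ← Finset.sum_sub_distrib, Fintype.card_subtype, ← Finset.sum_boole]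
  refine Finset.sum_congr rfl fun a _ => ?_
  have := congrArg₂ (· * ·) (h1 (f a) i) (h1 (g a) j)
  simp only [mul_ite, mul_one, mul_zero] at this
  refine Eq.trans (by ring) (this.trans ?_)
  split_ifs <;> simp_all

/-- Every matrix in `Θ_d` is the matrix of a pair of flags. -/
theorem exists_relPos_eq {C : Matrix (Fin n) (Fin n) ℤ} (h : IsTheta d C) :
    ∃ V V' : NStepFlag F n d, relPos V V' = C := by
  classical
  -- The coordinates are distributed over the cells of C, with C i j of them in the cell (i, j); the
  -- two flags are read off from the row and the column of each coordinate.
  have hcard : Fintype.card (Fin d) =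
      Fintype.card (Σ p : Fin n × Fin n, Fin (C p.1 p.2).toNat) := by
    rw [Fintype.card_fin, Fintype.card_sigma]
    simp only [Fintype.card_fin]
    have h2 := h.2
    rw [← Fintype.sum_prod_type' (f := fun i j => C i j)] at h2
    zify
    rw [← h2]
    exact Finset.sum_congr rfl fun p _ => (Int.toNat_of_nonneg (h.1 _ _)).symm
  let e := Fintype.equivOfCardEq hcard
  refine ⟨coordFlag F fun a => (e a).1.1, coordFlag F fun a => (e a).1.2, ?_⟩
  ext i j
  rw [relPos_coordFlag]
  have e2 : {a // (e a).1.1 = i ∧ (e a).1.2 = j} ≃ Fin (C i j).toNat :=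
    { toFun := fun a => (finCongr (by rw [a.2.1, a.2.2])) (e a.1).2
      invFun := fun b => ⟨e.symm ⟨(i, j), b⟩, by simp⟩
      left_inv := by
        rintro ⟨a, rfl, rfl⟩
        exact Subtype.ext (e.symm_apply_eq.2 rfl)
      right_inv := by
        intro b
        ext
        simp only [finCongr_apply, Fin.val_cast]
        rw [Equiv.apply_symm_apply] }
  rw [Fintype.card_congr e2, Fintype.card_fin, Int.toNat_of_nonneg (h.1 _ _)]

end Coordinate

/-! ### Counting the one-dimensional enlargements of a subspace -/

section Lines

variable {F : Type} [Field F] {E : Type} [AddCommGroup E] [Module F E] [Finite E]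

theorem natCard_sdiff {Y X : Submodule F E} (h : Y ≤ X) :
    (Nat.card {x // x ∈ X ∧ x ∉ Y} : ℤ) = Nat.card X - Nat.card Y := by
  classical
  have := Fintype.ofFinite E
  have e := Set.ncard_sdiff_add_ncard_of_subset (s := (Y : Set E)) (t := X) h
  have h1 : Nat.card {x // x ∈ X ∧ x ∉ Y} = ((X : Set E) \ Y).ncard := rfl
  have h2 : Nat.card X = (X : Set E).ncard := rfl
  have h3 : Nat.card Y = (Y : Set E).ncard := rfl
  omega

theorem sup_span_singleton_eq {U L : Submodule F E} (hU : U ≤ L)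
    (hL : Module.finrank F L = Module.finrank F U + 1) {x : E} (hx : x ∈ L) (hxU : x ∉ U) :
    U ⊔ Submodule.span F {x} = L := by
  have : FiniteDimensional F E := Module.Finite.of_finite
  have hle : U ⊔ Submodule.span F {x} ≤ L :=
    sup_le hU ((Submodule.span_singleton_le_iff_mem x L).2 hx)
  refine Submodule.eq_of_le_of_finrank_le hle ?_
  have hlt : U < U ⊔ Submodule.span F {x} := by
    refine lt_of_le_of_ne le_sup_left fun h => hxU ?_
    rw [h]
    exact Submodule.mem_sup_right (Submodule.mem_span_singleton_self x)
  have := Submodule.finrank_lt_finrank_of_lt hlt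
  omega

theorem finrank_sup_span_singleton {U : Submodule F E} {x : E} (hxU : x ∉ U) :
    Module.finrank F ↥(U ⊔ Submodule.span F {x}) = Module.finrank F U + 1 := by
  have : FiniteDimensional F E := Module.Finite.of_finite
  have hlt : U < U ⊔ Submodule.span F {x} := by
    refine lt_of_le_of_ne le_sup_left fun h => hxU ?_
    rw [h]
    exact Submodule.mem_sup_right (Submodule.mem_span_singleton_self x)
  have h1 := Submodule.finrank_lt_finrank_of_lt hlt
  have h2 := Submodule.finrank_add_le_finrank_add_finrank U (Submodule.span F {x})
  have h3 : Module.finrank F (Submodule.span F {x}) = 1 :=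
    finrank_span_singleton fun h => hxU (h ▸ U.zero_mem)
  omega

/-- The subspaces `L` with `U ≤ L ≤ X`, `dim L = dim U + 1` and not `L ≤ Y`. -/
def LineOver (U Y X : Submodule F E) : Type :=
  {L : Submodule F E // U ≤ L ∧ Module.finrank F L = Module.finrank F U + 1 ∧ L ≤ X ∧ ¬ L ≤ Y}

/-- A vector of `X \ Y` is a vector of `L \ U` for a unique `L`. -/
def lineOverEquiv {U Y X : Submodule F E} (hUY : U ≤ Y) (hYX : Y ≤ X) :
    {x // x ∈ X ∧ x ∉ Y} ≃ Σ L : LineOver U Y X, {x // x ∈ L.1 ∧ x ∉ U} where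
  toFun x := ⟨⟨U ⊔ Submodule.span F {x.1}, le_sup_left,
      finrank_sup_span_singleton fun h => x.2.2 (hUY h),
      sup_le (hUY.trans hYX) ((Submodule.span_singleton_le_iff_mem _ _).2 x.2.1),
      fun h => x.2.2 (h (Submodule.mem_sup_right (Submodule.mem_span_singleton_self _)))⟩,
    ⟨x.1, Submodule.mem_sup_right (Submodule.mem_span_singleton_self _), fun h => x.2.2 (hUY h)⟩⟩
  invFun y := ⟨y.2.1, y.1.2.2.2.1 y.2.2.1, fun h => y.1.2.2.2.2 (by
    rw [← sup_span_singleton_eq y.1.2.1 y.1.2.2.1 y.2.2.1 y.2.2.2]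
    exact sup_le hUY ((Submodule.span_singleton_le_iff_mem _ _).2 h))⟩
  left_inv x := rfl
  right_inv := by
    rintro ⟨⟨L, h1, h2, h3, h4⟩, ⟨x, hx, hxU⟩⟩
    obtain rfl := sup_span_singleton_eq h1 h2 hx hxU
    rfl

/-- The vectors of X outside Y are partitioned by the sets L \ U, each of size q^{dim U}(q - 1).
Dividing |X| - |Y| by this size leaves q^a (1 + q + ⋯ + q^{b-1}). -/
theorem natCard_lineOver [Finite F] {U Y X : Submodule F E} (hUY : U ≤ Y) (hYX : Y ≤ X)
    {a b : ℕ} (ha : Module.finrank F Y = Module.finrank F U + a)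
    (hb : Module.finrank F X = Module.finrank F U + a + b) :
    (Nat.card (LineOver U Y X) : ℤ) =
      (Nat.card F : ℤ) ^ a * ∑ t ∈ Finset.range b, (Nat.card F : ℤ) ^ t := by
  classical
  have : FiniteDimensional F E := Module.Finite.of_finite
  have : Finite (LineOver U Y X) := Subtype.finite
  have := Fintype.ofFinite (LineOver U Y X)
  have := Fintype.ofFinite E
  have hq : (1 : ℤ) < Nat.card F := by exact_mod_cast Finite.one_lt_card
  set q : ℤ := (Nat.card F : ℤ)
  have hcard : ∀ W : Submodule F E, (Nat.card W : ℤ) = q ^ Module.finrank F W := by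
    intro W
    rw [Module.natCard_eq_pow_finrank (K := F)]
    push_cast
    rfl
  have h1 := Nat.card_congr (lineOverEquiv hUY hYX)
  rw [Nat.card_sigma] at h1
  have h2 : ∀ L : LineOver U Y X, (Nat.card {x // x ∈ L.1 ∧ x ∉ U} : ℤ) =
      q ^ Module.finrank F U * (q - 1) := by
    intro L
    rw [natCard_sdiff L.2.1, hcard, hcard, L.2.2.1]
    ring
  have h3 := congrArg (Nat.cast : ℕ → ℤ) h1
  rw [natCard_sdiff hYX, hcard, hcard] at h3
  push_cast at h3
  simp only [h2] at h3
  rw [Finset.sum_const, Finset.card_univ, ← Nat.card_eq_fintype_card, nsmul_eq_mul, ha, hb] at h3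
  have h4 := geom_sum_mul q b
  have h5 : q ^ Module.finrank F U * (q - 1) ≠ 0 :=
    mul_ne_zero (pow_ne_zero _ (by omega)) (by omega)
  apply mul_right_cancel₀ h5
  rw [← h3, pow_add, pow_add]
  linear_combination (-q ^ Module.finrank F U * q ^ a) * h4

end Lines

/-! ### Flags that differ in one step -/

section Step

variable {F : Type} [Field F] {d : ℕ}

theorem deg_single (p : UPair n) (c : ℕ) (t : Fin (n + 1)) :
    deg (Pi.single p c) t = if p.1.1.castSucc < t ∧ t ≤ p.1.2.castSucc then (c : ℤ) else 0 := by
  unfold deg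
  rw [Finset.sum_eq_single p.1.1, Finset.sum_eq_single p.1.2]
  · simp [ent_single]
  · intro l _ hl
    simp [ent_single, hl]
  · simp
  · intro k _ hk
    simp [ent_single, hk]
  · simp

/-- The flag `V''` is obtained from `V'` by enlarging the space at `t` by one dimension. -/
def IsStep (t : Fin (n + 1)) (V'' V' : NStepFlag F n d) : Prop :=
  (∀ u, u ≠ t → V''.space u = V'.space u) ∧ V'.space t ≤ V''.space t ∧
    Module.finrank F (V''.space t) = Module.finrank F (V'.space t) + 1

variable {h h' : Fin n}

theorem succ_eq_castSucc_of_val (hh : (h : ℕ) + 1 = h') : h.succ = h'.castSucc := Fin.ext hh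

theorem lt_of_val_add_one (hh : (h : ℕ) + 1 = h') : h < h' := by
  rw [Fin.lt_def]; omega

/-- The function `deg` of a simple root is the indicator of a single position, so the two flags
agree at every other place and differ there by one dimension. This is what turns products with
simple roots into counts of lines. -/
theorem isOff_unitIdx_iff (hh : (h : ℕ) + 1 = h') {V'' V' : NStepFlag F n d} :
    IsOff (relPos V'' V') (unitIdx (upair h h' (lt_of_val_add_one hh))) ↔
      IsStep h'.castSucc V'' V' := by
  constructor
  · intro H
    have hd : ∀ t, (Module.finrank F (V''.space t) : ℤ) =
        Module.finrank F (V'.space t) + if t = h'.castSucc then 1 else 0 := by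
      intro t
      rw [H.finrank_eq t, deg_single]
      congr 1
      refine if_congr ?_ rfl rfl
      simp only [Fin.lt_def, Fin.le_def, Fin.ext_iff, Fin.val_castSucc]
      omega
    refine ⟨fun u hu => ?_, H.space_le _, ?_⟩
    · refine (Submodule.eq_of_le_of_finrank_eq (H.space_le u) ?_).symm
      have := hd u
      rw [if_neg hu] at this
      omega
    · have := hd h'.castSucc
      rw [if_pos rfl] at this
      omega
  · rintro ⟨h1, h2, h3⟩
    -- Compared with the pair (V', V'), the only intersections that grow are those of the enlarged
    -- space with strictly larger members of V'; differencing this indicator twice gives the unit at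
    -- (h, h') off the diagonal.
    have hr : ∀ i j, rk V'' V' i j =
        rk V' V' i j + if i = h'.castSucc ∧ h'.castSucc < j then 1 else 0 := by
      intro i j
      by_cases hi : i = h'.castSucc
      · subst hi
        by_cases hj : h'.castSucc < j
        · rw [if_pos ⟨rfl, hj⟩, rk, rk, inf_eq_left.2 (V'.mono hj.le), ← h1 j hj.ne',
            inf_eq_left.2 (V''.mono hj.le), h3]
          simp
        · rw [if_neg (by simp [hj]), rk, rk, inf_eq_right.2 (V'.mono (not_lt.1 hj)),
            inf_eq_right.2 ((V'.mono (not_lt.1 hj)).trans h2), add_zero]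
      · rw [if_neg (by simp [hi]), rk, rk, h1 i hi, add_zero]
    intro i j hij
    have h0 := (isOff_zero_iff (V := V') (V' := V')).2 rfl i j hij
    rw [relPos_eq] at h0 ⊢
    simp only [hr, ent_single, ent_zero] at h0 ⊢
    rw [Nat.cast_ite]
    have e1 : i.succ = h'.castSucc ↔ i = h := by
      rw [← succ_eq_castSucc_of_val hh, Fin.succ_inj]
    simp only [e1, Fin.castSucc_inj, Fin.castSucc_lt_castSucc_iff, Fin.castSucc_lt_succ_iff]
    simp only [Fin.ext_iff, Fin.lt_def, Fin.le_def] at *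
    split_ifs <;> omega

/-- `V'_t + V_i ∩ V'_u`. -/
def layer (V V' : NStepFlag F n d) (h' : Fin n) (i : Fin (n + 1)) : Submodule F (Fin d → F) :=
  V'.space h'.castSucc ⊔ (V.space i ⊓ V'.space h'.succ)

theorem layer_mono (V V' : NStepFlag F n d) (h' : Fin n) : Monotone (layer V V' h') :=
  fun _ _ hij => sup_le_sup_left (inf_le_inf_right _ (V.mono hij)) _

theorem layer_zero (V V' : NStepFlag F n d) (h' : Fin n) :
    layer V V' h' 0 = V'.space h'.castSucc := by
  rw [layer, V.bot, bot_inf_eq, sup_bot_eq]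

theorem layer_last (V V' : NStepFlag F n d) (h' : Fin n) :
    layer V V' h' (Fin.last n) = V'.space h'.succ := by
  rw [layer, V.top, top_inf_eq, sup_eq_right]
  exact V'.mono (Fin.castSucc_lt_succ).le

theorem finrank_layer (V V' : NStepFlag F n d) (h' : Fin n) (i : Fin (n + 1)) :
    (Module.finrank F (layer V V' h' i) : ℤ) = Module.finrank F (V'.space h'.castSucc) +
      (rk V V' i h'.succ - rk V V' i h'.castSucc) := by
  have h := Submodule.finrank_sup_add_finrank_inf_eq (V'.space h'.castSucc)
    (V.space i ⊓ V'.space h'.succ)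
  have e : V'.space h'.castSucc ⊓ (V.space i ⊓ V'.space h'.succ) =
      V.space i ⊓ V'.space h'.castSucc := by
    rw [inf_left_comm, inf_eq_left.2 (V'.mono (Fin.castSucc_lt_succ).le)]
  rw [e] at h
  rw [layer, rk, rk]
  omega

theorem finrank_layer_eq_sum (V V' : NStepFlag F n d) (h' : Fin n) (i : Fin (n + 1)) :
    (Module.finrank F (layer V V' h' i) : ℤ) = Module.finrank F (V'.space h'.castSucc) +
      ∑ k : Fin n, if k.castSucc < i then relPos V V' k h' else 0 := by
  have := Fin.sum_ite_lt_sub (fun k => rk V V' k h'.succ - rk V V' k h'.castSucc) i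
  rw [finrank_layer, add_right_inj]
  rw [rk_zero_left, rk_zero_left, sub_zero, sub_zero] at this
  rw [← this]
  refine Finset.sum_congr rfl fun k _ => if_congr Iff.rfl ?_ rfl
  rw [relPos_eq]
  ring

open Classical in
-- With U ⊂ L the two spaces at the step, the modular law gives `layer` ∩ L = U + (V_i ∩ L). As U
-- has codimension one in L, V_i ∩ L exceeds V_i ∩ U by one dimension exactly when L lies in the
-- layer.
theorem IsStep.rk_eq {V V' V'' : NStepFlag F n d} {h' : Fin n} (hs : IsStep h'.castSucc V'' V')
    (i j : Fin (n + 1)) :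
    rk V V'' i j = rk V V' i j +
      if j = h'.castSucc ∧ V''.space h'.castSucc ≤ layer V V' h' i then 1 else 0 := by
  obtain ⟨h1, h2, h3⟩ := hs
  by_cases hj : j = h'.castSucc
  swap
  · rw [if_neg (by simp [hj]), rk, rk, h1 j hj, add_zero]
  subst hj
  set L := V''.space h'.castSucc with hL
  set U := V'.space h'.castSucc with hU
  have hLt : L ≤ V'.space h'.succ := by
    rw [← h1 h'.succ (Fin.castSucc_lt_succ).ne']
    exact V''.mono (Fin.castSucc_lt_succ).le
  have e1 : layer V V' h' i ⊓ L = U ⊔ (V.space i ⊓ L) := by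
    rw [layer, sup_inf_assoc_of_le _ h2, inf_assoc, inf_eq_right.2 hLt]
  have e2 := Submodule.finrank_sup_add_finrank_inf_eq U (V.space i ⊓ L)
  have e3 : U ⊓ (V.space i ⊓ L) = V.space i ⊓ U := by
    rw [inf_left_comm, inf_eq_left.2 h2]
  rw [← e1, e3] at e2
  rw [rk, rk, ← hL, ← hU]
  by_cases hX : L ≤ layer V V' h' i
  · rw [if_pos ⟨rfl, hX⟩]
    rw [inf_eq_right.2 hX] at e2
    omega
  · rw [if_neg (by simp [hX])]
    have e4 : layer V V' h' i ⊓ L < L := lt_of_le_of_ne inf_le_right fun h => hX (inf_eq_right.1 h)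
    have e5 := Submodule.finrank_lt_finrank_of_lt e4
    have e6 : Module.finrank F U ≤ Module.finrank F ↥(layer V V' h' i ⊓ L) :=
      Submodule.finrank_mono (le_inf le_sup_left h2)
    omega

/-- The enlargement from `V'` to `V''` happens in the `k`-th layer. -/
def StepType (V V' V'' : NStepFlag F n d) (h' k : Fin n) : Prop :=
  V''.space h'.castSucc ≤ layer V V' h' k.succ ∧ ¬ V''.space h'.castSucc ≤ layer V V' h' k.castSucc

/-- The layers form a chain from V'_t up to V'_{t+1}. The enlarged space lies in the last one but
not in the first, so it enters the chain at exactly one place. -/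
theorem IsStep.existsUnique_stepType {V V' V'' : NStepFlag F n d}
    (hs : IsStep h'.castSucc V'' V') : ∃! k, StepType V V' V'' h' k := by
  have h0 : ¬ V''.space h'.castSucc ≤ layer V V' h' 0 := by
    rw [layer_zero]
    intro hle
    have := Submodule.finrank_mono hle
    have := hs.2.2
    omega
  have hlast : V''.space h'.castSucc ≤ layer V V' h' (Fin.last n) := by
    rw [layer_last, ← hs.1 h'.succ (Fin.castSucc_lt_succ).ne']
    exact V''.mono (Fin.castSucc_lt_succ).le
  obtain ⟨k, hk⟩ : ∃ k, StepType V V' V'' h' k := by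
    by_contra hne
    have hall : ∀ t, ¬ V''.space h'.castSucc ≤ layer V V' h' t := by
      intro t
      induction t using Fin.induction with
      | zero => exact h0
      | succ k ih => exact fun h => hne ⟨k, h, ih⟩
    exact hall _ hlast
  refine ⟨k, hk, fun l hl => ?_⟩
  rcases lt_trichotomy l k with hlt | heq | hgt
  · exact (hk.2 (hl.1.trans (layer_mono _ _ _ (Fin.succ_le_castSucc_iff.2 hlt)))).elim
  · exact heq
  · exact (hl.2 (hk.1.trans (layer_mono _ _ _ (Fin.succ_le_castSucc_iff.2 hgt)))).elim

/-- The matrix `Z + E_{kh} - E_{kh'}`. -/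
def moveMat (Z : Matrix (Fin n) (Fin n) ℤ) (k h h' : Fin n) : Matrix (Fin n) (Fin n) ℤ :=
  fun i j => Z i j + if i = k then (if j = h then 1 else 0) - (if j = h' then 1 else 0) else 0

/-- The rank function changes only at the position of the step and only in rows beyond k; the second
difference of that indicator is E_{kh} - E_{kh'}. -/
theorem IsStep.relPos_eq (hh : (h : ℕ) + 1 = h') {V V' V'' : NStepFlag F n d} {k : Fin n}
    (hs : IsStep h'.castSucc V'' V') (hk : StepType V V' V'' h' k) :
    relPos V V'' = moveMat (relPos V V') k h h' := by
  classical
  have hle : ∀ i, V''.space h'.castSucc ≤ layer V V' h' i ↔ k.castSucc < i := by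
    intro i
    constructor
    · intro hi
      by_contra hlt
      exact hk.2 (hi.trans (layer_mono _ _ _ (not_lt.1 hlt)))
    · intro hi
      exact hk.1.trans (layer_mono _ _ _ (Fin.castSucc_lt_iff_succ_le.1 hi))
  ext i j
  rw [_root_.relPos_eq, moveMat, _root_.relPos_eq, hs.rk_eq, hs.rk_eq, hs.rk_eq, hs.rk_eq]
  have e1 : j.succ = h'.castSucc ↔ j = h := by
    rw [← succ_eq_castSucc_of_val hh, Fin.succ_inj]
  simp only [hle, e1, Fin.castSucc_inj, Fin.castSucc_lt_castSucc_iff, Fin.castSucc_lt_succ_iff]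
  simp only [Fin.ext_iff, Fin.lt_def, Fin.le_def] at *
  split_ifs <;> omega

/-- The flag obtained from `V'` by replacing the space at `h'.castSucc` by `L`. -/
def replaceFlag (V' : NStepFlag F n d) (hh : (h : ℕ) + 1 = h') (L : Submodule F (Fin d → F))
    (h1 : V'.space h'.castSucc ≤ L) (h2 : L ≤ V'.space h'.succ) : NStepFlag F n d where
  space := Function.update V'.space h'.castSucc L
  mono := by
    intro a b hab
    rcases eq_or_lt_of_le hab with rfl | hab
    · exact le_rfl
    by_cases ha : a = h'.castSucc
    · subst ha
      rw [Function.update_self, Function.update_of_ne hab.ne']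
      exact h2.trans (V'.mono (Fin.castSucc_lt_iff_succ_le.1 hab))
    · rw [Function.update_of_ne ha]
      by_cases hb : b = h'.castSucc
      · subst hb
        rw [Function.update_self]
        exact (V'.mono hab.le).trans h1
      · rw [Function.update_of_ne hb]
        exact V'.mono hab.le
  bot := by
    rw [Function.update_of_ne, V'.bot]
    -- The existence of a predecessor h of h' guarantees that the replaced space is not V'_0.
    rw [← succ_eq_castSucc_of_val hh]
    exact (Fin.succ_ne_zero h).symm
  top := by
    rw [Function.update_of_ne, V'.top]
    exact (Fin.castSucc_lt_last _).ne'

/-- The enlargements in the `k`-th layer are the subspaces counted by `LineOver`. -/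
def stepEquiv (hh : (h : ℕ) + 1 = h') (V V' : NStepFlag F n d) (k : Fin n) :
    {V'' : NStepFlag F n d // IsStep h'.castSucc V'' V' ∧ StepType V V' V'' h' k} ≃
      LineOver (V'.space h'.castSucc) (layer V V' h' k.castSucc) (layer V V' h' k.succ) where
  toFun W := ⟨W.1.space h'.castSucc, W.2.1.2.1, W.2.1.2.2, W.2.2.1, W.2.2.2⟩
  invFun L := ⟨replaceFlag V' hh L.1 L.2.1
      (L.2.2.2.1.trans ((layer_mono V V' h' (Fin.le_last _)).trans (layer_last V V' h').le)), by
    have e : (replaceFlag V' hh L.1 L.2.1 (L.2.2.2.1.trans ((layer_mono V V' h'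
        (Fin.le_last _)).trans (layer_last V V' h').le))).space h'.castSucc = L.1 :=
      Function.update_self ..
    refine ⟨⟨fun u hu => Function.update_of_ne hu _ _, ?_, ?_⟩, ?_, ?_⟩ <;> rw [e]
    · exact L.2.1
    · exact L.2.2.1
    · exact L.2.2.2.1
    · exact L.2.2.2.2⟩
  left_inv W := by
    refine Subtype.ext (NStepFlag.ext fun i => ?_)
    by_cases hi : i = h'.castSucc
    · subst hi
      exact Function.update_self ..
    · exact (Function.update_of_ne hi _ _).trans (W.2.1.1 i hi).symm
  right_inv L := Subtype.ext (Function.update_self ..)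

/-- By `finrank_layer_eq_sum`, the lower layer has codimension over V'_t equal to the sum of the
entries of column h' above row k, and passing to the upper layer adds the entry at (k, h'). -/
theorem natCard_stepType [Finite F] (hh : (h : ℕ) + 1 = h') (V V' : NStepFlag F n d) (k : Fin n) :
    (Nat.card {V'' : NStepFlag F n d // IsStep h'.castSucc V'' V' ∧ StepType V V' V'' h' k} : ℤ) =
      (Nat.card F : ℤ) ^ (∑ i, if i < k then relPos V V' i h' else 0).toNat *
        ∑ t ∈ Finset.range (relPos V V' k h').toNat, (Nat.card F : ℤ) ^ t := by
  rw [Nat.card_congr (stepEquiv hh V V' k)]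
  have h0 : 0 ≤ ∑ i, if i < k then relPos V V' i h' else 0 :=
    Finset.sum_nonneg fun i _ => by
      split_ifs
      · exact relPos_nonneg _ _ _ _
      · exact le_rfl
  have h1 := finrank_layer_eq_sum V V' h' k.castSucc
  have h2 := finrank_layer V V' h' k.succ
  have h3 := finrank_layer V V' h' k.castSucc
  have h4 := relPos_eq V V' k h'
  have h5 := relPos_nonneg V V' k h'
  simp only [Fin.castSucc_lt_castSucc_iff] at h1
  refine natCard_lineOver le_sup_left (layer_mono _ _ _ (Fin.castSucc_lt_succ).le) ?_ ?_
  · omega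
  · omega

end Step

/-! ### Integral polynomials and their values at odd primes -/

theorem infinite_odd_primes : {p : ℕ | p.Prime ∧ p ≠ 2}.Infinite := by
  have := Nat.infinite_setOfPred_prime.sdiff (Set.finite_singleton 2)
  exact this

/-- The prime fields `ZMod p` suffice as test fields; p = 2 is left out because structure
polynomials are constrained only in odd characteristic. -/
theorem Polynomial.eq_of_eval_odd_primes {P Q : ℤ[X]}
    (h : ∀ p : ℕ, p.Prime → p ≠ 2 → P.eval (p : ℤ) = Q.eval (p : ℤ)) : P = Q := by
  refine eq_of_infinite_eval_eq P Q ((infinite_odd_primes.image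
    (f := fun p : ℕ => (p : ℤ)) Nat.cast_injective.injOn).mono ?_)
  rintro _ ⟨p, hp, rfl⟩
  exact h p hp.1 hp.2

/-- At every odd prime the value of the remainder is divisible by that of D. For large p it is also
smaller in absolute value, by comparison of degrees, so the remainder has infinitely many zeros. -/
theorem Polynomial.Monic.dvd_of_eval_dvd {D N : ℤ[X]} (hD : D.Monic)
    (h : ∀ p : ℕ, p.Prime → p ≠ 2 → D.eval (p : ℤ) ∣ N.eval (p : ℤ)) : D ∣ N := by
  rw [← modByMonic_eq_zero_iff_dvd hD]
  set R := N %ₘ D with hR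
  have hdvd : ∀ p : ℕ, p.Prime → p ≠ 2 → D.eval (p : ℤ) ∣ R.eval (p : ℤ) := by
    intro p h1 h2
    have e := congrArg (Polynomial.eval (p : ℤ)) (modByMonic_add_div N D)
    rw [eval_add, eval_mul] at e
    rw [← hR] at e
    rw [eq_sub_of_add_eq e]
    exact dvd_sub (h p h1 h2) (dvd_mul_right _ _)
  have hlt : (R.map (Int.castRingHom ℝ)).degree < (D.map (Int.castRingHom ℝ)).degree := by
    rw [degree_map_eq_of_injective Int.cast_injective,
      degree_map_eq_of_injective Int.cast_injective]
    exact degree_modByMonic_lt N hD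
  have ht := Polynomial.div_tendsto_atTop_zero_of_degree_lt _ _ hlt
  have hev := ht.eventually (Metric.ball_mem_nhds 0 one_pos)
  obtain ⟨x₀, hx₀⟩ := Filter.eventually_atTop.1 hev
  refine eq_of_infinite_eval_eq R 0 (((infinite_odd_primes.sdiff
    (Set.finite_lt_nat ⌈x₀⌉₊)).image (f := fun p : ℕ => (p : ℤ))
      Nat.cast_injective.injOn).mono ?_)
  rintro _ ⟨p, ⟨hp, hpx⟩, rfl⟩
  have hpx' : x₀ ≤ (p : ℝ) := Nat.ceil_le.1 (not_lt.1 hpx)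
  have h1 := hx₀ p hpx'
  have hcast : ∀ P : ℤ[X], (P.map (Int.castRingHom ℝ)).eval (p : ℝ) = (P.eval (p : ℤ) : ℤ) := by
    intro P
    rw [eval_map, show (p : ℝ) = Int.castRingHom ℝ (p : ℤ) by simp, eval₂_hom]
    rfl
  simp only [hcast, dist_zero_right, Real.norm_eq_abs, abs_div] at h1
  have h2 := hdvd p hp.1 hp.2
  change R.eval (p : ℤ) = (0 : ℤ[X]).eval (p : ℤ)
  rw [eval_zero]
  by_contra hne
  have hD0 : D.eval (p : ℤ) ≠ 0 := fun h0 => hne (zero_dvd_iff.1 (h0 ▸ h2))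
  have h3 := Int.le_of_dvd (abs_pos.2 hne) ((abs_dvd_abs _ _).2 h2)
  rw [div_lt_one (abs_pos.2 (by exact_mod_cast hD0))] at h1
  have h4 : |R.eval (p : ℤ)| < |D.eval (p : ℤ)| := by exact_mod_cast h1
  omega

/-! ### The matrices of the relative positions -/

instance (F : Type) [Field F] [Finite F] (n d : ℕ) : Finite (NStepFlag F n d) :=
  Finite.of_injective (fun V => V.space) fun _ _ h => NStepFlag.ext (congrFun h)

instance (F : Type) [Field F] [Finite F] (n d : ℕ) : Fintype (NStepFlag F n d) := Fintype.ofFinite _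

instance (F : Type) [Field F] (n d : ℕ) : DecidableEq (NStepFlag F n d) := Classical.decEq _

open Classical in
/-- The indicator matrix of the pairs of flags of type `A`. -/
def relMat (F : Type) [Field F] (d : ℕ) (A : Idx n) :
    Matrix (NStepFlag F n d) (NStepFlag F n d) ℤ :=
  Matrix.of fun V V' => if IsOff (relPos V V') A then 1 else 0

section RelMat

variable (F : Type) [Field F] (d : ℕ)

open Classical in
theorem relMat_apply (A : Idx n) (V V' : NStepFlag F n d) :
    relMat F d A V V' = if IsOff (relPos V V') A then 1 else 0 := rfl

/-- The value at `q` of a formal combination of the types of pairs of flags. -/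
def hallEval : (Idx n →₀ ℤ[X]) →+ Matrix (NStepFlag F n d) (NStepFlag F n d) ℤ :=
  Finsupp.liftAddHom fun C =>
    { toFun := fun P => P.eval (Nat.card F : ℤ) • relMat F d C
      map_zero' := by simp
      map_add' := fun P Q => by simp [add_smul] }

theorem hallEval_single (C : Idx n) (P : ℤ[X]) :
    hallEval F d (Finsupp.single C P) = P.eval (Nat.card F : ℤ) • relMat F d C := by
  simp [hallEval]

theorem hallEval_single_one (C : Idx n) :
    hallEval F d (Finsupp.single C 1) = relMat F d C := by
  simp [hallEval_single]

theorem hallEval_smul (P : ℤ[X]) (φ : Idx n →₀ ℤ[X]) :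
    hallEval F d (P • φ) = P.eval (Nat.card F : ℤ) • hallEval F d φ := by
  induction φ using Finsupp.induction_linear with
  | zero => simp
  | add φ ψ h1 h2 => rw [smul_add, map_add, map_add, smul_add, h1, h2]
  | single C Q =>
    rw [Finsupp.smul_single, hallEval_single, hallEval_single, smul_eq_mul, eval_mul, mul_smul]

theorem hallEval_apply {C : Idx n} {V V' : NStepFlag F n d} (h : IsOff (relPos V V') C)
    (φ : Idx n →₀ ℤ[X]) : hallEval F d φ V V' = (φ C).eval (Nat.card F : ℤ) := by
  classical
  induction φ using Finsupp.induction_linear with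
  | zero => simp
  | add φ ψ h1 h2 => rw [map_add, Matrix.add_apply, h1, h2, Finsupp.add_apply, eval_add]
  | single D Q =>
    rw [hallEval_single, Matrix.smul_apply, relMat_apply, Finsupp.single_apply]
    by_cases hD : D = C
    · subst hD
      simp [h]
    · rw [if_neg fun h' => hD (h'.unique h), if_neg hD]
      simp

theorem hallEval_apply_eq_zero {V V' : NStepFlag F n d} (h : ∀ C : Idx n, ¬ IsOff (relPos V V') C)
    (φ : Idx n →₀ ℤ[X]) : hallEval F d φ V V' = 0 := by
  classical
  induction φ using Finsupp.induction_linear with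
  | zero => simp
  | add φ ψ h1 h2 => rw [map_add, Matrix.add_apply, h1, h2, add_zero]
  | single D Q => rw [hallEval_single, Matrix.smul_apply, relMat_apply, if_neg (h D), smul_zero]

end RelMat

/-! ### Realizing every type by flags, and reduction of identities to matrices -/

/-- The strictly upper triangular matrix `A`. -/
def toMat (A : Idx n) : Matrix (Fin n) (Fin n) ℤ := fun i j => ent A i j

theorem isOff_toMat (A : Idx n) : IsOff (toMat A) A := fun _ _ _ => rfl

/-- The sum of the entries. -/
def size (A : Idx n) : ℕ := ∑ i, ∑ j, ent A i j

theorem isTheta_toMat (A : Idx n) : IsTheta (size A) (toMat A) :=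
  ⟨fun i j => by simp [toMat], by simp [toMat, size]⟩

theorem exists_isOff (F : Type) [Field F] (A : Idx n) :
    ∃ V V' : NStepFlag F n (size A), IsOff (relPos V V') A := by
  obtain ⟨V, V', h⟩ := exists_relPos_eq F (isTheta_toMat A)
  exact ⟨V, V', h ▸ isOff_toMat A⟩

/-- Each type occurs for some pair of flags over every `ZMod p`, and the matrix entry there is the
value at p of its coefficient. Identities between Hall polynomials thereby reduce to identities of
integer matrices. -/
theorem hallEval_ext {φ ψ : Idx n →₀ ℤ[X]}
    (h : ∀ (F : Type) [Field F] [Finite F] (d : ℕ), hallEval F d φ = hallEval F d ψ) : φ = ψ := by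
  ext1 C
  refine Polynomial.eq_of_eval_odd_primes fun p hp _ => ?_
  have : Fact p.Prime := ⟨hp⟩
  obtain ⟨V, V', hV⟩ := exists_isOff (ZMod p) C
  have := congrFun (congrFun (h (ZMod p) (size C)) V) V'
  rwa [hallEval_apply _ _ hV, hallEval_apply _ _ hV, Nat.card_zmod] at this

theorem relMat_mul_apply (F : Type) [Field F] [Finite F] (d : ℕ) (A B : Idx n)
    (V V' : NStepFlag F n d) : (relMat F d A * relMat F d B) V V' =
      Nat.card {V'' : NStepFlag F n d // IsOff (relPos V V'') A ∧ IsOff (relPos V'' V') B} := by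
  classical
  rw [Matrix.mul_apply, Nat.card_eq_fintype_card, Fintype.card_subtype, ← Finset.sum_boole]
  refine Finset.sum_congr rfl fun W _ => ?_
  rw [relMat_apply, relMat_apply, ite_and, ite_mul, one_mul, zero_mul]

/-! ### Multiplication with a simple root element -/

/-- `A - E_{kh} + E_{kh'}` (where `E_{kh}` is omitted if `k = h`). -/
def moveIdx (A : Idx n) (k h h' : Fin n) : Idx n := fun p =>
  A p + (if p.1.1 = k ∧ p.1.2 = h' then 1 else 0) - (if p.1.1 = k ∧ p.1.2 = h then 1 else 0)

theorem ent_moveIdx (A : Idx n) {k h h' i j : Fin n} (hij : i < j) :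
    ent (moveIdx A k h h') i j = ent A i j + (if i = k ∧ j = h' then 1 else 0) -
      (if i = k ∧ j = h then 1 else 0) := by
  rw [ent_of_lt _ hij, ent_of_lt _ hij]
  rfl

theorem moveIdx_self (A : Idx n) {h h' : Fin n} (hlt : h < h') :
    moveIdx A h h h' = A + unitIdx (upair h h' hlt) := by
  refine Idx.ext_ent fun i j hij => ?_
  rw [ent_moveIdx _ hij, ent_add, ent_single, if_neg (c := i = h ∧ j = h), Nat.sub_zero]
  rintro ⟨rfl, rfl⟩
  exact lt_irrefl _ hij

theorem moveIdx_add (A : Idx n) {k h h' : Fin n} (hkh : k < h) (hkh' : k < h') :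
    moveIdx (A + unitIdx (upair k h hkh)) k h h' = A + unitIdx (upair k h' hkh') := by
  refine Idx.ext_ent fun i j hij => ?_
  rw [ent_moveIdx _ hij, ent_add, ent_add, ent_single, ent_single]
  simp only
  omega

theorem exists_eq_add_unitIdx (A : Idx n) {k h : Fin n} (hkh : k < h) (hA : 0 < ent A k h) :
    ∃ B : Idx n, A = B + unitIdx (upair k h hkh) := by
  refine ⟨A - unitIdx (upair k h hkh), (tsub_add_cancel_of_le ?_).symm⟩
  intro p
  by_cases hp : p = upair k h hkh
  · subst hp
    rw [ent_of_lt _ hkh] at hA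
    simpa using Nat.succ_le_of_lt hA
  · simp [hp]

/-- The polynomial `q^{∑_{i < k} a_{ih'}} [a_{kh'} + 1]_q`. -/
def chevCoeff (A : Idx n) (k h' : Fin n) : ℤ[X] :=
  X ^ (∑ i, if i < k then ent A i h' else 0) * ∑ t ∈ Finset.range (ent A k h' + 1), X ^ t

/-- A unit of the row `k` may be moved from the column `h` to the column `h'`. -/
def CanMove (A : Idx n) (k h : Fin n) : Prop := k ≤ h ∧ (k < h → 0 < ent A k h)

open Classical in
/-- The product of the basis element `A` with the basis element `E_{hh'}`, where `h' = h + 1`. -/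
def chev (A : Idx n) (h h' : Fin n) : Idx n →₀ ℤ[X] :=
  ∑ k, if CanMove A k h then Finsupp.single (moveIdx A k h h') (chevCoeff A k h') else 0

/-- The relation between the types before and after a step is solved for the original matrix.
Nonnegativity of Z is what forces k ≤ h and, off the diagonal, an available unit at (k, h); under
this condition the truncated subtraction in `moveIdx` loses nothing. -/
theorem isOff_moveMat_iff {Z : Matrix (Fin n) (Fin n) ℤ} (hZ : ∀ i j, 0 ≤ Z i j) (A : Idx n)
    {k h h' : Fin n} (hh : h < h') :
    IsOff (moveMat Z k h h') A ↔ CanMove A k h ∧ IsOff Z (moveIdx A k h h') := by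
  constructor
  · intro H
    have hc : CanMove A k h := by
      rw [CanMove]
      by_cases hkh : k = h
      · subst hkh
        exact ⟨le_rfl, fun h0 => (lt_irrefl _ h0).elim⟩
      have h1 := H k h hkh
      simp only [moveMat, if_true, if_neg hh.ne] at h1
      have h2 := hZ k h
      by_cases hlt : k < h
      · exact ⟨hlt.le, fun _ => by omega⟩
      · rw [ent_of_not_lt _ hlt] at h1
        simp at h1
        omega
    refine ⟨hc, fun i j hij => ?_⟩
    have h1 := H i j hij
    by_cases hlt : i < j
    · rw [ent_moveIdx _ hlt]
      simp only [moveMat] at h1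
      have h2 := hZ i j
      by_cases e1 : i = k
      · subst e1
        rw [if_pos rfl] at h1
        simp only [true_and]
        split_ifs at h1 ⊢ <;> omega
      · rw [if_neg e1] at h1
        simp only [e1, false_and, if_false]
        omega
    · rw [ent_of_not_lt _ hlt] at h1 ⊢
      simp only [moveMat] at h1
      have h3 : i = k → j ≠ h := by
        rintro rfl rfl
        exact hlt (lt_of_le_of_ne hc.1 hij)
      have h4 : i = k → j ≠ h' := by
        rintro rfl rfl
        exact hlt (hc.1.trans_lt hh)
      split_ifs at h1 <;> simp_all
  · rintro ⟨hc, H⟩ i j hij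
    have h1 := H i j hij
    simp only [moveMat]
    by_cases hlt : i < j
    · rw [ent_moveIdx _ hlt] at h1
      rw [h1]
      have h4 : i = k → j = h → 0 < ent A i j := by
        rintro rfl rfl
        exact hc.2 hlt
      split_ifs at h1 ⊢ <;> simp_all
    · rw [ent_of_not_lt _ hlt] at h1 ⊢
      have h3 : i = k → j ≠ h := by
        rintro rfl rfl
        exact hlt (lt_of_le_of_ne hc.1 hij)
      have h4 : i = k → j ≠ h' := by
        rintro rfl rfl
        exact hlt (hc.1.trans_lt hh)
      rw [h1]
      split_ifs <;> simp_all

/-- Multiplication from the right with a simple root element. -/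
theorem relMat_mul_unitIdx (F : Type) [Field F] [Finite F] (d : ℕ) (A : Idx n) {h h' : Fin n}
    (hh : (h : ℕ) + 1 = h') :
    relMat F d A * relMat F d (unitIdx (upair h h' (lt_of_val_add_one hh))) =
      hallEval F d (chev A h h') := by
  classical
  have hlt := lt_of_val_add_one hh
  ext V V'
  have e1 : hallEval F d (chev A h h') V V' = ∑ k, if IsOff (moveMat (relPos V V') k h h') A then
      (chevCoeff A k h').eval (Nat.card F : ℤ) else 0 := by
    rw [chev, map_sum, Matrix.sum_apply]
    refine Finset.sum_congr rfl fun k _ => ?_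
    rw [if_congr (isOff_moveMat_iff (relPos_nonneg V V') A hlt) rfl rfl, ite_and]
    split_ifs with h1 h2
    · rw [hallEval_single, Matrix.smul_apply, relMat_apply, if_pos h2, smul_eq_mul, mul_one]
    · rw [hallEval_single, Matrix.smul_apply, relMat_apply, if_neg h2, smul_zero]
    · rw [map_zero, Matrix.zero_apply]
  rw [e1, Matrix.mul_apply]
  -- A step happens in exactly one layer k, so the indicator of W is a sum over k; exchanging the
  -- two sums leaves one count of lines for each k.
  have e2 : ∀ W : NStepFlag F n d, relMat F d A V W *
      relMat F d (unitIdx (upair h h' hlt)) W V' = ∑ k,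
        if IsOff (moveMat (relPos V V') k h h') A then
          if IsStep h'.castSucc W V' ∧ StepType V V' W h' k then (1 : ℤ) else 0 else 0 := by
    intro W
    rw [relMat_apply, relMat_apply, if_congr (isOff_unitIdx_iff hh) rfl rfl]
    by_cases hs : IsStep h'.castSucc W V'
    · obtain ⟨k, hk, hu⟩ := hs.existsUnique_stepType (V := V)
      rw [Finset.sum_eq_single k, hs.relPos_eq hh hk, if_pos hs,
        if_pos (c := _ ∧ _) ⟨hs, hk⟩, mul_one]
      · intro l _ hl
        rw [if_neg (c := _ ∧ _), ite_self]
        exact fun h' => hl (hu l h'.2)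
      · simp
    · simp [hs]
  simp only [e2]
  rw [Finset.sum_comm]
  refine Finset.sum_congr rfl fun k _ => ?_
  by_cases hA : IsOff (moveMat (relPos V V') k h h') A
  swap
  · simp [hA]
  simp only [hA, if_true]
  rw [Finset.sum_boole, ← Fintype.card_subtype, ← Nat.card_eq_fintype_card,
    natCard_stepType hh, chevCoeff, eval_mul, eval_pow, eval_X, eval_finsetSum]
  simp only [eval_pow, eval_X]
  have hk : k ≤ h := ((isOff_moveMat_iff (relPos_nonneg V V') A hlt).1 hA).1.1
  -- The step removes one unit from the cell (k, h'), so (V, V') has one more there than A; hence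
  -- the quantum integer of a_{kh'} + 1.
  have f1 : relPos V V' k h' = ent A k h' + 1 := by
    have := hA k h' (hk.trans_lt hlt).ne
    simp only [moveMat, if_true, if_neg hlt.ne'] at this
    omega
  have f2 : (∑ i, if i < k then relPos V V' i h' else 0) =
      ((∑ i, if i < k then ent A i h' else 0 : ℕ) : ℤ) := by
    push_cast
    refine Finset.sum_congr rfl fun i _ => ?_
    by_cases hik : i < k
    · have := hA i h' ((hik.trans_le hk).trans hlt).ne
      simp only [moveMat, if_neg hik.ne, add_zero] at this
      simp [hik, this]
    · simp [hik]
  rw [f1, f2, Int.toNat_natCast]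
  congr 2

/-! ### Hall polynomials -/

theorem relMat_zero (F : Type) [Field F] [Finite F] (d : ℕ) : relMat F d (0 : Idx n) = 1 := by
  classical
  ext V V'
  rw [relMat_apply, Matrix.one_apply]
  exact if_congr isOff_zero_iff rfl rfl

/-- The products with the combination `ψ` are given by polynomials. -/
def HasHall (ψ : Idx n →₀ ℤ[X]) : Prop :=
  ∀ A : Idx n, ∃ φ : Idx n →₀ ℤ[X], ∀ (F : Type) [Field F] [Finite F] (d : ℕ),
    relMat F d A * hallEval F d ψ = hallEval F d φ

theorem HasHall.zero : HasHall (0 : Idx n →₀ ℤ[X]) := fun _ =>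
  ⟨0, fun F _ _ d => by rw [map_zero, mul_zero]⟩

theorem HasHall.add {φ ψ : Idx n →₀ ℤ[X]} (hφ : HasHall φ) (hψ : HasHall ψ) :
    HasHall (φ + ψ) := fun A => by
  obtain ⟨φ', h1⟩ := hφ A
  obtain ⟨ψ', h2⟩ := hψ A
  exact ⟨φ' + ψ', fun F _ _ d => by rw [map_add, map_add, mul_add, h1, h2]⟩

theorem HasHall.smul {φ : Idx n →₀ ℤ[X]} (hφ : HasHall φ) (P : ℤ[X]) :
    HasHall (P • φ) := fun A => by
  obtain ⟨φ', h1⟩ := hφ A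
  exact ⟨P • φ', fun F _ _ d => by rw [hallEval_smul, hallEval_smul, mul_smul_comm, h1]⟩

theorem HasHall.sum {ι : Type*} (s : Finset ι) {φ : ι → Idx n →₀ ℤ[X]}
    (h : ∀ i ∈ s, HasHall (φ i)) : HasHall (∑ i ∈ s, φ i) := by
  classical
  induction s using Finset.induction_on with
  | empty => exact HasHall.zero
  | insert a s ha ih =>
    rw [Finset.sum_insert ha]
    exact (h a (by simp)).add (ih fun i hi => h i (by simp [hi]))

theorem hallEval_mul_unitIdx (F : Type) [Field F] [Finite F] (d : ℕ) (φ : Idx n →₀ ℤ[X])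
    {h h' : Fin n} (hh : (h : ℕ) + 1 = h') :
    hallEval F d φ * relMat F d (unitIdx (upair h h' (lt_of_val_add_one hh))) =
      hallEval F d (φ.sum fun C P => P • chev C h h') := by
  induction φ using Finsupp.induction_linear with
  | zero => simp
  | add φ ψ h1 h2 =>
    rw [map_add, add_mul, h1, h2, Finsupp.sum_add_index' (by simp) (by intros; rw [add_smul]),
      map_add]
  | single C P =>
    rw [Finsupp.sum_single_index (by simp), hallEval_single, hallEval_smul, smul_mul_assoc,
      relMat_mul_unitIdx F d C hh]

/-- Associativity: B · (A · E_{hh'}) = (B · A) · E_{hh'}, where the inner product is known and the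
outer one is a simple root multiplication. -/
theorem HasHall.chev {A : Idx n} (hA : HasHall (Finsupp.single A 1)) {h h' : Fin n}
    (hh : (h : ℕ) + 1 = h') : HasHall (chev A h h') := fun B => by
  obtain ⟨φ, hφ⟩ := hA B
  refine ⟨φ.sum fun C P => P • _root_.chev C h h', fun F _ _ d => ?_⟩
  rw [← hallEval_mul_unitIdx F d φ hh, ← relMat_mul_unitIdx F d A hh, ← mul_assoc, ← hφ,
    hallEval_single_one]

/-- Division by a monic polynomial with positive values. -/
theorem HasHall.of_smul {φ : Idx n →₀ ℤ[X]} {D : ℤ[X]} (hD : D.Monic)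
    (hpos : ∀ q : ℤ, 0 < q → D.eval q ≠ 0) (h : HasHall (D • φ)) : HasHall φ := fun A => by
  obtain ⟨ψ, hψ⟩ := h A
  -- Over `ZMod p` the coefficient of C evaluates to D(p) times an integer matrix entry, so
  -- divisibility holds at all odd primes and hence for the polynomials.
  have hdvd : ∀ C, D ∣ ψ C := by
    intro C
    refine hD.dvd_of_eval_dvd fun p hp _ => ?_
    have : Fact p.Prime := ⟨hp⟩
    obtain ⟨V, V', hV⟩ := exists_isOff (ZMod p) C
    have h1 := congrFun (congrFun (hψ (ZMod p) (size C)) V) V'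
    rw [hallEval_apply _ _ hV, hallEval_smul, mul_smul_comm, Matrix.smul_apply, Nat.card_zmod] at h1
    rw [← h1]
    exact dvd_mul_right _ _
  choose χ hχ using hdvd
  have hfin : (Function.support χ).Finite := by
    refine ψ.support.finite_toSet.subset fun C hC => ?_
    simp only [Function.mem_support] at hC
    simp [hχ C, hC, hD.ne_zero]
  refine ⟨Finsupp.ofSupportFinite χ hfin, fun F _ _ d => ?_⟩
  have hψ' : ψ = D • Finsupp.ofSupportFinite χ hfin := by
    ext1 C
    rw [Finsupp.smul_apply, smul_eq_mul]
    exact hχ C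
  have h1 := hψ F d
  rw [hψ', hallEval_smul, hallEval_smul, mul_smul_comm] at h1
  have hq : (0 : ℤ) < Nat.card F := by exact_mod_cast Nat.card_pos
  exact smul_right_injective _ (hpos _ hq) h1

/-- The measure for the induction on the right factor. -/
def hallMeasure (A : Idx n) : ℕ :=
  ∑ p : UPair n, A p * ((n - (p.1.1 : ℕ)) * ((p.1.2 : ℕ) - (p.1.1 : ℕ)))

theorem hallMeasure_add (A B : Idx n) : hallMeasure (A + B) = hallMeasure A + hallMeasure B := by
  simp [hallMeasure, add_mul, Finset.sum_add_distrib]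

theorem hallMeasure_unitIdx (p : UPair n) :
    hallMeasure (unitIdx p) = (n - (p.1.1 : ℕ)) * ((p.1.2 : ℕ) - (p.1.1 : ℕ)) := by
  rw [hallMeasure, Finset.sum_eq_single p]
  · simp
  · intro q _ hq
    simp [hq]
  · simp

/-- A unit at (i, j) weighs (n - i)(j - i), so a move in row k adds n - k whatever h is. The highest
row in which a move is possible thus gives the strictly largest term of the product. -/
theorem hallMeasure_moveIdx (A : Idx n) {k h h' : Fin n} (hh : (h : ℕ) + 1 = h')
    (hk : CanMove A k h) : hallMeasure (moveIdx A k h h') = hallMeasure A + (n - (k : ℕ)) := by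
  have hlt := lt_of_val_add_one hh
  rcases eq_or_lt_of_le hk.1 with rfl | hkh
  · rw [moveIdx_self A hlt, hallMeasure_add, hallMeasure_unitIdx]
    simp only [← hh]
    simp
  · obtain ⟨B, rfl⟩ := exists_eq_add_unitIdx A hkh (hk.2 hkh)
    rw [moveIdx_add B hkh (hkh.trans hlt), hallMeasure_add, hallMeasure_add, hallMeasure_unitIdx,
      hallMeasure_unitIdx, add_assoc, add_right_inj]
    simp only [← hh]
    rw [Nat.sub_add_comm (show (k : ℕ) ≤ h from hk.1), mul_add, mul_one]

/-- In the topmost nonzero row k of B, one unit is pushed back by one column (into the diagonal if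
it sits next to it). Since the rows above k stay empty, every other move available to B' with the
same h lies below row k. -/
theorem exists_chev_leading {B : Idx n} (hB : B ≠ 0) : ∃ (B' : Idx n) (k h h' : Fin n),
    (h : ℕ) + 1 = h' ∧ CanMove B' k h ∧ moveIdx B' k h h' = B ∧
      ∀ i j, i < k → ent B' i j = 0 := by
  classical
  have hex : ∃ k : ℕ, ∃ p : UPair n, (p.1.1 : ℕ) = k ∧ B p ≠ 0 := by
    obtain ⟨p, hp⟩ := Function.ne_iff.1 hB
    exact ⟨_, p, rfl, hp⟩
  obtain ⟨p, hpk, hp⟩ := Nat.find_spec hex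
  have hmin : ∀ i j, i < p.1.1 → ent B i j = 0 := by
    intro i j hi
    by_cases hij : i < j
    · rw [ent_of_lt _ hij]
      by_contra hne
      rw [Fin.lt_def, hpk] at hi
      exact Nat.find_min hex hi ⟨upair i j hij, rfl, hne⟩
    · exact ent_of_not_lt _ hij
  obtain ⟨⟨k, h'⟩, hkh'⟩ := p
  simp only at hmin hkh'
  obtain ⟨B₀, rfl⟩ := exists_eq_add_unitIdx B hkh' (by
    rw [ent_of_lt _ hkh']; exact Nat.pos_of_ne_zero hp)
  have hpos : 0 < (h' : ℕ) := lt_of_le_of_lt (Nat.zero_le _) hkh'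
  obtain ⟨h, hh⟩ : ∃ h : Fin n, (h : ℕ) + 1 = h' :=
    ⟨⟨(h' : ℕ) - 1, by omega⟩, by simp only; omega⟩
  have hmin' : ∀ i j, i < k → ent B₀ i j = 0 := by
    intro i j hi
    have := hmin i j hi
    rw [ent_add] at this
    omega
  have hkh : k ≤ h := by
    rw [Fin.le_def]
    rw [Fin.lt_def] at hkh'
    omega
  rcases eq_or_lt_of_le hkh with rfl | hlt
  · exact ⟨B₀, k, k, h', hh, ⟨le_rfl, fun h => (lt_irrefl _ h).elim⟩, moveIdx_self _ _, hmin'⟩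
  · refine ⟨B₀ + unitIdx (upair k h hlt), k, h, h', hh, ⟨hkh, fun _ => ?_⟩,
      moveIdx_add _ _ _, fun i j hi => ?_⟩
    · rw [ent_add, ent_single]
      simp
    · rw [ent_add, ent_single, hmin' i j hi, if_neg]
      simp [hi.ne]

/-- By `exists_chev_leading`, B' · E_{hh'} is a quantum integer times B plus terms of smaller
measure. The product, the remaining terms and B' are all covered by the induction, so the multiple
of B is; then the quantum integer is divided out. -/
theorem hasHall_single (B : Idx n) : HasHall (Finsupp.single B 1) := by
  classical
  induction hm : hallMeasure B using Nat.strong_induction_on generalizing B with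
  | _ m ih =>
    by_cases hB : B = 0
    · subst hB
      refine fun A => ⟨Finsupp.single A 1, fun F _ _ d => ?_⟩
      rw [hallEval_single_one, hallEval_single_one]
      rw [relMat_zero, mul_one]
    obtain ⟨B', k, h, h', hh, hk, rfl, hmin⟩ := exists_chev_leading hB
    have hm' := hallMeasure_moveIdx B' hh hk
    have hB' : HasHall (Finsupp.single B' 1) := ih _ (by omega) B' rfl
    have hlt := lt_of_val_add_one hh
    have hrest : HasHall (∑ k' ∈ Finset.univ.erase k,
        if CanMove B' k' h then Finsupp.single (moveIdx B' k' h h') (chevCoeff B' k' h') else 0) := by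
      refine HasHall.sum _ fun k' hk' => ?_
      split_ifs with hc
      · have hkk : k < k' := by
          refine lt_of_le_of_ne (not_lt.1 fun hlt' => ?_) (Finset.ne_of_mem_erase hk').symm
          have := hc.2 (hlt'.trans_le hk.1)
          rw [hmin k' h hlt'] at this
          exact lt_irrefl _ this
        have := ih _ (by
          rw [hallMeasure_moveIdx B' hh hc] at *
          have := k'.2
          rw [Fin.lt_def] at hkk
          omega) (moveIdx B' k' h h') rfl
        have := this.smul (chevCoeff B' k' h')
        rwa [Finsupp.smul_single, smul_eq_mul, mul_one] at this
      · exact HasHall.zero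
    have h0 : (∑ i, if i < k then ent B' i h' else 0) = 0 :=
      Finset.sum_eq_zero fun i _ => by
        split_ifs with hi
        · exact hmin i h' hi
        · rfl
    have hlead : HasHall ((∑ t ∈ Finset.range (ent B' k h' + 1), X ^ t : ℤ[X]) •
        Finsupp.single (moveIdx B' k h h') 1) := by
      have e := (hB'.chev hh).add (hrest.smul (-1))
      rw [_root_.chev, ← Finset.add_sum_erase _ _ (Finset.mem_univ k), if_pos hk, chevCoeff, h0,
        pow_zero, one_mul, neg_smul, one_smul, add_neg_cancel_right] at e
      rwa [Finsupp.smul_single, smul_eq_mul, mul_one]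
    refine hlead.of_smul (monic_geom_sum_X (by omega)) fun q hq => ?_
    rw [eval_finsetSum]
    simp only [eval_pow, eval_X]
    exact (Finset.sum_pos (fun t _ => pow_pos hq t) ⟨0, by simp⟩).ne'

/-- The Hall polynomials of `A` and `B`. -/
def hall (A B : Idx n) : Idx n →₀ ℤ[X] := (hasHall_single B A).choose

theorem relMat_mul (F : Type) [Field F] [Finite F] (d : ℕ) (A B : Idx n) :
    relMat F d A * relMat F d B = hallEval F d (hall A B) := by
  rw [hall, ← (hasHall_single B A).choose_spec F d, hallEval_single_one]

theorem hall_zero_right (A : Idx n) : hall A 0 = Finsupp.single A 1 :=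
  hallEval_ext fun F _ _ d => by
    rw [← relMat_mul, relMat_zero, mul_one, hallEval_single_one]

theorem hall_zero_left (A : Idx n) : hall 0 A = Finsupp.single A 1 :=
  hallEval_ext fun F _ _ d => by
    rw [← relMat_mul, relMat_zero, one_mul, hallEval_single_one]

theorem hall_unitIdx (A : Idx n) {h h' : Fin n} (hh : (h : ℕ) + 1 = h') :
    hall A (unitIdx (upair h h' (lt_of_val_add_one hh))) = chev A h h' :=
  hallEval_ext fun F _ _ d => by rw [← relMat_mul, relMat_mul_unitIdx F d A hh]

theorem hallEval_sum_hall_right (F : Type) [Field F] [Finite F] (d : ℕ) (φ : Idx n →₀ ℤ[X])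
    (C : Idx n) :
    hallEval F d (φ.sum fun E P => P • hall E C) = hallEval F d φ * relMat F d C := by
  induction φ using Finsupp.induction_linear with
  | zero => simp
  | add φ ψ h1 h2 =>
    rw [map_add, add_mul, ← h1, ← h2, Finsupp.sum_add_index' (by simp) (by intros; rw [add_smul]),
      map_add]
  | single E P =>
    rw [Finsupp.sum_single_index (by simp), hallEval_single, hallEval_smul, smul_mul_assoc,
      relMat_mul]

theorem hallEval_sum_hall_left (F : Type) [Field F] [Finite F] (d : ℕ) (φ : Idx n →₀ ℤ[X])
    (A : Idx n) :
    hallEval F d (φ.sum fun E P => P • hall A E) = relMat F d A * hallEval F d φ := by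
  induction φ using Finsupp.induction_linear with
  | zero => simp
  | add φ ψ h1 h2 =>
    rw [map_add, mul_add, ← h1, ← h2, Finsupp.sum_add_index' (by simp) (by intros; rw [add_smul]),
      map_add]
  | single E P =>
    rw [Finsupp.sum_single_index (by simp), hallEval_single, hallEval_smul, mul_smul_comm,
      relMat_mul]

/-- Associativity of the Hall algebra. -/
theorem hall_assoc (A B C : Idx n) : ((hall A B).sum fun E P => P • hall E C) =
    (hall B C).sum fun E P => P • hall A E :=
  hallEval_ext fun F _ _ d => by
    rw [hallEval_sum_hall_right, hallEval_sum_hall_left, ← relMat_mul, ← relMat_mul, mul_assoc]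

/-! ### Gradings of the Hall algebra -/

/-- A nonzero polynomial is nonzero at some odd prime, where its value counts middle flags. Any
invariant of pairs of flags that is additive along V, V'', V' therefore becomes a grading. -/
theorem exists_of_hall_ne_zero {A B C : Idx n} (h : hall A B C ≠ 0) :
    ∃ (F : Type) (_ : Field F) (d : ℕ) (V V'' V' : NStepFlag F n d),
      IsOff (relPos V V') C ∧ IsOff (relPos V V'') A ∧ IsOff (relPos V'' V') B := by
  by_contra hne
  apply h
  refine Polynomial.eq_of_eval_odd_primes fun p hp _ => ?_
  have : Fact p.Prime := ⟨hp⟩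
  obtain ⟨V, V', hV⟩ := exists_isOff (ZMod p) C
  have h1 := congrFun (congrFun (relMat_mul (ZMod p) (size C) A B) V) V'
  rw [hallEval_apply _ _ hV, relMat_mul_apply, Nat.card_zmod] at h1
  have : IsEmpty {V'' : NStepFlag (ZMod p) n (size C) //
      IsOff (relPos V V'') A ∧ IsOff (relPos V'' V') B} :=
    ⟨fun W => hne ⟨ZMod p, inferInstance, _, V, W.1, V', hV, W.2.1, W.2.2⟩⟩
  rw [← h1, Nat.card_of_isEmpty]
  simp

/-- The difference `co - ro`. -/
def wt (A : Idx n) : Fin n → ℤ := fun i => colSum (toMat A) i - rowSum (toMat A) i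

theorem IsOff.eq_add_diagonal {Z : Matrix (Fin n) (Fin n) ℤ} {A : Idx n} (h : IsOff Z A) :
    Z = toMat A + Matrix.diagonal fun i => Z i i := by
  ext i j
  by_cases hij : i = j
  · subst hij
    simp [toMat, ent_of_not_lt]
  · simp [toMat, h i j hij, hij]

theorem rowSum_add_diagonal (Z : Matrix (Fin n) (Fin n) ℤ) (l : Fin n → ℤ) :
    rowSum (Z + Matrix.diagonal l) = rowSum Z + l := by
  ext i
  simp [rowSum, Finset.sum_add_distrib, Matrix.diagonal_apply]

theorem colSum_add_diagonal (Z : Matrix (Fin n) (Fin n) ℤ) (l : Fin n → ℤ) :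
    colSum (Z + Matrix.diagonal l) = colSum Z + l := by
  ext i
  simp [colSum, Finset.sum_add_distrib, Matrix.diagonal_apply]

theorem IsOff.colSum_eq {Z : Matrix (Fin n) (Fin n) ℤ} {A : Idx n} (h : IsOff Z A) :
    colSum Z = rowSum Z + wt A := by
  rw [h.eq_add_diagonal, rowSum_add_diagonal, colSum_add_diagonal]
  ext i
  simp only [wt, Pi.add_apply]
  ring

/-- The weight is the difference between the successive dimension jumps of V' and of V, which
telescopes. -/
theorem wt_of_hall_ne_zero {A B C : Idx n} (h : hall A B C ≠ 0) : wt C = wt A + wt B := by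
  obtain ⟨F, _, d, V, V'', V', h1, h2, h3⟩ := exists_of_hall_ne_zero h
  ext i
  have e1 := congrFun h1.colSum_eq i
  have e2 := congrFun h2.colSum_eq i
  have e3 := congrFun h3.colSum_eq i
  rw [Pi.add_apply, colSum_relPos, rowSum_relPos] at e1 e2 e3
  rw [Pi.add_apply]
  omega

theorem deg_of_hall_ne_zero {A B C : Idx n} (h : hall A B C ≠ 0) (t : Fin (n + 1)) :
    deg C t = deg A t + deg B t := by
  obtain ⟨F, _, d, V, V'', V', h1, h2, h3⟩ := exists_of_hall_ne_zero h
  have e1 := h1.finrank_eq t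
  have e2 := h2.finrank_eq t
  have e3 := h3.finrank_eq t
  omega

/-! ### The indeterminate `v` -/

theorem vv_ne_zero : vv ≠ 0 := RatFunc.X_ne_zero

theorem vv_pow_injective : Function.Injective fun k : ℕ => vv ^ k := by
  intro a b hab
  have h : (algebraMap ℚ[X] Kv) (X ^ a) = (algebraMap ℚ[X] Kv) (X ^ b) := by
    rw [map_pow, map_pow, RatFunc.algebraMap_X]
    exact hab
  have h2 := congrArg natDegree (RatFunc.algebraMap_injective ℚ h)
  simpa using h2

theorem vv_zpow_injective : Function.Injective fun k : ℤ => vv ^ k := by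
  have key : ∀ a b : ℤ, a ≤ b → vv ^ a = vv ^ b → a = b := by
    intro a b hle hab
    obtain ⟨c, rfl⟩ := Int.le.dest hle
    rw [zpow_add₀ vv_ne_zero, eq_comm, mul_eq_left₀ (zpow_ne_zero _ vv_ne_zero),
      zpow_natCast] at hab
    have := vv_pow_injective (a₁ := c) (a₂ := 0) (by simpa using hab)
    simp [this]
  intro a b hab
  rcases le_total a b with h | h
  · exact key a b h hab
  · exact (key b a h hab.symm).symm

theorem aeval_vv_sq_ne_zero {P : ℤ[X]} (hP : P ≠ 0) : aeval (vv ^ 2) P ≠ 0 := by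
  have h1 : aeval (vv ^ 2) P = algebraMap ℚ[X] Kv ((P.map (Int.castRingHom ℚ)).comp (X ^ 2)) := by
    rw [comp, eval₂_map, hom_eval₂]
    have : (algebraMap ℚ[X] Kv) (X ^ 2) = vv ^ 2 := by
      rw [map_pow, RatFunc.algebraMap_X]; rfl
    rw [this, aeval_def]
    congr 1
  rw [h1, Ne, map_eq_zero_iff _ (RatFunc.algebraMap_injective ℚ)]
  intro h
  rw [comp_eq_zero_iff] at h
  rcases h with h | ⟨_, h⟩
  · exact hP (map_injective _ (Int.castRingHom ℚ).injective_int (by rw [h, Polynomial.map_zero]))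
  · have := congrArg natDegree h
    simp at this

/-! ### Stabilization for upper triangular matrices -/

theorem IsOff.ext_rowSum {Z Z' : Matrix (Fin n) (Fin n) ℤ} {A : Idx n} (h : IsOff Z A)
    (h' : IsOff Z' A) (hr : rowSum Z = rowSum Z') : Z = Z' := by
  rw [h.eq_add_diagonal, h'.eq_add_diagonal, rowSum_add_diagonal, rowSum_add_diagonal] at hr
  rw [h.eq_add_diagonal, h'.eq_add_diagonal, add_left_cancel hr]

theorem IsOff.add_diagonal {Z : Matrix (Fin n) (Fin n) ℤ} {A : Idx n} (h : IsOff Z A)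
    (l : Fin n → ℤ) : IsOff (Z + Matrix.diagonal l) A := fun i j hij => by
  rw [Matrix.add_apply, Matrix.diagonal_apply_ne _ hij, add_zero, h i j hij]

theorem shift_eq (p : ℕ) (A : ThetaTilde n) :
    shift p A = A.1 + Matrix.diagonal fun _ => (p : ℤ) := by
  rw [shift, ← Matrix.diagonal_one, ← Matrix.diagonal_smul]
  congr 2
  ext i
  simp

theorem isOff_shift_iff {p : ℕ} {Z : ThetaTilde n} {A : Idx n} :
    IsOff (shift p Z) A ↔ IsOff Z.1 A := by
  rw [shift_eq]
  refine ⟨fun h => ?_, fun h => h.add_diagonal _⟩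
  have := h.add_diagonal (fun _ => -(p : ℤ))
  rwa [add_assoc, Matrix.diagonal_add, show (fun i : Fin n => (p : ℤ) + -(p : ℤ)) = 0 by
    ext; simp, Matrix.diagonal_zero', add_zero] at this

/-- A diagonal entry in the position (k, l) forces j < l = k ≤ i, where the other factor is below
the diagonal and vanishes. So only diagonal entries in the position (i, j) contribute, and their
partners (k, l) with k ≤ i < l add up to `deg`. -/
theorem dimDiff_add_diagonal {Z : Matrix (Fin n) (Fin n) ℤ} {A : Idx n} (hZ : IsOff Z A)
    (l : Fin n → ℤ) :
    dimDiff (Z + Matrix.diagonal l) = dimDiff Z + ∑ i, l i * deg A i.succ := by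
  have key : ∀ i j k m : Fin n, (if k ≤ i ∧ j < m then
      (Z + Matrix.diagonal l) i j * (Z + Matrix.diagonal l) k m else 0) =
      (if k ≤ i ∧ j < m then Z i j * Z k m else 0) +
        if i = j then (if k.castSucc < i.succ ∧ i.succ ≤ m.castSucc then
          l i * (ent A k m : ℤ) else 0) else 0 := by
    intro i j k m
    simp only [Fin.castSucc_lt_succ_iff, Fin.succ_le_castSucc_iff]
    by_cases hc : k ≤ i ∧ j < m
    · rw [if_pos hc, if_pos hc, Matrix.add_apply, Matrix.add_apply]
      by_cases hij : i = j
      · subst hij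
        have hkm : k ≠ m := (hc.1.trans_lt hc.2).ne
        rw [if_pos rfl, if_pos hc, Matrix.diagonal_apply_eq, Matrix.diagonal_apply_ne _ hkm,
          hZ k m hkm]
        ring
      · rw [if_neg hij, Matrix.diagonal_apply_ne _ hij]
        by_cases hkm : k = m
        · subst hkm
          have hji : j < i := hc.2.trans_le hc.1
          rw [hZ i j hij, ent_of_not_lt _ hji.not_gt]
          simp
        · rw [Matrix.diagonal_apply_ne _ hkm]
          ring
    · rw [if_neg hc, if_neg hc]
      by_cases hij : i = j
      · subst hij
        rw [if_neg hc]
        simp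
      · rw [if_neg hij, zero_add]
  rw [dimDiff, dimDiff]
  simp only [key, Finset.sum_add_distrib]
  congr 1
  refine Finset.sum_congr rfl fun i _ => ?_
  rw [Finset.sum_eq_single i]
  · simp only [if_true, deg, Finset.mul_sum, mul_ite, mul_zero]
  · intro j _ hj
    simp [hj.symm]
  · simp

theorem eventually_nonneg_shift (Z : ThetaTilde n) :
    ∀ᶠ p : ℕ in Filter.atTop, ∀ i j, 0 ≤ shift p Z i j := by
  filter_upwards [Filter.eventually_ge_atTop (∑ i, (Z.1 i i).natAbs)] with p hp i j
  rw [shift_eq, Matrix.add_apply]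
  by_cases hij : i = j
  · subst hij
    have h1 : (Z.1 i i).natAbs ≤ ∑ i, (Z.1 i i).natAbs :=
      Finset.single_le_sum (f := fun i => (Z.1 i i).natAbs) (fun _ _ => Nat.zero_le _)
        (Finset.mem_univ i)
    rw [Matrix.diagonal_apply_eq]
    omega
  · rw [Matrix.diagonal_apply_ne _ hij, add_zero]
    exact Z.2 i j hij

theorem sum_shift (p : ℕ) (Z : ThetaTilde n) :
    ∑ i, ∑ j, shift p Z i j = ∑ i, rowSum Z.1 i + n * p := by
  change ∑ i, rowSum (shift p Z) i = _
  rw [shift_eq, rowSum_add_diagonal]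
  simp [Finset.sum_add_distrib]

theorem IsSchurCoeff.unique {d : ℕ} {A B C : Matrix (Fin n) (Fin n) ℤ} (hC : IsTheta d C)
    {x y : Kv} (hx : IsSchurCoeff d A B C x) (hy : IsSchurCoeff d A B C y) : x = y := by
  obtain ⟨P, hP, rfl⟩ := hx
  obtain ⟨Q, hQ, rfl⟩ := hy
  congr 2
  refine Polynomial.eq_of_eval_odd_primes fun p hp h2 => ?_
  have : Fact p.Prime := ⟨hp⟩
  obtain ⟨V, V', hV⟩ := exists_relPos_eq (ZMod p) hC
  have hc : ringChar (ZMod p) ≠ 2 := by rwa [ZMod.ringChar_zmod_n]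
  have e1 := hP (ZMod p) hc V V' hV
  have e2 := hQ (ZMod p) hc V V' hV
  rw [Nat.card_zmod] at e1 e2
  rw [e1, e2]

/-- The values v^{-p} are pairwise distinct and each Schur coefficient is determined by counts over
prime fields, so two families agree at infinitely many points. Hence any explicit stable family is
the one chosen in `basisMul`. -/
theorem IsStableProduct.unique {A B : ThetaTilde n} {G G' : ThetaTilde n →₀ Kv[X]}
    (hG : IsStableProduct A B G) (hG' : IsStableProduct A B G') : G = G' := by
  obtain ⟨p₀, h⟩ := hG
  obtain ⟨p₁, h'⟩ := hG'
  ext1 Z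
  by_cases hZ : Z ∈ G.support ∨ Z ∈ G'.support
  · refine eq_of_infinite_eval_eq _ _ (((Set.Ici_infinite (max p₀ p₁)).image
      (f := fun p : ℕ => vv ^ (-(p : ℤ))) fun a _ b _ hab => ?_).mono ?_)
    · have := vv_zpow_injective hab
      omega
    · rintro _ ⟨p, hp, rfl⟩
      obtain ⟨d, h1, h2, h3, h4⟩ := h p ((le_max_left _ _).trans hp)
      obtain ⟨d', h1', h2', h3', h4'⟩ := h' p ((le_max_right _ _).trans hp)
      have hd : d = d' := by
        have := h1.2.symm.trans h1'.2
        exact_mod_cast this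
      subst hd
      have hT : IsTheta d (shift p Z) := hZ.elim (h3 Z) (h3' Z)
      exact (h4 Z hT).unique hT (h4' Z hT)
  · rw [not_or, Finsupp.notMem_support_iff, Finsupp.notMem_support_iff] at hZ
    rw [hZ.1, hZ.2]

/-- The off-diagonal part of an upper triangular matrix. -/
def offIdx (Z : ThetaTilde n) : Idx n := fun p => (Z.1 p.1.1 p.1.2).toNat

theorem IsOff.offIdx_eq {Z : ThetaTilde n} {C : Idx n} (h : IsOff Z.1 C) : offIdx Z = C := by
  funext p
  rw [offIdx, h _ _ p.2.ne, ent_of_lt _ p.2, Int.toNat_natCast]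

/-- The coefficient of `[Z]` in the product of `[ZA]` and `[ZB]` if these are upper triangular. -/
def upperCoeff (ZA ZB Z : ThetaTilde n) : Kv :=
  vv ^ (dimDiff Z.1 - dimDiff ZA.1 - dimDiff ZB.1) *
    aeval (vv ^ 2) (hall (offIdx ZA) (offIdx ZB) (offIdx Z))

/-- `Z` is upper triangular and has the same row sums as `ZA`. -/
def UpperMatch (ZA Z : ThetaTilde n) : Prop := IsOff Z.1 (offIdx Z) ∧ rowSum Z.1 = rowSum ZA.1

open Classical in
/-- The product of two upper triangular basis elements. -/
def upperProd (ZA ZB : ThetaTilde n) : ThetaTilde n →₀ Kv :=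
  Finsupp.ofSupportFinite (fun Z => if UpperMatch ZA Z then upperCoeff ZA ZB Z else 0) (by
    refine Set.Finite.of_injOn (f := offIdx) (t := ((hall (offIdx ZA) (offIdx ZB)).support : Set _))
      (fun Z hZ => ?_) (fun Z hZ Z' hZ' hoff => ?_) (Finset.finite_toSet _)
    · simp only [Function.mem_support, ne_eq, ite_eq_right_iff, Classical.not_imp] at hZ
      rw [Finset.mem_coe, Finsupp.mem_support_iff]
      intro h0
      exact hZ.2 (by rw [upperCoeff, h0, map_zero, mul_zero])
    · simp only [Function.mem_support, ne_eq, ite_eq_right_iff, Classical.not_imp] at hZ hZ'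
      exact Subtype.ext (hZ.1.1.ext_rowSum (hoff ▸ hZ'.1.1) (hZ.1.2.trans hZ'.1.2.symm)))

theorem upperProd_apply_of_match {ZA ZB Z : ThetaTilde n} (h : UpperMatch ZA Z) :
    upperProd ZA ZB Z = upperCoeff ZA ZB Z := if_pos h

theorem upperProd_apply_of_not_match {ZA ZB Z : ThetaTilde n} (h : ¬ UpperMatch ZA Z) :
    upperProd ZA ZB Z = 0 := if_neg h

theorem dimDiff_shift {Z : ThetaTilde n} {C : Idx n} (h : IsOff Z.1 C) (p : ℕ) :
    dimDiff (shift p Z) = dimDiff Z.1 + ∑ i : Fin n, p * deg C i.succ := by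
  rw [shift_eq, dimDiff_add_diagonal h]

/-- An upper triangular matrix is determined by its off-diagonal part and its row sums, and the row
sums are forced: first by V, then by the column sums of the first factor. So the count of middle
flags is the same as without any condition on the diagonal. -/
theorem isOff_iff_relPos_eq {F : Type} [Field F] {d p : ℕ} {ZA ZB Z : ThetaTilde n}
    (hA : IsOff ZA.1 (offIdx ZA)) (hB : IsOff ZB.1 (offIdx ZB))
    (hAB : colSum ZA.1 = rowSum ZB.1) (hZ : rowSum Z.1 = rowSum ZA.1) {V V' : NStepFlag F n d}
    (hV : relPos V V' = shift p Z) (W : NStepFlag F n d) :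
    (relPos V W = shift p ZA ∧ relPos W V' = shift p ZB) ↔
      (IsOff (relPos V W) (offIdx ZA) ∧ IsOff (relPos W V') (offIdx ZB)) := by
  constructor
  · rintro ⟨h1, h2⟩
    rw [h1, h2, isOff_shift_iff, isOff_shift_iff]
    exact ⟨hA, hB⟩
  · rintro ⟨h1, h2⟩
    have e1 : relPos V W = shift p ZA := by
      refine h1.ext_rowSum (isOff_shift_iff.2 hA) ?_
      have e : rowSum (relPos V W) = rowSum (relPos V V') := by
        ext i
        rw [rowSum_relPos, rowSum_relPos]
      rw [e, hV, shift_eq, shift_eq, rowSum_add_diagonal, rowSum_add_diagonal, hZ]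
    refine ⟨e1, h2.ext_rowSum (isOff_shift_iff.2 hB) ?_⟩
    have e : rowSum (relPos W V') = colSum (relPos V W) := by
      ext i
      rw [rowSum_relPos, colSum_relPos]
    rw [e, e1, shift_eq, shift_eq, rowSum_add_diagonal, colSum_add_diagonal, hAB]

/-- In the exponent of v the shift by p contributes p times a sum of values of `deg`, which cancels
because `deg` is additive where the Hall polynomial is nonzero. If Z does not match, a middle flag
would make Z upper triangular with the row sums of ZA, so there is none. -/
theorem isSchurCoeff_upperProd {d p : ℕ} {ZA ZB Z : ThetaTilde n}
    (hA : IsOff ZA.1 (offIdx ZA)) (hB : IsOff ZB.1 (offIdx ZB))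
    (hAB : colSum ZA.1 = rowSum ZB.1) :
    IsSchurCoeff d (shift p ZA) (shift p ZB) (shift p Z) (upperProd ZA ZB Z) := by
  by_cases hm : UpperMatch ZA Z
  · refine ⟨hall (offIdx ZA) (offIdx ZB) (offIdx Z), fun F _ _ _ V V' hV => ?_, ?_⟩
    · have hoff : IsOff (relPos V V') (offIdx Z) := hV ▸ isOff_shift_iff.2 hm.1
      rw [← hallEval_apply F d hoff, ← relMat_mul, relMat_mul_apply]
      congr 1
      exact Nat.card_congr (Equiv.subtypeEquivRight fun W =>
        (isOff_iff_relPos_eq hA hB hAB hm.2 hV W).symm)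
    · rw [upperProd_apply_of_match hm, upperCoeff]
      by_cases h0 : hall (offIdx ZA) (offIdx ZB) (offIdx Z) = 0
      · rw [h0, map_zero, mul_zero, mul_zero]
      · rw [dimDiff_shift hm.1, dimDiff_shift hA, dimDiff_shift hB]
        simp only [deg_of_hall_ne_zero h0, mul_add, Finset.sum_add_distrib]
        congr 2
        ring
  · refine ⟨0, fun F _ _ _ V V' hV => ?_, by
      rw [upperProd_apply_of_not_match hm, map_zero, mul_zero]⟩
    have : IsEmpty {W : NStepFlag F n d // relPos V W = shift p ZA ∧ relPos W V' = shift p ZB} := by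
      refine ⟨fun W => hm ?_⟩
      obtain ⟨W, h1, h2⟩ := W
      have hr : rowSum Z.1 = rowSum ZA.1 := by
        have e : rowSum (relPos V W) = rowSum (relPos V V') := by
          ext i
          rw [rowSum_relPos, rowSum_relPos]
        rw [h1, hV, shift_eq, shift_eq, rowSum_add_diagonal, rowSum_add_diagonal] at e
        exact (add_right_cancel e).symm
      have h3 : (relMat F d (offIdx ZA) * relMat F d (offIdx ZB)) V V' ≠ 0 := by
        rw [relMat_mul_apply, Nat.cast_ne_zero]
        have : Nonempty {W : NStepFlag F n d // IsOff (relPos V W) (offIdx ZA) ∧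
          IsOff (relPos W V') (offIdx ZB)} :=
          ⟨W, (isOff_iff_relPos_eq hA hB hAB hr hV W).1 ⟨h1, h2⟩⟩
        exact Nat.card_pos.ne'
      rw [relMat_mul] at h3
      obtain ⟨C, hC⟩ : ∃ C : Idx n, IsOff (relPos V V') C := by
        by_contra hne
        exact h3 (hallEval_apply_eq_zero F d (fun C hC => hne ⟨C, hC⟩) _)
      rw [hV, isOff_shift_iff] at hC
      exact ⟨hC.offIdx_eq.symm ▸ hC, hr⟩
    rw [eval_zero, Nat.card_of_isEmpty, Nat.cast_zero]

theorem isStableProduct_upperProd {ZA ZB : ThetaTilde n}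
    (hA : IsOff ZA.1 (offIdx ZA)) (hB : IsOff ZB.1 (offIdx ZB))
    (hAB : colSum ZA.1 = rowSum ZB.1) :
    IsStableProduct ZA ZB ((upperProd ZA ZB).mapRange C C_0) := by
  have hev := (eventually_nonneg_shift ZA).and ((eventually_nonneg_shift ZB).and
    ((Filter.eventually_all_finset (upperProd ZA ZB).support).2 fun Z _ =>
      eventually_nonneg_shift Z))
  obtain ⟨p₀, hp₀⟩ := Filter.eventually_atTop.1 hev
  refine ⟨p₀, fun p hp => ?_⟩
  obtain ⟨h1, h2, h3⟩ := hp₀ p hp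
  have hsum : ∑ i, rowSum ZB.1 i = ∑ i, rowSum ZA.1 i := by
    rw [← hAB]
    exact Finset.sum_comm
  have hnonneg : 0 ≤ ∑ i, ∑ j, shift p ZA i j :=
    Finset.sum_nonneg fun i _ => Finset.sum_nonneg fun j _ => h1 i j
  refine ⟨(∑ i, ∑ j, shift p ZA i j).toNat, ⟨h1, (Int.toNat_of_nonneg hnonneg).symm⟩, ⟨h2, ?_⟩,
    fun Z hZ => ?_, fun Z _ => ?_⟩
  · rw [Int.toNat_of_nonneg hnonneg, sum_shift, sum_shift, hsum]
  · have hZ' : Z ∈ (upperProd ZA ZB).support := Finsupp.support_mapRange hZ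
    have hr : rowSum Z.1 = rowSum ZA.1 := by
      by_contra hne
      exact Finsupp.mem_support_iff.1 hZ' (upperProd_apply_of_not_match fun h => hne h.2)
    refine ⟨h3 Z hZ', ?_⟩
    rw [Int.toNat_of_nonneg hnonneg, sum_shift, sum_shift, hr]
  · rw [Finsupp.mapRange_apply, eval_C]
    exact isSchurCoeff_upperProd hA hB hAB

theorem basisMul_eq_upperProd {ZA ZB : ThetaTilde n}
    (hA : IsOff ZA.1 (offIdx ZA)) (hB : IsOff ZB.1 (offIdx ZB))
    (hAB : colSum ZA.1 = rowSum ZB.1) : basisMul ZA ZB = upperProd ZA ZB := by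
  have hG := isStableProduct_upperProd hA hB hAB
  have h : colSum ZA.1 = rowSum ZB.1 ∧ ∃ G, IsStableProduct ZA ZB G := ⟨hAB, _, hG⟩
  rw [basisMul, dif_pos h, h.2.choose_spec.unique hG]
  ext1 Z
  simp

/-! ### The elements of the completion supported on upper triangular matrices -/

theorem rElem_mem (A : Idx n) (x : ThetaTilde n → Kv) : (open Classical in
    fun Z : ThetaTilde n => if IsOff Z.1 A then x Z else 0) ∈ locallyFinite n := by
  classical
  intro t
  constructor
  · refine Set.Subsingleton.finite ?_
    rintro Z ⟨h1, h2⟩ Z' ⟨h3, h4⟩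
    have hZ : IsOff Z.1 A := by
      by_contra h; exact h2 (if_neg h)
    have hZ' : IsOff Z'.1 A := by
      by_contra h; exact h4 (if_neg h)
    exact Subtype.ext (hZ.ext_rowSum hZ' (h1.trans h3.symm))
  · refine Set.Subsingleton.finite ?_
    rintro Z ⟨h1, h2⟩ Z' ⟨h3, h4⟩
    have hZ : IsOff Z.1 A := by
      by_contra h; exact h2 (if_neg h)
    have hZ' : IsOff Z'.1 A := by
      by_contra h; exact h4 (if_neg h)
    refine Subtype.ext (hZ.ext_rowSum hZ' ?_)
    have h5 := h1.trans h3.symm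
    rw [hZ.colSum_eq, hZ'.colSum_eq] at h5
    exact add_right_cancel h5

open Classical in
/-- The element `∑_Z v^{ro(Z) · m} e_Z` of the completion, where `Z` runs over the upper triangular
matrices with off-diagonal part `A` and `e_Z = v^{d(Z) - r(Z)} [Z]`. -/
def rElem (A : Idx n) (m : Fin n → ℤ) : KHat n :=
  ⟨fun Z => if IsOff Z.1 A then vv ^ (dotProduct (rowSum Z.1) m + dimDiff Z.1) else 0,
    rElem_mem A fun Z => vv ^ (dotProduct (rowSum Z.1) m + dimDiff Z.1)⟩

/-- The coefficient of `[Z]`. -/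
def KHat.coeff (Z : ThetaTilde n) : KHat n →ₗ[Kv] Kv where
  toFun ξ := ξ.1 Z
  map_add' _ _ := rfl
  map_smul' _ _ := rfl

theorem KHat.ext_coeff {ξ η : KHat n} (h : ∀ Z, KHat.coeff Z ξ = KHat.coeff Z η) : ξ = η :=
  KHat.ext h

open Classical in
theorem coeff_rElem (A : Idx n) (m : Fin n → ℤ) (Z : ThetaTilde n) :
    KHat.coeff Z (rElem A m) =
      if IsOff Z.1 A then vv ^ (dotProduct (rowSum Z.1) m + dimDiff Z.1) else 0 := rfl

/-- The upper triangular matrix with off-diagonal part `A` and row sums `t`. -/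
def mkZ (A : Idx n) (t : Fin n → ℤ) : ThetaTilde n :=
  ⟨toMat A + Matrix.diagonal (t - rowSum (toMat A)), fun i j hij => by
    rw [((isOff_toMat A).add_diagonal _) i j hij]
    exact Int.natCast_nonneg _⟩

theorem isOff_mkZ (A : Idx n) (t : Fin n → ℤ) : IsOff (mkZ A t).1 A :=
  (isOff_toMat A).add_diagonal _

theorem rowSum_mkZ (A : Idx n) (t : Fin n → ℤ) : rowSum (mkZ A t).1 = t := by
  rw [mkZ, rowSum_add_diagonal, add_sub_cancel]

theorem colSum_mkZ (A : Idx n) (t : Fin n → ℤ) : colSum (mkZ A t).1 = t + wt A := by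
  rw [(isOff_mkZ A t).colSum_eq, rowSum_mkZ]

theorem eq_mkZ_iff {A : Idx n} {t : Fin n → ℤ} {Z : ThetaTilde n} :
    Z = mkZ A t ↔ IsOff Z.1 A ∧ rowSum Z.1 = t := by
  constructor
  · rintro rfl
    exact ⟨isOff_mkZ A t, rowSum_mkZ A t⟩
  · rintro ⟨h1, h2⟩
    exact Subtype.ext (h1.ext_rowSum (isOff_mkZ A t) (h2.trans (rowSum_mkZ A t).symm))

theorem rowPart_rElem (A : Idx n) (m t : Fin n → ℤ) :
    rowPart t (rElem A m) =
      Finsupp.single (mkZ A t) (vv ^ (dotProduct t m + dimDiff (mkZ A t).1)) := by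
  classical
  ext Z
  change (if rowSum Z.1 = t then KHat.coeff Z (rElem A m) else 0) = _
  rw [coeff_rElem]
  by_cases hZ : Z = mkZ A t
  · subst hZ
    rw [Finsupp.single_eq_same, if_pos (rowSum_mkZ A t), if_pos (isOff_mkZ A t), rowSum_mkZ]
  · rw [Finsupp.single_eq_of_ne hZ]
    by_cases h1 : rowSum Z.1 = t
    · rw [if_pos h1, if_neg fun h => hZ (eq_mkZ_iff.2 ⟨h, h1⟩)]
    · rw [if_neg h1]

theorem colPart_rElem (A : Idx n) (m t : Fin n → ℤ) :
    colPart t (rElem A m) = Finsupp.single (mkZ A (t - wt A))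
      (vv ^ (dotProduct (t - wt A) m + dimDiff (mkZ A (t - wt A)).1)) := by
  classical
  ext Z
  change (if colSum Z.1 = t then KHat.coeff Z (rElem A m) else 0) = _
  rw [coeff_rElem]
  by_cases hZ : Z = mkZ A (t - wt A)
  · subst hZ
    rw [Finsupp.single_eq_same, if_pos (by rw [colSum_mkZ, sub_add_cancel]),
      if_pos (isOff_mkZ _ _), rowSum_mkZ]
  · rw [Finsupp.single_eq_of_ne hZ]
    by_cases h1 : colSum Z.1 = t
    · rw [if_pos h1, if_neg]
      intro h
      refine hZ (eq_mkZ_iff.2 ⟨h, ?_⟩)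
      rw [← h1, h.colSum_eq, add_sub_cancel_right]
    · rw [if_neg h1]

theorem kMul_single (Z Z' : ThetaTilde n) (x y : Kv) :
    kMul (Finsupp.single Z x) (Finsupp.single Z' y) = (x * y) • basisMul Z Z' := by
  simp [kMul, mul_smul]

theorem offIdx_mkZ (A : Idx n) (t : Fin n → ℤ) : offIdx (mkZ A t) = A :=
  (isOff_mkZ A t).offIdx_eq

theorem coeff_rElem_mul (A B : Idx n) (m k : Fin n → ℤ) (Z : ThetaTilde n) :
    KHat.coeff Z (rElem A m * rElem B k) =
      vv ^ (dotProduct (rowSum Z.1) m + dimDiff (mkZ A (rowSum Z.1)).1) *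
      vv ^ (dotProduct (colSum Z.1 - wt B) k + dimDiff (mkZ B (colSum Z.1 - wt B)).1) *
      basisMul (mkZ A (rowSum Z.1)) (mkZ B (colSum Z.1 - wt B)) Z := by
  change kMul (rowPart (rowSum Z.1) (rElem A m)) (colPart (colSum Z.1) (rElem B k)) Z = _
  rw [rowPart_rElem, colPart_rElem, kMul_single, Finsupp.smul_apply, smul_eq_mul]

/-- For each Z, only one summand of either factor contributes. The normalization by `dimDiff`
cancels against that of [Z], leaving the Hall polynomial at v². The twist arises because the
character k is evaluated at the row sums of the right factor, which are those of Z shifted by `wt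
A`. -/
theorem rElem_mul (A B : Idx n) (m k : Fin n → ℤ) :
    rElem A m * rElem B k = vv ^ dotProduct (wt A) k •
      (hall A B).sum fun C P => aeval (vv ^ 2) P • rElem C (m + k) := by
  classical
  refine KHat.ext_coeff fun Z => ?_
  rw [coeff_rElem_mul, map_smul, map_finsuppSum]
  simp only [map_smul, coeff_rElem]
  by_cases hZ : IsOff Z.1 (offIdx Z)
  · rw [Finsupp.sum_eq_single (offIdx Z)
      (fun C _ hC => by rw [if_neg fun h => hC h.offIdx_eq.symm, smul_zero])
      (fun _ => by rw [map_zero, zero_smul]), if_pos hZ]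
    by_cases hw : wt (offIdx Z) = wt A + wt B
    · have hcol : colSum Z.1 - wt B = rowSum Z.1 + wt A := by
        rw [hZ.colSum_eq, hw]
        abel
      rw [basisMul_eq_upperProd (by rw [offIdx_mkZ]; exact isOff_mkZ _ _)
        (by rw [offIdx_mkZ]; exact isOff_mkZ _ _) (by rw [colSum_mkZ, rowSum_mkZ, hcol]),
        upperProd_apply_of_match ⟨hZ, (rowSum_mkZ _ _).symm⟩, upperCoeff, offIdx_mkZ, offIdx_mkZ,
        hcol, smul_eq_mul, smul_eq_mul, ← mul_assoc, ← zpow_add₀ vv_ne_zero,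
        ← zpow_add₀ vv_ne_zero, mul_left_comm, ← zpow_add₀ vv_ne_zero,
        mul_comm (aeval (vv ^ 2) _)]
      congr 2
      rw [add_dotProduct, dotProduct_add]
      ring
    · have h0 : hall A B (offIdx Z) = 0 := by
        by_contra h
        exact hw (wt_of_hall_ne_zero h)
      have hne : ¬ colSum (mkZ A (rowSum Z.1)).1 = rowSum (mkZ B (colSum Z.1 - wt B)).1 := by
        rw [colSum_mkZ, rowSum_mkZ, hZ.colSum_eq]
        intro h
        apply hw
        ext i
        have := congrFun h i
        simp only [Pi.add_apply, Pi.sub_apply] at this ⊢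
        omega
      rw [basisMul, dif_neg fun h => hne h.1, h0]
      simp
  · have hr : (hall A B).sum (fun C P => aeval (vv ^ 2) P •
        if IsOff Z.1 C then vv ^ (dotProduct (rowSum Z.1) (m + k) + dimDiff Z.1) else 0) = 0 := by
      refine Finset.sum_eq_zero fun C _ => ?_
      dsimp only
      rw [if_neg fun h : IsOff Z.1 C => hZ (by rw [h.offIdx_eq]; exact h), smul_zero]
    rw [hr, smul_zero]
    by_cases hc : colSum (mkZ A (rowSum Z.1)).1 = rowSum (mkZ B (colSum Z.1 - wt B)).1
    · rw [basisMul_eq_upperProd (by rw [offIdx_mkZ]; exact isOff_mkZ _ _)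
        (by rw [offIdx_mkZ]; exact isOff_mkZ _ _) hc,
        upperProd_apply_of_not_match fun h => hZ h.1, mul_zero]
    · rw [basisMul, dif_neg fun h => hc h.1]
      simp

theorem deg_zero (t : Fin (n + 1)) : deg (0 : Idx n) t = 0 := by simp [deg]

theorem isOff_iff_hatElem {A : ThetaZero n} {A' : Idx n} (hA : IsOff A.1.1 A') (Z : ThetaTilde n) :
    Z.1 = A.1.1 + Matrix.diagonal (fun i => Z.1 i i) ↔ IsOff Z.1 A' := by
  constructor
  · intro h
    rw [h]
    exact hA.add_diagonal _
  · intro h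
    ext i j
    by_cases hij : i = j
    · subst hij
      simp [A.2 i]
    · rw [Matrix.add_apply, Matrix.diagonal_apply_ne _ hij, add_zero, h i j hij, hA i j hij]

/-- Both exponents of v are affine in the diagonal λ. The first condition equates the slopes, with
`deg` coming from `dimDiff`, and the second the constant terms. -/
theorem hatElem_eq_rElem {A : ThetaZero n} {A' : Idx n} (hA : IsOff A.1.1 A')
    {j m : Fin n → ℤ} (h : ∀ i, j i = m i + deg A' i.succ)
    (h0 : dotProduct (rowSum A.1.1) m + dimDiff A.1.1 = 0) : hatElem A j = rElem A' m := by
  classical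
  refine KHat.ext_coeff fun Z => ?_
  rw [coeff_rElem]
  change (if _ then _ else _) = _
  by_cases hZ : IsOff Z.1 A'
  · have e := (isOff_iff_hatElem hA Z).2 hZ
    rw [if_pos e, if_pos hZ]
    congr 1
    have e1 : rowSum Z.1 = rowSum A.1.1 + fun i => Z.1 i i := by
      conv_lhs => rw [e]
      rw [rowSum_add_diagonal]
    have e2 : dimDiff Z.1 = dimDiff A.1.1 + ∑ i, Z.1 i i * deg A' i.succ := by
      conv_lhs => rw [e]
      rw [dimDiff_add_diagonal hA]
    rw [e1, e2, add_dotProduct]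
    simp only [h, mul_add, Finset.sum_add_distrib]
    simp only [dotProduct] at h0 ⊢
    linarith
  · rw [if_neg fun h => hZ ((isOff_iff_hatElem hA Z).1 h), if_neg hZ]

/-- The sum of the unit vectors strictly between `i` and `j`. -/
def between (i j : Fin n) : Fin n → ℤ := fun k => if i < k ∧ k < j then 1 else 0

theorem hatElem_zeroMat (j : Fin n → ℤ) : hatElem (zeroMat n) j = rElem 0 j := by
  refine hatElem_eq_rElem (fun i j _ => by simp [zeroMat]) (fun i => by simp [deg_zero]) ?_
  have : rowSum (0 : Matrix (Fin n) (Fin n) ℤ) = 0 := by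
    ext
    simp [rowSum]
  simp [zeroMat, this, dimDiff]

/-- For the unit at (i, j), `deg` is the indicator of i ≤ k < j. Subtracted from the unit vector at
i, it leaves minus the indicator of the indices strictly between i and j. -/
theorem hatElem_unitMat {i j : Fin n} (hij : i < j) :
    hatElem (unitMat i j hij.ne) (Pi.single i 1) =
      rElem (unitIdx (upair i j hij)) (-between i j) := by
  have hE : ∀ a b, (unitMat i j hij.ne).1.1 a b = if i = a ∧ j = b then (1 : ℤ) else 0 :=
    fun a b => Matrix.single_apply ..
  refine hatElem_eq_rElem (fun a b _ => ?_) (fun k => ?_) ?_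
  · rw [hE, ent_single]
    simp only [eq_comm]
    split_ifs <;> simp
  · rw [deg_single, Pi.single_apply, Pi.neg_apply, between]
    simp only [Fin.castSucc_lt_succ_iff, Fin.succ_le_castSucc_iff]
    simp only [Fin.ext_iff, Fin.lt_def, Fin.le_def] at *
    split_ifs <;> first | rfl | omega
  · have h1 : dimDiff (unitMat i j hij.ne).1.1 = 0 := by
      refine Finset.sum_eq_zero fun a _ => Finset.sum_eq_zero fun b _ =>
        Finset.sum_eq_zero fun c _ => Finset.sum_eq_zero fun d _ => ?_
      rw [hE, hE]
      split_ifs with h1 h2 h3 <;> try simp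
      rw [← h2.2, ← h3.2] at h1
      exact lt_irrefl _ h1.2
    rw [h1, add_zero]
    refine Finset.sum_eq_zero fun k _ => ?_
    by_cases hk : k = i
    · subst hk
      simp [between]
    · have : rowSum (unitMat i j hij.ne).1.1 k = 0 :=
        Finset.sum_eq_zero fun b _ => by rw [hE, if_neg fun h => hk h.1.symm]
      rw [this, zero_mul]

theorem tBar_of_lt {i j : Fin n} (hij : i < j) : tBar i j =
    (vv - vv⁻¹) • rElem (unitIdx (upair i j hij)) (-between i j) := by
  rw [tBar, dif_pos hij, hatElem_unitMat hij, neg_sub]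

theorem tBar_self (i : Fin n) : tBar i i = rElem 0 (Pi.single i 1) := by
  rw [tBar, dif_neg (lt_irrefl i), if_pos rfl, hatElem_zeroMat]

theorem tBar_of_gt {i j : Fin n} (hij : j < i) : tBar i j = 0 := by
  rw [tBar, dif_neg hij.not_gt, if_neg hij.ne']

theorem KHat.one_eq : (1 : KHat n) = rElem 0 0 := hatElem_zeroMat 0

/-! ### The twisted Hall algebra -/

/-- The Hall algebra at `q = v²`, extended by a torus; the basis element `(A, m)` corresponds to
`rElem A m`. -/
def TwHall (n : ℕ) : Type := (Idx n × (Fin n → ℤ)) →₀ Kv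

namespace TwHall

instance : AddCommGroup (TwHall n) := inferInstanceAs (AddCommGroup (_ →₀ Kv))

instance : Module Kv (TwHall n) := inferInstanceAs (Module Kv (_ →₀ Kv))

/-- The basis element `(A, m)`. -/
def bas (A : Idx n) (m : Fin n → ℤ) : TwHall n := Finsupp.single (A, m) 1

/-- The evaluation of a formal combination at `q = v²`. -/
def emb (m : Fin n → ℤ) : (Idx n →₀ ℤ[X]) →+ TwHall n :=
  Finsupp.liftAddHom fun C =>
    { toFun := fun P => aeval (vv ^ 2) P • bas C m
      map_zero' := by simp
      map_add' := fun P Q => by simp [add_smul] }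

theorem emb_apply (m : Fin n → ℤ) (φ : Idx n →₀ ℤ[X]) :
    emb m φ = φ.sum fun C P => aeval (vv ^ 2) P • bas C m := rfl

theorem emb_single (m : Fin n → ℤ) (C : Idx n) (P : ℤ[X]) :
    emb m (Finsupp.single C P) = aeval (vv ^ 2) P • bas C m := by
  simp [emb]

theorem emb_smul (m : Fin n → ℤ) (P : ℤ[X]) (φ : Idx n →₀ ℤ[X]) :
    emb m (P • φ) = aeval (vv ^ 2) P • emb m φ := by
  induction φ using Finsupp.induction_linear with
  | zero => simp
  | add φ ψ h1 h2 => rw [smul_add, map_add, map_add, smul_add, h1, h2]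
  | single C Q => rw [Finsupp.smul_single, emb_single, emb_single, smul_eq_mul, map_mul, mul_smul]

/-- The product of two basis elements. -/
def basMul (a b : Idx n × (Fin n → ℤ)) : TwHall n :=
  vv ^ dotProduct (wt a.1) b.2 • emb (a.2 + b.2) (hall a.1 b.1)

/-- The bilinear product. -/
def mulMap : TwHall n →ₗ[Kv] TwHall n →ₗ[Kv] TwHall n :=
  Finsupp.lsum Kv fun a => LinearMap.toSpanSingleton Kv _ (Finsupp.lsum Kv fun b =>
    LinearMap.toSpanSingleton Kv (TwHall n) (basMul a b))

theorem mulMap_bas (A B : Idx n) (m k : Fin n → ℤ) : mulMap (bas A m) (bas B k) =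
    vv ^ dotProduct (wt A) k • emb (m + k) (hall A B) := by
  have h1 : mulMap (bas A m) = Finsupp.lsum Kv fun b =>
      LinearMap.toSpanSingleton Kv (TwHall n) (basMul (A, m) b) :=
    (Finsupp.lsum_single ..).trans (one_smul _ _)
  rw [h1]
  exact (Finsupp.lsum_single ..).trans (one_smul _ _)

theorem induction_bas {p : TwHall n → Prop} (x : TwHall n) (h0 : p 0)
    (hadd : ∀ x y, p x → p y → p (x + y)) (hbas : ∀ (c : Kv) A m, p (c • bas A m)) : p x := by
  induction x using Finsupp.induction_linear with
  | zero => exact h0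
  | add x y h1 h2 => exact hadd x y h1 h2
  | single a c =>
    have := hbas c a.1 a.2
    rwa [show c • bas a.1 a.2 = (Finsupp.single a c : _ →₀ Kv) by
      change c • Finsupp.single a (1 : Kv) = _
      rw [Finsupp.smul_single, smul_eq_mul, mul_one]] at this

theorem linearMap_ext {E : Type*} [AddCommMonoid E] [Module Kv E] {f g : TwHall n →ₗ[Kv] E}
    (h : ∀ A m, f (bas A m) = g (bas A m)) : f = g :=
  Finsupp.lhom_ext' fun a => LinearMap.ext_ring (h a.1 a.2)

/-- The twist depends on the weight of the left factor, so it can be pulled out only when φ is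
homogeneous; products of basis elements are, by `wt_of_hall_ne_zero`. -/
theorem mulMap_emb_left {φ : Idx n →₀ ℤ[X]} {w : Fin n → ℤ} (hw : ∀ E, φ E ≠ 0 → wt E = w)
    (C : Idx n) (m k : Fin n → ℤ) : mulMap (emb m φ) (bas C k) =
      vv ^ dotProduct w k • emb (m + k) (φ.sum fun E P => P • hall E C) := by
  rw [emb_apply, Finsupp.sum, map_sum, LinearMap.sum_apply, Finsupp.sum, map_sum, Finset.smul_sum]
  refine Finset.sum_congr rfl fun E hE => ?_
  rw [map_smul, LinearMap.smul_apply, mulMap_bas, emb_smul, hw E (Finsupp.mem_support_iff.1 hE),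
    smul_comm]

theorem mulMap_emb_right (φ : Idx n →₀ ℤ[X]) (A : Idx n) (m k : Fin n → ℤ) :
    mulMap (bas A m) (emb k φ) =
      vv ^ dotProduct (wt A) k • emb (m + k) (φ.sum fun E P => P • hall A E) := by
  rw [emb_apply, Finsupp.sum, map_sum, Finsupp.sum, map_sum, Finset.smul_sum]
  refine Finset.sum_congr rfl fun E hE => ?_
  rw [map_smul, mulMap_bas, emb_smul, smul_comm]

theorem mulMap_assoc (x y z : TwHall n) : mulMap (mulMap x y) z = mulMap x (mulMap y z) := by
  induction x using induction_bas with
  | h0 => simp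
  | hadd x x' h1 h2 => simp [h1, h2]
  | hbas a A m =>
  induction y using induction_bas with
  | h0 => simp
  | hadd y y' h1 h2 =>
    simp only [map_add, LinearMap.add_apply] at h1 h2 ⊢
    rw [h1, h2]
  | hbas b B k =>
  induction z using induction_bas with
  | h0 => simp
  | hadd z z' h1 h2 =>
    simp only [map_add] at h1 h2 ⊢
    rw [h1, h2]
  | hbas c C l =>
    have key : mulMap (mulMap (bas A m) (bas B k)) (bas C l) =
        mulMap (bas A m) (mulMap (bas B k) (bas C l)) := by
      rw [mulMap_bas, mulMap_bas, map_smul, map_smul, LinearMap.smul_apply, mulMap_emb_right,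
        mulMap_emb_left (fun E hE => wt_of_hall_ne_zero hE), hall_assoc, smul_smul, smul_smul,
        ← zpow_add₀ vv_ne_zero, ← zpow_add₀ vv_ne_zero, add_assoc, dotProduct_add, add_dotProduct]
      congr 2
      ring
    simp only [map_smul, LinearMap.smul_apply, key]

theorem wt_zero : wt (0 : Idx n) = 0 := by
  ext i
  simp [wt, toMat, colSum, rowSum]

instance : Ring (TwHall n) :=
  { (inferInstance : AddCommGroup (TwHall n)) with
    mul := fun x y => mulMap x y
    one := bas 0 0
    left_distrib := fun x y z => map_add (mulMap x) y z
    right_distrib := fun x y z => by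
      change mulMap (x + y) z = mulMap x z + mulMap y z
      rw [map_add, LinearMap.add_apply]
    zero_mul := fun x => by
      change mulMap 0 x = 0
      rw [map_zero, LinearMap.zero_apply]
    mul_zero := fun x => map_zero (mulMap x)
    mul_assoc := mulMap_assoc
    one_mul := fun x => by
      change mulMap (bas 0 0) x = x
      refine LinearMap.congr_fun (f := mulMap (bas 0 0)) (g := LinearMap.id) ?_ x
      refine linearMap_ext fun A m => ?_
      rw [mulMap_bas, hall_zero_left, emb_single, wt_zero, zero_dotProduct]
      simp
    mul_one := fun x => by
      change mulMap x (bas 0 0) = x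
      refine LinearMap.congr_fun (f := mulMap.flip (bas 0 0)) (g := LinearMap.id) ?_ x
      refine linearMap_ext fun A m => ?_
      rw [LinearMap.flip_apply, mulMap_bas, hall_zero_right, emb_single, dotProduct_zero]
      simp }

instance : Algebra Kv (TwHall n) :=
  Algebra.ofModule
    (fun c x y => by
      change mulMap (c • x) y = c • mulMap x y
      rw [map_smul, LinearMap.smul_apply])
    (fun c x y => map_smul (mulMap x) c y)

theorem bas_mul_bas (A B : Idx n) (m k : Fin n → ℤ) : bas A m * bas B k =
    vv ^ dotProduct (wt A) k • emb (m + k) (hall A B) := mulMap_bas A B m k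

theorem one_eq : (1 : TwHall n) = bas 0 0 := rfl

/-- The embedding into the completion. -/
def toKHat : TwHall n →ₗ[Kv] KHat n :=
  Finsupp.lsum Kv fun a => LinearMap.toSpanSingleton Kv (KHat n) (rElem a.1 a.2)

theorem toKHat_bas (A : Idx n) (m : Fin n → ℤ) : toKHat (bas A m) = rElem A m :=
  (Finsupp.lsum_single ..).trans (one_smul _ _)

theorem toKHat_one : toKHat (1 : TwHall n) = 1 := by
  rw [one_eq, toKHat_bas, KHat.one_eq]

theorem toKHat_mul (x y : TwHall n) : toKHat (x * y) = toKHat x * toKHat y := by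
  induction x using induction_bas with
  | h0 => simp
  | hadd x x' h1 h2 => simp [add_mul, h1, h2]
  | hbas a A m =>
  induction y using induction_bas with
  | h0 => simp
  | hadd y y' h1 h2 =>
    rw [mul_add, map_add, map_add, mul_add, h1, h2]
  | hbas b B k =>
    rw [smul_mul_smul_comm, map_smul, map_smul, map_smul, toKHat_bas, toKHat_bas,
      smul_mul_smul_comm, rElem_mul, bas_mul_bas, map_smul, emb_apply, map_finsuppSum]
    simp only [map_smul, toKHat_bas]

/-- The character `t ↦ v^{t · m}` of `ℤ^n`. -/
def char (m : Fin n → ℤ) : Multiplicative (Fin n → ℤ) →* Kv where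
  toFun t := vv ^ dotProduct t.toAdd m
  map_one' := by simp
  map_mul' s t := by
    rw [toAdd_mul, add_dotProduct, zpow_add₀ vv_ne_zero]

theorem char_injective : Function.Injective (char : (Fin n → ℤ) → _) := by
  intro m k h
  ext i
  have h1 := DFunLike.congr_fun h (Multiplicative.ofAdd (Pi.single i (1 : ℤ)))
  have h2 : vv ^ m i = vv ^ k i := by simpa [char] using h1
  exact vv_zpow_injective h2

/-- Elements with different A have disjoint supports. For fixed A the coefficients of `rElem A m`,
divided by a power of v that does not depend on m, form the character t ↦ v^{t · m} of ℤ^n, and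
distinct characters are linearly independent. -/
theorem toKHat_injective : Function.Injective (toKHat : TwHall n →ₗ[Kv] KHat n) := by
  classical
  have hli : LinearIndependent Kv (fun a : Idx n × (Fin n → ℤ) => rElem a.1 a.2) := by
    rw [linearIndependent_iff']
    intro s g hg a ha
    have hch : LinearIndependent Kv
        (fun m : Fin n → ℤ => (char m : Multiplicative (Fin n → ℤ) → Kv)) :=
      (linearIndependent_monoidHom (Multiplicative (Fin n → ℤ)) Kv).comp _ char_injective
    rw [linearIndependent_iff'] at hch
    have key := hch ((s.filter fun b => b.1 = a.1).image Prod.snd) (fun m => g (a.1, m)) ?_ a.2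
      (Finset.mem_image.2 ⟨a, by simp [ha], rfl⟩)
    · exact key
    funext t
    have h1 := congrArg (KHat.coeff (mkZ a.1 t.toAdd)) hg
    rw [map_sum, map_zero] at h1
    simp only [map_smul, coeff_rElem] at h1
    rw [Finset.sum_image, Finset.sum_apply, Finset.sum_filter]
    · have h2 : vv ^ dimDiff (mkZ a.1 t.toAdd).1 ≠ 0 := zpow_ne_zero _ vv_ne_zero
      apply mul_right_cancel₀ h2
      rw [Pi.zero_apply, zero_mul, Finset.sum_mul]
      refine (Finset.sum_congr rfl fun b _ => ?_).trans h1
      by_cases hb : b.1 = a.1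
      · rw [if_pos hb, if_pos (by rw [hb]; exact isOff_mkZ _ _), rowSum_mkZ,
          zpow_add₀ vv_ne_zero, ← hb]
        simp [char, mul_assoc]
      · rw [if_neg hb, if_neg fun h => hb (h.unique (isOff_mkZ _ _)), zero_mul, smul_zero]
    · rintro ⟨b, m⟩ hb ⟨c, k⟩ hc h
      simp only [Finset.coe_filter, Set.mem_ofPred_eq] at hb hc h
      rw [hb.2, hc.2, h]
  rw [linearIndependent_iff_injective_finsuppLinearCombination] at hli
  exact hli

end TwHall

/-! ### Relations between the root elements -/

namespace TwHall

/-- The basis element `A` of the Hall algebra. -/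
def hx (A : Idx n) : TwHall n := bas A 0

/-- The element `m` of the torus. -/
def tor (m : Fin n → ℤ) : TwHall n := bas 0 m

theorem tor_mul_bas (m k : Fin n → ℤ) (A : Idx n) : tor m * bas A k = bas A (m + k) := by
  rw [tor, bas_mul_bas, hall_zero_left, emb_single, wt_zero, zero_dotProduct]
  simp

theorem bas_mul_tor (m k : Fin n → ℤ) (A : Idx n) :
    bas A k * tor m = vv ^ dotProduct (wt A) m • bas A (k + m) := by
  rw [tor, bas_mul_bas, hall_zero_right, emb_single]
  simp

theorem tor_mul_hx (m : Fin n → ℤ) (A : Idx n) : tor m * hx A = bas A m := by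
  rw [hx, tor_mul_bas, add_zero]

theorem hx_mul_tor (m : Fin n → ℤ) (A : Idx n) :
    hx A * tor m = vv ^ dotProduct (wt A) m • (tor m * hx A) := by
  rw [hx, bas_mul_tor, zero_add, ← tor_mul_hx, hx]

theorem tor_mul_tor (m k : Fin n → ℤ) : (tor m * tor k : TwHall n) = tor (m + k) := tor_mul_bas m k 0

theorem hx_zero : (hx 0 : TwHall n) = 1 := rfl

/-- The scalar `q^{∑_{i < k} a_{ij}} [a_{kj} + 1]_q` at `q = v²`. -/
def qc (A : Idx n) (k j : Fin n) : Kv := aeval (vv ^ 2) (chevCoeff A k j)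

theorem qc_eq (A : Idx n) (k j : Fin n) : qc A k j =
    (vv ^ 2) ^ (∑ i, if i < k then ent A i j else 0) *
      ∑ t ∈ Finset.range (ent A k j + 1), (vv ^ 2) ^ t := by
  simp [qc, chevCoeff]

theorem qc_ne_zero (A : Idx n) (k j : Fin n) : qc A k j ≠ 0 := by
  apply aeval_vv_sq_ne_zero
  exact mul_ne_zero (pow_ne_zero _ X_ne_zero) (monic_geom_sum_X (by omega)).ne_zero

theorem qc_congr {A B : Idx n} {k j : Fin n} (h : ∀ i, i ≤ k → ent A i j = ent B i j) :
    qc A k j = qc B k j := by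
  rw [qc_eq, qc_eq, h k le_rfl]
  congr 2
  refine Finset.sum_congr rfl fun i _ => ?_
  by_cases hi : i < k
  · rw [if_pos hi, if_pos hi, h i hi.le]
  · rw [if_neg hi, if_neg hi]

theorem qc_eq_one {A : Idx n} {k j : Fin n} (h : ∀ i, i ≤ k → ent A i j = 0) : qc A k j = 1 := by
  rw [qc_congr (B := 0) fun i hi => (h i hi).trans (ent_zero i j).symm, qc_eq]
  simp

theorem ent_unitIdx_of_col_ne {p : UPair n} {a b : Fin n} (h : b ≠ p.1.2) :
    ent (unitIdx p) a b = 0 := by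
  rw [ent_single, if_neg fun h' => h h'.2]

theorem ent_unitIdx_of_row_ne {p : UPair n} {a b : Fin n} (h : a ≠ p.1.1) :
    ent (unitIdx p) a b = 0 := by
  rw [ent_single, if_neg fun h' => h h'.1]

theorem ent_unitIdx_self {i j : Fin n} (h : i < j) : ent (unitIdx (upair i j h)) i j = 1 := by
  rw [ent_single, if_pos ⟨rfl, rfl⟩]

open Classical in
theorem hx_mul_simple (A : Idx n) {h h' : Fin n} (hh : (h : ℕ) + 1 = h') :
    hx A * hx (unitIdx (upair h h' (lt_of_val_add_one hh))) =
      ∑ k, if CanMove A k h then qc A k h' • hx (moveIdx A k h h') else 0 := by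
  rw [hx, hx, bas_mul_bas, hall_unitIdx A hh, dotProduct_zero, zpow_zero, one_smul, zero_add, chev,
    map_sum]
  refine Finset.sum_congr rfl fun k _ => ?_
  split_ifs
  · rw [emb_single, qc, hx]
  · rw [map_zero]

theorem canMove_self (A : Idx n) (h : Fin n) : CanMove A h h :=
  ⟨le_rfl, fun h => (lt_irrefl _ h).elim⟩

theorem not_canMove {A : Idx n} {k h : Fin n} (hk : k ≠ h) (hA : ent A k h = 0) :
    ¬ CanMove A k h := fun H => by
  have := H.2 (lt_of_le_of_ne H.1 hk)
  omega

theorem hx_mul_simple_of_zero {A : Idx n} {h h' : Fin n} (hh : (h : ℕ) + 1 = h')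
    (hA : ∀ k, ent A k h = 0) :
    hx A * hx (unitIdx (upair h h' (lt_of_val_add_one hh))) =
      qc A h h' • hx (A + unitIdx (upair h h' (lt_of_val_add_one hh))) := by
  classical
  rw [hx_mul_simple A hh, Finset.sum_eq_single h]
  · rw [if_pos (canMove_self A h), moveIdx_self]
  · intro k _ hk
    rw [if_neg (not_canMove hk (hA k))]
  · simp

theorem hx_add_mul_simple {A : Idx n} {i h h' : Fin n} (hh : (h : ℕ) + 1 = h') (hi : i < h)
    (hih' : i < h') (hA : ∀ k, k ≠ i → ent A k h = 0) :
    hx (A + unitIdx (upair i h hi)) * hx (unitIdx (upair h h' (lt_of_val_add_one hh))) =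
      qc A h h' • hx (A + unitIdx (upair i h hi) + unitIdx (upair h h' (lt_of_val_add_one hh))) +
        qc A i h' • hx (A + unitIdx (upair i h' hih')) := by
  classical
  have hlt := lt_of_val_add_one hh
  have hq : ∀ k, qc (A + unitIdx (upair i h hi)) k h' = qc A k h' := fun k =>
    qc_congr fun a _ => by rw [ent_add, ent_unitIdx_of_col_ne hlt.ne', add_zero]
  rw [hx_mul_simple _ hh, Finset.sum_eq_add h i hi.ne', if_pos (canMove_self _ h), moveIdx_self _ hlt,
    if_pos ⟨hi.le, fun _ => by rw [ent_add, ent_unitIdx_self]; omega⟩, moveIdx_add _ _ hih', hq, hq]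
  · intro k _ hk
    rw [if_neg (not_canMove hk.1 _)]
    rw [ent_add, hA k hk.2, ent_unitIdx_of_row_ne hk.2]
  · simp
  · simp

/-- Multiplication from the right with a root element in a column not to the right of the support
gives a multiple of a single basis element. -/
theorem hx_mul_root {A : Idx n} {i j : Fin n} (hij : i < j)
    (hA : ∀ a b, b < j → ent A a b = 0) :
    hx A * hx (unitIdx (upair i j hij)) = qc A i j • hx (A + unitIdx (upair i j hij)) := by
  induction hm : (j : ℕ) generalizing j A with
  | zero => exact absurd hij (by rw [Fin.lt_def, hm]; omega)
  | succ m ih =>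
    obtain ⟨h, rfl⟩ : ∃ h : Fin n, m = h := ⟨⟨m, by have := j.2; omega⟩, rfl⟩
    have hhj := lt_of_val_add_one hm.symm
    rcases eq_or_lt_of_le (show i ≤ h by rw [Fin.le_def]; rw [Fin.lt_def] at hij; omega) with
      rfl | hih
    · exact hx_mul_simple_of_zero hm.symm fun k => hA k _ hhj
    -- With h = j - 1, E_{ij} is the commutator of E_{ih} and E_{hj}. When A is multiplied by this
    -- commutator, the terms containing both units cancel and only A + E_{ij} remains.
    have e1 : hx (unitIdx (upair i h hih)) * hx (unitIdx (upair h j hhj)) =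
        hx (unitIdx (upair i h hih) + unitIdx (upair h j hhj)) + hx (unitIdx (upair i j hij)) := by
      have := hx_add_mul_simple (A := 0) hm.symm hih hij (by simp)
      rw [zero_add, zero_add, qc_eq_one (by simp), qc_eq_one (by simp), one_smul, one_smul] at this
      exact this
    have e2 : hx (unitIdx (upair h j hhj)) * hx (unitIdx (upair i h hih)) =
        hx (unitIdx (upair i h hih) + unitIdx (upair h j hhj)) := by
      rw [ih hih (fun a b hb => ent_unitIdx_of_col_ne (hb.trans hhj).ne) rfl,
        qc_eq_one fun a _ => ent_unitIdx_of_col_ne hhj.ne, one_smul, add_comm]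
    have e3 : hx (unitIdx (upair i j hij)) = hx (unitIdx (upair i h hih)) *
        hx (unitIdx (upair h j hhj)) - hx (unitIdx (upair h j hhj)) * hx (unitIdx (upair i h hih)) := by
      rw [e1, e2, add_sub_cancel_left]
    have hAh : ∀ k, ent A k h = 0 := fun k => hA k h hhj
    have e4 : hx (A + unitIdx (upair h j hhj)) * hx (unitIdx (upair i h hih)) =
        hx (A + unitIdx (upair h j hhj) + unitIdx (upair i h hih)) := by
      rw [ih hih (fun a b hb => by
        rw [ent_add, hA a b (hb.trans hhj), ent_unitIdx_of_col_ne (hb.trans hhj).ne]) rfl,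
        qc_eq_one fun a _ => by rw [ent_add, hAh, ent_unitIdx_of_col_ne hhj.ne], one_smul]
    rw [e3, mul_sub, ← mul_assoc, ← mul_assoc, ih hih (fun a b hb => hA a b (hb.trans hhj)) rfl,
      qc_eq_one fun a _ => hAh a, one_smul, hx_add_mul_simple hm.symm hih hij fun k _ => hAh k,
      hx_mul_simple_of_zero hm.symm hAh, smul_mul_assoc, e4, add_right_comm A, add_sub_cancel_left]

/-- The root element `E_{ij}`, or `0` if not `i < j`. -/
def rt (i j : Fin n) : TwHall n := if h : i < j then hx (unitIdx (upair i j h)) else 0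

theorem rt_of_lt {i j : Fin n} (h : i < j) : rt i j = hx (unitIdx (upair i j h)) := dif_pos h

theorem rt_mul_rt_of_col_lt {i a j b : Fin n} (hia : i < a) (hjb : j < b) (hab : a < b) :
    rt j b * rt i a = hx (unitIdx (upair j b hjb) + unitIdx (upair i a hia)) := by
  rw [rt_of_lt hia, rt_of_lt hjb, hx_mul_root hia fun c d hd =>
    ent_unitIdx_of_col_ne (hd.trans hab).ne, qc_eq_one fun c _ => ent_unitIdx_of_col_ne hab.ne,
    one_smul]

theorem rt_mul_rt_of_row_lt {i j a : Fin n} (hia : i < a) (hja : j < a) (hij : i < j) :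
    rt j a * rt i a = hx (unitIdx (upair i a hia) + unitIdx (upair j a hja)) := by
  rw [rt_of_lt hia, rt_of_lt hja, hx_mul_root hia fun c d hd => ent_unitIdx_of_col_ne hd.ne,
    qc_eq_one fun c hc => ent_unitIdx_of_row_ne (hc.trans_lt hij).ne, one_smul, add_comm]

/-- The factor q = v² counts the one unit that lies above row j in column a. -/
theorem rt_mul_rt_of_lt_row {i j a : Fin n} (hia : i < a) (hja : j < a) (hij : i < j) :
    rt i a * rt j a = vv ^ 2 • (rt j a * rt i a) := by
  rw [rt_mul_rt_of_row_lt hia hja hij, rt_of_lt hia, rt_of_lt hja,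
    hx_mul_root hja fun c d hd => ent_unitIdx_of_col_ne hd.ne, qc_eq,
    ent_unitIdx_of_row_ne hij.ne', Finset.sum_eq_single i]
  · rw [if_pos hij, ent_unitIdx_self]
    simp
  · intro k _ hk
    rw [ent_unitIdx_of_row_ne hk, ite_self]
  · simp

theorem qc_unitIdx_self {i a : Fin n} (hia : i < a) :
    qc (unitIdx (upair i a hia)) i a = 1 + vv ^ 2 := by
  rw [qc_eq, ent_unitIdx_self, Finset.sum_eq_zero]
  · simp [Finset.sum_range_succ]
  · intro k _
    split_ifs with hk
    · exact ent_unitIdx_of_row_ne hk.ne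
    · rfl

theorem rt_mul_self {i a : Fin n} (hia : i < a) : rt i a * rt i a =
    (1 + vv ^ 2) • hx (unitIdx (upair i a hia) + unitIdx (upair i a hia)) := by
  rw [rt_of_lt hia, hx_mul_root hia fun c d hd => ent_unitIdx_of_col_ne hd.ne, qc_unitIdx_self]

theorem rt_mul_simple {i h h' : Fin n} (hh : (h : ℕ) + 1 = h') (hi : i < h) :
    rt i h * rt h h' = rt h h' * rt i h + rt i h' := by
  have hlt := lt_of_val_add_one hh
  rw [rt_mul_rt_of_col_lt hi hlt hlt, rt_of_lt hi, rt_of_lt hlt, rt_of_lt (hi.trans hlt)]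
  have := hx_add_mul_simple (A := 0) hh hi (hi.trans hlt) (by simp)
  rwa [zero_add, zero_add, qc_eq_one (by simp), qc_eq_one (by simp), one_smul, one_smul,
    add_comm (unitIdx _)] at this

/-- Exactly the rows h, i and k have a unit to move out of column h, and the empty column h' makes
all coefficients 1. -/
theorem hx_two_mul_simple {i k h h' : Fin n} (hh : (h : ℕ) + 1 = h') (hi : i < h) (hk : k < h)
    (hik : i ≠ k) (hih' : i < h') (hkh' : k < h') :
    hx (unitIdx (upair k h hk) + unitIdx (upair i h hi)) * rt h h' =
      hx (unitIdx (upair k h hk) + unitIdx (upair i h hi) +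
        unitIdx (upair h h' (lt_of_val_add_one hh))) +
      hx (unitIdx (upair k h hk) + unitIdx (upair i h' hih')) +
      hx (unitIdx (upair i h hi) + unitIdx (upair k h' hkh')) := by
  classical
  have hlt := lt_of_val_add_one hh
  have hq : ∀ a, qc (unitIdx (upair k h hk) + unitIdx (upair i h hi)) a h' = 1 := fun a =>
    qc_eq_one fun b _ => by
      rw [ent_add, ent_unitIdx_of_col_ne hlt.ne', ent_unitIdx_of_col_ne hlt.ne']
  have hcm : ∀ a, CanMove (unitIdx (upair k h hk) + unitIdx (upair i h hi)) a h ↔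
      a = h ∨ a = i ∨ a = k := by
    intro a
    rw [CanMove, ent_add, ent_single, ent_single]
    constructor
    · rintro ⟨h1, h2⟩
      by_contra hne
      push Not at hne
      have := h2 (lt_of_le_of_ne h1 hne.1)
      simp [hne.2.1, hne.2.2] at this
    · rintro (rfl | rfl | rfl)
      · exact ⟨le_rfl, fun h => (lt_irrefl _ h).elim⟩
      · exact ⟨hi.le, fun _ => by simp⟩
      · exact ⟨hk.le, fun _ => by simp⟩
  rw [rt_of_lt hlt, hx_mul_simple _ hh, ← Finset.sum_filter]
  have hs : Finset.univ.filter (fun a => CanMove (unitIdx (upair k h hk) + unitIdx (upair i h hi)) a h)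
      = {h, i, k} := by
    ext a
    simp [hcm]
  rw [hs, Finset.sum_insert (by simp [hi.ne', hk.ne']), Finset.sum_pair hik, hq, hq, hq, one_smul,
    one_smul, one_smul, moveIdx_self _ hlt, moveIdx_add _ hi hih', ← add_assoc,
    add_comm (unitIdx (upair k h hk)) (unitIdx (upair i h hi)), moveIdx_add _ hk hkh']

theorem rt_eq_sub {i h h' : Fin n} (hh : (h : ℕ) + 1 = h') (hi : i < h) :
    rt i h' = rt i h * rt h h' - rt h h' * rt i h := by
  rw [rt_mul_simple hh hi, add_sub_cancel_left]

theorem rt_comm_simple {i a h h' : Fin n} (hh : (h : ℕ) + 1 = h') (hia : i < a) (ha : a < h) :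
    rt i a * rt h h' = rt h h' * rt i a := by
  have hlt := lt_of_val_add_one hh
  rw [rt_mul_rt_of_col_lt hia hlt (ha.trans hlt), rt_of_lt hia, rt_of_lt hlt,
    hx_mul_simple_of_zero hh fun k => ent_unitIdx_of_col_ne ha.ne', qc_eq_one, one_smul, add_comm]
  exact fun k _ => ent_unitIdx_of_col_ne (ha.trans hlt).ne'

theorem exists_pred {j b : Fin n} (h : j < b) : ∃ h : Fin n, (h : ℕ) + 1 = b ∧ j ≤ h := by
  rw [Fin.lt_def] at h
  refine ⟨⟨(b : ℕ) - 1, by omega⟩, by simp only; omega, ?_⟩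
  rw [Fin.le_def]
  simp only
  omega

/-! ### Commutator identities for the induction on the column -/

section Step

variable {R : Type*} [Ring R] [Algebra Kv R]

/-- Used with w = E_{jh} and y = E_{h,h+1}, whose commutator is E_{j,h+1}: it carries a relation
between x and the column h over to the column h + 1. -/
theorem commutator_smul_comm {x w y : R} {c : Kv} (h1 : x * w = c • (w * x)) (h2 : x * y = y * x) :
    x * (w * y - y * w) = c • ((w * y - y * w) * x) := by
  rw [mul_sub, ← mul_assoc, ← mul_assoc, h1, h2, smul_mul_assoc, mul_assoc w, h2, mul_assoc y x, h1,
    mul_smul_comm, ← smul_sub, sub_mul, mul_assoc, mul_assoc]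

theorem commutator_comm {x w y : R} (h1 : x * w = w * x) (h2 : x * y = y * x) :
    x * (w * y - y * w) = (w * y - y * w) * x := by
  have := commutator_smul_comm (c := 1) (by rw [h1, one_smul]) h2
  rwa [one_smul] at this

/-- The same passage to the next column when the relation has a correction term s t: the column of s
advances together with that of w, and t commutes with y. -/
theorem commutator_add {x w y s t : R} {c e : Kv} (h1 : x * w = c • (w * x) + e • (s * t))
    (h2 : x * y = y * x) (h3 : t * y = y * t) :
    x * (w * y - y * w) = c • ((w * y - y * w) * x) + e • ((s * y - y * s) * t) := by
  rw [mul_sub, ← mul_assoc, ← mul_assoc, h1, h2, add_mul, smul_mul_assoc, smul_mul_assoc,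
    mul_assoc w, h2, mul_assoc s, h3, mul_assoc y x, h1]
  simp only [mul_add, sub_mul, mul_smul_comm, smul_sub, mul_assoc]
  abel

end Step

theorem rt_comm_of_lt {i a j b : Fin n} (hia : i < a) (haj : a < j) (hjb : j < b) :
    rt i a * rt j b = rt j b * rt i a := by
  induction hm : (b : ℕ) generalizing b with
  | zero => exact absurd hjb (by rw [Fin.lt_def, hm]; omega)
  | succ m ih =>
    obtain ⟨h, hh, hjh⟩ := exists_pred hjb
    rcases eq_or_lt_of_le hjh with rfl | hlt
    · exact rt_comm_simple hh hia haj
    · rw [rt_eq_sub hh hlt]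
      exact commutator_comm (ih hlt (by omega)) (rt_comm_simple hh hia (haj.trans hlt))

theorem rt_mul_touching {i a b : Fin n} (hia : i < a) (hab : a < b) :
    rt i a * rt a b = rt a b * rt i a + rt i b := by
  induction hm : (b : ℕ) generalizing b with
  | zero => exact absurd hab (by rw [Fin.lt_def, hm]; omega)
  | succ m ih =>
    obtain ⟨h, hh, hjh⟩ := exists_pred hab
    rcases eq_or_lt_of_le hjh with rfl | hlt
    · exact rt_mul_simple hh hia
    · rw [rt_eq_sub hh hlt, rt_eq_sub hh (hia.trans hlt)]
      have := commutator_add (c := 1) (e := 1) (x := rt i a) (w := rt a h) (y := rt h b)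
        (s := rt i h) (t := 1) (by rw [ih hlt (by omega)]; simp)
        (rt_comm_simple hh hia hlt) (by simp)
      simpa using this

theorem rt_comm_of_nested {i a j b : Fin n} (hji : j < i) (hia : i < a) (hab : a < b) :
    rt i a * rt j b = rt j b * rt i a := by
  induction hm : (b : ℕ) generalizing b with
  | zero => exact absurd hab (by rw [Fin.lt_def, hm]; omega)
  | succ m ih =>
    obtain ⟨h, hh, hjh⟩ := exists_pred hab
    have hlt' := lt_of_val_add_one hh
    rcases eq_or_lt_of_le hjh with rfl | hlt
    · have hja := hji.trans hia
      have hib := hia.trans hab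
      have hjb := hja.trans hab
      -- In the base case E_{jb} = [E_{ja}, E_{ab}], and both triple products are expanded in the
      -- basis. The term with three units and the term E_{ja} + E_{ib} cancel, leaving E_{ia} +
      -- E_{jb}, which is E_{jb} E_{ia}.
      have e1 : hx (unitIdx (upair j a hja) + unitIdx (upair i a hia)) = rt i a * rt j a := by
        rw [rt_mul_rt_of_row_lt hja hia hji]
      have e2 : hx (unitIdx (upair i a hia) + unitIdx (upair j a hja) +
          unitIdx (upair a b hab)) = rt a b * (rt i a * rt j a) := by
        rw [← mul_assoc, rt_mul_rt_of_col_lt hia hab hab, rt_of_lt hja, hx_mul_root hja]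
        · rw [qc_eq_one, one_smul, add_comm (unitIdx (upair a b hab)), add_right_comm]
          intro c hc
          rw [ent_add, ent_unitIdx_of_col_ne hab.ne, ent_unitIdx_of_row_ne (hc.trans_lt hji).ne]
        · intro c e he
          rw [ent_add, ent_unitIdx_of_col_ne (he.trans hab).ne, ent_unitIdx_of_col_ne he.ne]
      have e3 := hx_two_mul_simple hh hia hja hji.ne' hib hjb
      rw [rt_eq_sub hh hja, mul_sub, ← mul_assoc, ← mul_assoc, ← e1, e3, rt_mul_simple hh hia,
        ← rt_eq_sub hh hja, add_mul, mul_assoc, rt_mul_rt_of_col_lt hia hjb hab,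
        rt_mul_rt_of_col_lt hja hib hab, add_comm (unitIdx (upair j a hja)) (unitIdx (upair i a hia)),
        e2, add_comm (unitIdx (upair i b hib)), add_comm (unitIdx (upair j b hjb))]
      abel
    · rw [rt_eq_sub hh ((hji.trans hia).trans hlt)]
      exact commutator_comm (ih hlt (by omega)) (rt_comm_simple hh hia hlt)

theorem rt_mul_rt_same_row {i a b : Fin n} (hia : i < a) (hab : a < b) :
    rt i a * rt i b = vv ^ 2 • (rt i b * rt i a) := by
  induction hm : (b : ℕ) generalizing b with
  | zero => exact absurd hab (by rw [Fin.lt_def, hm]; omega)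
  | succ m ih =>
    obtain ⟨h, hh, hjh⟩ := exists_pred hab
    have hlt' := lt_of_val_add_one hh
    rcases eq_or_lt_of_le hjh with rfl | hlt
    · have hib := hia.trans hab
      -- The square of E_{ia} contributes 1 + v² to both orders of the product with E_{ab}. The
      -- terms with E_{ab} cancel, and (1 + v²) - 1 = v² remains in front of E_{ia} + E_{ib}.
      have e2 : rt a b * rt i a * rt i a = (1 + vv ^ 2) •
          hx (unitIdx (upair i a hia) + unitIdx (upair i a hia) + unitIdx (upair a b hab)) := by
        rw [rt_mul_rt_of_col_lt hia hab hab, rt_of_lt hia, hx_mul_root hia,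
          qc_congr (B := unitIdx (upair i a hia)), qc_unitIdx_self, add_assoc,
          add_comm (unitIdx (upair a b hab))]
        · intro c _
          rw [ent_add, ent_unitIdx_of_col_ne hab.ne, zero_add]
        · intro c e he
          rw [ent_add, ent_unitIdx_of_col_ne (he.trans hab).ne, ent_unitIdx_of_col_ne he.ne]
      have e3 : hx (unitIdx (upair i a hia) + unitIdx (upair i a hia)) * rt a b =
          hx (unitIdx (upair i a hia) + unitIdx (upair i a hia) + unitIdx (upair a b hab)) +
            hx (unitIdx (upair i a hia) + unitIdx (upair i b hib)) := by
        rw [rt_of_lt hab, hx_add_mul_simple hh hia hib fun k hk => ent_unitIdx_of_row_ne hk,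
          qc_eq_one fun c _ => ent_unitIdx_of_col_ne hab.ne',
          qc_eq_one fun c _ => ent_unitIdx_of_col_ne hab.ne', one_smul, one_smul]
      have e4 := rt_mul_rt_of_col_lt hia hib hab
      rw [e4]
      rw [rt_eq_sub hh hia, mul_sub, ← mul_assoc, ← mul_assoc, rt_mul_self hia, smul_mul_assoc, e3,
        rt_mul_simple hh hia, add_mul, e2, e4, add_comm (unitIdx (upair i b hib))]
      rw [smul_add, add_sub_add_left_eq_sub, add_smul, one_smul, add_sub_cancel_left]
    · rw [rt_eq_sub hh (hia.trans hlt)]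
      exact commutator_smul_comm (ih hlt (by omega)) (rt_comm_simple hh hia hlt)

theorem rt_mul_crossing {i a j b : Fin n} (hij : i < j) (hja : j < a) (hab : a < b) :
    rt i a * rt j b = vv ^ 2 • (rt j b * rt i a) + (vv ^ 2 - 1) • (rt i b * rt j a) := by
  induction hm : (b : ℕ) generalizing b with
  | zero => exact absurd hab (by rw [Fin.lt_def, hm]; omega)
  | succ m ih =>
    obtain ⟨h, hh, hjh⟩ := exists_pred hab
    have hlt' := lt_of_val_add_one hh
    have hia := hij.trans hja
    rcases eq_or_lt_of_le hjh with rfl | hlt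
    -- Moving E_{ia} past the commutator E_{jb} = [E_{ja}, E_{ab}] yields v² E_{jb} E_{ia} and the
    -- corrections v² E_{ja} E_{ib} - E_{ib} E_{ja}; by the nested case the last two products
    -- coincide.
    · rw [rt_eq_sub hh hja, mul_sub, ← mul_assoc, ← mul_assoc, rt_mul_rt_of_lt_row hia hja hij,
        smul_mul_assoc, mul_assoc, rt_mul_simple hh hia, add_mul, mul_assoc (rt a b),
        rt_mul_rt_of_lt_row hia hja hij, mul_add, rt_comm_of_nested hij hja hab]
      simp only [sub_mul, mul_smul_comm, smul_add, smul_sub, mul_assoc, sub_smul, one_smul]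
      abel
    · rw [rt_eq_sub hh (hja.trans hlt), rt_eq_sub hh (hia.trans hlt)]
      exact commutator_add (ih hlt (by omega)) (rt_comm_simple hh hia hlt)
        (rt_comm_simple hh hja hlt)

end TwHall

/-! ### The RTT relations of the positive part -/

section RTT

variable {R : Type*} [Ring R] [Algebra Kv R]

/-- The RTT relations with parameter `q`, resolved into the possible relative positions of the
indices. -/
structure IsRTT (q : Kv) (x : Fin n → Fin n → R) : Prop where
  zero : ∀ i j, j < i → x i j = 0
  row : ∀ i a b, a < b → x i a * x i b = q⁻¹ • (x i b * x i a)
  col : ∀ i j a, i < j → x i a * x j a = q⁻¹ • (x j a * x i a)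
  comm : ∀ i j a b, a < b → j < i → x i a * x j b = x j b * x i a
  cross : ∀ i j a b, a < b → i < j →
    x i a * x j b = x j b * x i a + (q⁻¹ - q) • (x i b * x j a)

theorem IsRTT.rtt {q : Kv} (hq : q ≠ 0) {x : Fin n → Fin n → R} (hx : IsRTT q x)
    (i a j b : Fin n) :
    powDelta q i j • (x i a * x j b) - powDelta q a b • (x j b * x i a) =
      ((q - q⁻¹) * (delta (b < a) - delta (i < j))) • (x j a * x i b) := by
  unfold powDelta delta
  rcases lt_trichotomy i j with hij | rfl | hij
  · rw [if_neg hij.ne, if_pos hij]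
    rcases lt_trichotomy a b with hab | rfl | hab
    · rw [if_neg hab.ne, if_neg hab.not_gt, hx.cross i j a b hab hij, hx.comm j i a b hab hij]
      simp only [one_smul, add_sub_cancel_left]
      congr 1
      ring
    · rw [if_pos rfl, if_neg (lt_irrefl _), hx.col i j a hij, one_smul, ← sub_smul]
      congr 1
      ring
    · rw [if_neg hab.ne', if_pos hab, hx.comm j i b a hab hij]
      simp
  · rw [if_pos rfl, if_neg (lt_irrefl _)]
    rcases lt_trichotomy a b with hab | rfl | hab
    · rw [if_neg hab.ne, if_neg hab.not_gt, hx.row i a b hab, smul_smul, mul_inv_cancel₀ hq]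
      simp
    · simp
    · rw [if_neg hab.ne', if_pos hab, hx.row i b a hab, one_smul, ← sub_smul]
      congr 1
      ring
  · rw [if_neg hij.ne', if_neg hij.not_gt]
    rcases lt_trichotomy a b with hab | rfl | hab
    · rw [if_neg hab.ne, if_neg hab.not_gt, hx.comm i j a b hab hij]
      simp
    · rw [if_pos rfl, if_neg (lt_irrefl _), hx.col j i a hij, smul_smul, mul_inv_cancel₀ hq]
      simp
    · rw [if_neg hab.ne', if_pos hab, hx.cross j i b a hab hij, one_smul, one_smul, sub_zero,
        mul_one, sub_add_cancel_left, ← neg_smul, neg_sub]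

theorem IsRTT.of_rtt {q : Kv} (hq : q ≠ 0) {x : Fin n → Fin n → R}
    (hzero : ∀ i j, j < i → x i j = 0)
    (hx : ∀ i a j b : Fin n, powDelta q i j • (x i a * x j b) - powDelta q a b • (x j b * x i a) =
      ((q - q⁻¹) * (delta (b < a) - delta (i < j))) • (x j a * x i b)) : IsRTT q x := by
  have hcomm : ∀ i j a b, a < b → j < i → x i a * x j b = x j b * x i a := by
    intro i j a b hab hij
    have := hx i a j b
    rw [powDelta, powDelta, delta, delta, if_neg hij.ne', if_neg hab.ne, if_neg hab.not_gt,
      if_neg hij.not_gt] at this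
    simpa [sub_eq_zero] using this
  refine ⟨hzero, fun i a b hab => ?_, fun i j a hij => ?_, hcomm, fun i j a b hab hij => ?_⟩
  · have := hx i a i b
    rw [powDelta, powDelta, delta, delta, if_pos rfl, if_neg hab.ne, if_neg hab.not_gt,
      if_neg (lt_irrefl _), sub_self, mul_zero, zero_smul, sub_eq_zero, one_smul] at this
    rw [← this, smul_smul, inv_mul_cancel₀ hq, one_smul]
  · have := hx i a j a
    rw [powDelta, powDelta, delta, delta, if_neg hij.ne, if_pos rfl, if_neg (lt_irrefl _),
      if_pos hij, one_smul, sub_eq_iff_eq_add, ← add_smul] at this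
    rw [this]
    congr 1
    ring
  · have := hx i a j b
    rw [powDelta, powDelta, delta, delta, if_neg hij.ne, if_neg hab.ne, if_neg hab.not_gt,
      if_pos hij, one_smul, one_smul, sub_eq_iff_eq_add, hcomm j i a b hab hij] at this
    rw [this, add_comm]
    congr 2
    ring

/-- Reflection of the indices along the antidiagonal inverts the parameter. -/
theorem IsRTT.reflect {q : Kv} (hq : q ≠ 0) {x : Fin n → Fin n → R} (hx : IsRTT q x) :
    IsRTT q⁻¹ fun i j => x j.rev i.rev where
  zero i j h := hx.zero _ _ (Fin.rev_lt_rev.2 h)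
  row i a b h := by
    rw [hx.col b.rev a.rev i.rev (Fin.rev_lt_rev.2 h), smul_smul, inv_inv, mul_inv_cancel₀ hq,
      one_smul]
  col i j a h := by
    rw [hx.row a.rev j.rev i.rev (Fin.rev_lt_rev.2 h), smul_smul, inv_inv, mul_inv_cancel₀ hq,
      one_smul]
  comm i j a b h1 h2 := hx.comm _ _ _ _ (Fin.rev_lt_rev.2 h2) (Fin.rev_lt_rev.2 h1)
  cross i j a b h1 h2 := by
    rw [hx.cross b.rev a.rev j.rev i.rev (Fin.rev_lt_rev.2 h2) (Fin.rev_lt_rev.2 h1), inv_inv,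
      add_assoc, ← add_smul]
    simp

end RTT

namespace RTTPlus

theorem gen_zero (q : Kv) {i j : Fin n} (h : j < i) : gen q i j = 0 := by
  rw [gen, RingQuot.mkAlgHom_rel Kv (RTTPlusRel.zero (q := q) j i h), map_zero]

theorem isRTT_gen {q : Kv} (hq : q ≠ 0) : IsRTT q (gen q : Fin n → Fin n → RTTPlus n q) :=
  IsRTT.of_rtt hq (fun _ _ h => gen_zero q h) fun i a j b => by
    have := RingQuot.mkAlgHom_rel Kv (RTTPlusRel.rtt (q := q) i a j b)
    simp only [map_sub, map_smul, map_mul] at this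
    exact this

/-- The universal property. -/
def lift {q : Kv} (hq : q ≠ 0) {R : Type*} [Ring R] [Algebra Kv R] {x : Fin n → Fin n → R}
    (hx : IsRTT q x) : RTTPlus n q →ₐ[Kv] R :=
  RingQuot.liftAlgHom Kv ⟨FreeAlgebra.lift Kv fun p => x p.1 p.2, by
    intro a b h
    cases h with
    | zero i j h => simp [hx.zero j i h]
    | rtt i a j b => simpa using hx.rtt hq i a j b⟩

theorem lift_gen {q : Kv} (hq : q ≠ 0) {R : Type*} [Ring R] [Algebra Kv R] {x : Fin n → Fin n → R}
    (hx : IsRTT q x) (i j : Fin n) : lift hq hx (gen q i j) = x i j := by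
  rw [lift, gen, RingQuot.liftAlgHom_mkAlgHom_apply, FreeAlgebra.lift_ι_apply]

theorem adjoin_gen (q : Kv) :
    Algebra.adjoin Kv (Set.range fun p : Fin n × Fin n => gen q p.1 p.2) = ⊤ := by
  have h := congrArg (Subalgebra.map (RingQuot.mkAlgHom Kv (RTTPlusRel n q)))
    (FreeAlgebra.adjoin_range_ι Kv (Fin n × Fin n))
  rw [AlgHom.map_adjoin, Algebra.map_top,
    (AlgHom.range_eq_top _).2 (RingQuot.mkAlgHom_surjective Kv _), ← Set.range_comp] at h
  exact h

theorem algHom_ext {q : Kv} {R : Type*} [Ring R] [Algebra Kv R] {f g : RTTPlus n q →ₐ[Kv] R}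
    (h : ∀ i j, f (gen q i j) = g (gen q i j)) : f = g := by
  refine AlgHom.ext_of_adjoin_eq_top (adjoin_gen q) ?_
  rintro _ ⟨p, rfl⟩
  exact h p.1 p.2

end RTTPlus

/-! ### Ordered monomials -/

section Spanning

variable {K R : Type*} [CommSemiring K] [Semiring R] [Algebra K R]

theorem adjoin_le_of_mul_mem {S : Set R} {M : Submodule K R} (h1 : 1 ∈ M)
    (hS : ∀ m ∈ M, ∀ s ∈ S, m * s ∈ M) : Subalgebra.toSubmodule (Algebra.adjoin K S) ≤ M := by
  rw [Algebra.adjoin_eq_span, Submodule.span_le]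
  intro x hx
  induction hx using Submonoid.closure_induction_right with
  | one => exact h1
  | mul_right x hx y hy ih => exact hS x ih y hy

theorem List.prod_map_mul_comm_le {ι : Type*} (C : ι → Submodule K R) (Y : Submodule K R)
    (l : List ι) (h : ∀ c ∈ l, C c * Y ≤ Y * C c) : (l.map C).prod * Y ≤ Y * (l.map C).prod := by
  induction l with
  | nil => simp
  | cons c l ih =>
    rw [List.map_cons, List.prod_cons]
    calc C c * (l.map C).prod * Y = C c * ((l.map C).prod * Y) := mul_assoc _ _ _
      _ ≤ C c * (Y * (l.map C).prod) :=
        mul_le_mul' le_rfl (ih fun c' hc' => h c' (List.mem_cons_of_mem _ hc'))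
      _ = C c * Y * (l.map C).prod := (mul_assoc _ _ _).symm
      _ ≤ Y * C c * (l.map C).prod := mul_le_mul' (h c List.mem_cons_self) le_rfl
      _ = _ := mul_assoc _ _ _

/-- An element of `Y c` on the right is moved leftwards past the factors after c and is then
absorbed by `C c`. -/
theorem List.prod_map_mul_le {ι : Type*} (C Y : ι → Submodule K R) (l : List ι)
    (hl : l.Pairwise fun c c' => C c' * Y c ≤ Y c * C c') (hC : ∀ c, C c * Y c ≤ C c)
    {c : ι} (hc : c ∈ l) : (l.map C).prod * Y c ≤ (l.map C).prod := by
  induction l with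
  | nil => simp at hc
  | cons c₀ l ih =>
    rw [List.pairwise_cons] at hl
    rw [List.map_cons, List.prod_cons]
    rcases List.mem_cons.1 hc with rfl | hc
    · calc C c * (l.map C).prod * Y c = C c * ((l.map C).prod * Y c) := mul_assoc _ _ _
        _ ≤ C c * (Y c * (l.map C).prod) :=
          mul_le_mul' le_rfl (List.prod_map_mul_comm_le C (Y c) l hl.1)
        _ = C c * Y c * (l.map C).prod := (mul_assoc _ _ _).symm
        _ ≤ _ := mul_le_mul' (hC c) le_rfl
    · rw [mul_assoc]
      exact mul_le_mul' le_rfl (ih hl.2 hc)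

theorem List.prod_map_span_range_le {ι κ : Type*} [DecidableEq ι] [Nonempty κ] (f : ι → κ → R)
    (l : List ι) (hl : l.Nodup) :
    (l.map fun t => Submodule.span K (Set.range (f t))).prod ≤
      Submodule.span K (Set.range fun M : ι → κ => (l.map fun t => f t (M t)).prod) := by
  induction l with
  | nil =>
    simp only [List.map_nil, List.prod_nil, Set.range_const]
    exact Submodule.one_eq_span.le
  | cons t l ih =>
    rw [List.nodup_cons] at hl
    rw [List.map_cons, List.prod_cons]
    refine (mul_le_mul' le_rfl (ih hl.2)).trans ?_
    rw [Submodule.span_mul_span]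
    apply Submodule.span_mono
    rintro _ ⟨_, ⟨k, rfl⟩, _, ⟨M, rfl⟩, rfl⟩
    refine ⟨Function.update M t k, ?_⟩
    simp only [List.map_cons, List.prod_cons, Function.update_self]
    congr 2
    refine List.map_congr_left fun s hs => ?_
    rw [Function.update_of_ne]
    rintro rfl
    exact hl.1 hs

theorem List.one_mem_prod_map {ι : Type*} (C : ι → Submodule K R) (l : List ι)
    (h : ∀ c, 1 ∈ C c) : 1 ∈ (l.map C).prod := by
  induction l with
  | nil => exact Submodule.one_le.1 le_rfl
  | cons c l ih =>
    rw [List.map_cons, List.prod_cons]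
    simpa using Submodule.mul_mem_mul (h c) ih

theorem List.prod_map_mono {ι : Type*} {C D : ι → Submodule K R} (l : List ι)
    (h : ∀ c, C c ≤ D c) : (l.map C).prod ≤ (l.map D).prod := by
  induction l with
  | nil => exact le_rfl
  | cons c l ih =>
    rw [List.map_cons, List.prod_cons, List.map_cons, List.prod_cons]
    exact mul_le_mul' (h c) ih

end Spanning

section Monomials

variable {R : Type*} [Ring R] [Algebra Kv R]

/-- The ordered monomial with the exponents `M`: the columns decrease from left to right. -/
def rttMonomial (x : Fin n → Fin n → R) (M : Fin n → Fin n → ℕ) : R :=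
  ((List.finRange n).reverse.map fun a => ((List.finRange n).map fun i => x i a ^ M a i).prod).prod

/-- Words are sorted on two levels. For a < b each of `cross`, `row`, `comm` rewrites x_{ia} x_{jb}
with the column b in front, so the column subalgebras can be multiplied in decreasing order; within
a column the generators commute up to scalars. -/
theorem IsRTT.span_rttMonomial {q : Kv} (hq : q ≠ 0) {x : Fin n → Fin n → R} (hx : IsRTT q x) :
    Subalgebra.toSubmodule (Algebra.adjoin Kv (Set.range fun p : Fin n × Fin n => x p.1 p.2)) ≤
      Submodule.span Kv (Set.range (rttMonomial x)) := by
  classical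
  let y : Fin n → Fin n → Submodule Kv R := fun i a => Submodule.span Kv {x i a}
  let Y : Fin n → Submodule Kv R := fun a => Submodule.span Kv (Set.range fun i => x i a)
  let Q : Fin n → Fin n → Submodule Kv R := fun a i =>
    Submodule.span Kv (Set.range fun k : ℕ => x i a ^ k)
  let AA : Fin n → Submodule Kv R := fun a =>
    Subalgebra.toSubmodule (Algebra.adjoin Kv (Set.range fun i => x i a))
  have hYA : ∀ a, Y a ≤ AA a := fun a => Submodule.span_le.2 Algebra.subset_adjoin
  have hAA : ∀ a, AA a * AA a ≤ AA a := fun a =>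
    Submodule.mul_le.2 fun u hu w hw => Subalgebra.mul_mem _ hu hw
  -- the columns can be sorted
  have hgen : ∀ a b i, a < b → ∀ z ∈ Y b, x i a * z ∈ Y b * AA a := by
    intro a b i hab z hz
    induction hz using Submodule.span_induction with
    | mem z hz =>
      obtain ⟨j, rfl⟩ := hz
      have hm : ∀ k l, x k b * x l a ∈ Y b * AA a := fun k l =>
        Submodule.mul_mem_mul (Submodule.subset_span ⟨k, rfl⟩)
          (hYA a (Submodule.subset_span ⟨l, rfl⟩))
      rcases lt_trichotomy i j with hij | rfl | hij
      · simp only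
        rw [hx.cross i j a b hab hij]
        exact Submodule.add_mem _ (hm _ _) (Submodule.smul_mem _ _ (hm _ _))
      · simp only
        rw [hx.row i a b hab]
        exact Submodule.smul_mem _ _ (hm _ _)
      · simp only
        rw [hx.comm i j a b hab hij]
        exact hm _ _
    | zero => rw [mul_zero]; exact Submodule.zero_mem _
    | add z w _ _ h1 h2 => rw [mul_add]; exact Submodule.add_mem _ h1 h2
    | smul c z _ h1 => rw [mul_smul_comm]; exact Submodule.smul_mem _ _ h1
  have hcol : ∀ a b, a < b → AA a * Y b ≤ Y b * AA a := by
    intro a b hab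
    rw [Submodule.mul_le]
    intro w hw
    induction hw using Algebra.adjoin_induction with
    | mem w hw =>
      obtain ⟨i, rfl⟩ := hw
      exact hgen a b i hab
    | algebraMap c =>
      intro z hz
      rw [← Algebra.smul_def]
      refine Submodule.smul_mem _ _ ?_
      rw [← mul_one z]
      exact Submodule.mul_mem_mul hz (Subalgebra.one_mem _)
    | add w w' _ _ h1 h2 =>
      intro z hz
      rw [add_mul]
      exact Submodule.add_mem _ (h1 z hz) (h2 z hz)
    | mul w w' _ _ h1 h2 =>
      intro z hz
      rw [mul_assoc]
      have key : ∀ u ∈ Y b * AA a, w * u ∈ Y b * AA a := by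
        intro u hu
        induction hu using Submodule.mul_induction_on' with
        | mem_mul_mem z hz v hv =>
          rw [← mul_assoc]
          have := Submodule.mul_mem_mul (h1 z hz) hv
          rw [mul_assoc] at this
          exact mul_le_mul' le_rfl (hAA a) this
        | add u _ v _ h1 h2 => rw [mul_add]; exact Submodule.add_mem _ h1 h2
      exact key _ (h2 z hz)
  -- the rows of a column can be sorted
  have hyQ : ∀ a i j, Q a j * y i a ≤ y i a * Q a j := by
    intro a i j
    rw [Submodule.span_mul_span, Submodule.span_le]
    rintro _ ⟨_, ⟨k, rfl⟩, _, rfl, rfl⟩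
    have hij : ∃ c : Kv, x j a * x i a = c • (x i a * x j a) := by
      rcases lt_trichotomy j i with h | rfl | h
      · exact ⟨_, hx.col j i a h⟩
      · exact ⟨1, (one_smul _ _).symm⟩
      · exact ⟨q, by rw [hx.col i j a h, smul_smul, mul_inv_cancel₀ hq, one_smul]⟩
    obtain ⟨c, hc⟩ := hij
    have hk : ∃ c' : Kv, x j a ^ k * x i a = c' • (x i a * x j a ^ k) := by
      induction k with
      | zero => exact ⟨1, by simp⟩
      | succ k ih =>
        obtain ⟨c', hc'⟩ := ih
        refine ⟨c * c', ?_⟩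
        rw [pow_succ, mul_assoc, hc, mul_smul_comm, ← mul_assoc, hc', smul_mul_assoc, smul_smul,
          mul_assoc]
    obtain ⟨c', hc'⟩ := hk
    simp only [SetLike.mem_coe]
    rw [hc']
    exact Submodule.smul_mem _ _ (Submodule.mul_mem_mul (Submodule.mem_span_singleton_self _)
      (Submodule.subset_span ⟨k, rfl⟩))
  have hQy : ∀ a i, Q a i * y i a ≤ Q a i := by
    intro a i
    rw [Submodule.span_mul_span]
    apply Submodule.span_mono
    rintro _ ⟨_, ⟨k, rfl⟩, _, rfl, rfl⟩
    exact ⟨k + 1, pow_succ _ _⟩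
  have hAQ : ∀ a, AA a ≤ ((List.finRange n).map (Q a)).prod := by
    intro a
    refine adjoin_le_of_mul_mem (List.one_mem_prod_map _ _ fun i =>
      Submodule.subset_span ⟨0, pow_zero _⟩) ?_
    rintro m hm _ ⟨i, rfl⟩
    exact List.prod_map_mul_le (Q a) (fun i => y i a) _
      (List.pairwise_of_forall fun i j => hyQ a i j) (hQy a) (List.mem_finRange i)
      (Submodule.mul_mem_mul hm (Submodule.mem_span_singleton_self _))
  have hall : Subalgebra.toSubmodule
      (Algebra.adjoin Kv (Set.range fun p : Fin n × Fin n => x p.1 p.2)) ≤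
      ((List.finRange n).reverse.map AA).prod := by
    refine adjoin_le_of_mul_mem (List.one_mem_prod_map _ _ fun a =>
      Subalgebra.one_mem _) ?_
    rintro m hm _ ⟨⟨i, a⟩, rfl⟩
    refine List.prod_map_mul_le AA Y (List.finRange n).reverse ?_
      (fun a => (mul_le_mul' le_rfl (hYA a)).trans (hAA a))
      (List.mem_reverse.2 (List.mem_finRange a))
      (Submodule.mul_mem_mul hm (Submodule.subset_span ⟨i, rfl⟩))
    rw [List.pairwise_reverse]
    exact (List.pairwise_lt_finRange n).imp fun {a b} hab => hcol a b hab
  refine hall.trans ((List.prod_map_mono _ hAQ).trans ?_)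
  refine (List.prod_map_mono _ fun a => List.prod_map_span_range_le
    (fun i (k : ℕ) => x i a ^ k) _ (List.nodup_finRange n)).trans ?_
  exact List.prod_map_span_range_le (fun a (M : Fin n → ℕ) =>
    ((List.finRange n).map fun i => x i a ^ M i).prod) _
    (List.nodup_reverse.2 (List.nodup_finRange n))

end Monomials

namespace TwHall

/-! ### The generators `t̄_{ij}` in the twisted Hall algebra -/

/-- The exponent of the torus part of `t̄_{ij}`. -/
def del (i j : Fin n) : Fin n → ℤ := if i = j then Pi.single i 1 else -between i j

theorem del_apply (i j k : Fin n) :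
    del i j k = if i = j then (if k = i then 1 else 0) else if i < k ∧ k < j then -1 else 0 := by
  unfold del
  split_ifs <;> simp_all [between]

/-- The off-diagonal part of the matrix unit at `(i, j)`. -/
def offUnit (i j : Fin n) : Idx n := if h : i < j then unitIdx (upair i j h) else 0

theorem offUnit_of_lt {i j : Fin n} (h : i < j) : offUnit i j = unitIdx (upair i j h) := dif_pos h

theorem offUnit_self (i : Fin n) : offUnit i i = 0 := dif_neg (lt_irrefl i)

theorem wt_offUnit {i j : Fin n} (h : i ≤ j) (m : Fin n → ℤ) :
    dotProduct (wt (offUnit i j)) m = m j - m i := by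
  rcases eq_or_lt_of_le h with rfl | h
  · rw [offUnit_self, wt_zero, zero_dotProduct, sub_self]
  · have : wt (offUnit i j) = Pi.single j 1 - Pi.single i 1 := by
      ext k
      simp only [wt, colSum, rowSum, toMat, offUnit_of_lt h, ent_single, Pi.sub_apply,
        Pi.single_apply]
      congr 1
      · by_cases hk : k = j <;> simp [hk]
      · by_cases hk : k = i <;> simp [hk]
    rw [this, sub_dotProduct, single_one_dotProduct, single_one_dotProduct]

/-- The scalar in front of `t̄_{ij}`. -/
def tc (i j : Fin n) : Kv := if i < j then vv - vv⁻¹ else if i = j then 1 else 0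

theorem tc_of_lt {i j : Fin n} (h : i < j) : tc i j = vv - vv⁻¹ := if_pos h

theorem tc_self (i : Fin n) : tc i i = 1 := by rw [tc, if_neg (lt_irrefl i), if_pos rfl]

theorem vv_sub_inv_ne_zero : vv - vv⁻¹ ≠ 0 := by
  intro h
  have h1 : vv ^ (1 : ℤ) = vv ^ (-1 : ℤ) := by
    rw [zpow_one, zpow_neg_one]
    exact sub_eq_zero.1 h
  exact absurd (vv_zpow_injective h1) (by norm_num)

theorem tc_ne_zero {i j : Fin n} (h : i ≤ j) : tc i j ≠ 0 := by
  rcases eq_or_lt_of_le h with rfl | h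
  · rw [tc_self]
    exact one_ne_zero
  · rw [tc_of_lt h]
    exact vv_sub_inv_ne_zero

/-- The element `t̄_{ij}` of the twisted Hall algebra. -/
def tt (i j : Fin n) : TwHall n := tc i j • (tor (del i j) * hx (offUnit i j))

theorem tt_of_gt {i j : Fin n} (h : j < i) : tt i j = 0 := by
  rw [tt, tc, if_neg h.not_gt, if_neg h.ne', zero_smul]

theorem toKHat_tt (i j : Fin n) : toKHat (tt i j) = tBar i j := by
  rcases lt_trichotomy i j with h | rfl | h
  · rw [tt, tor_mul_hx, map_smul, toKHat_bas, tBar_of_lt h, tc_of_lt h, del, if_neg h.ne,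
      offUnit_of_lt h]
  · rw [tt, tor_mul_hx, map_smul, toKHat_bas, tBar_self, tc_self, del, if_pos rfl, offUnit_self,
      one_smul]
  · rw [tt_of_gt h, map_zero, tBar_of_gt h]

theorem tt_mul_tt {i a : Fin n} (h : i ≤ a) (j b : Fin n) : tt i a * tt j b =
    (tc i a * tc j b * vv ^ (del j b a - del j b i)) •
      (tor (del i a + del j b) * (hx (offUnit i a) * hx (offUnit j b))) := by
  rw [tt, tt, smul_mul_smul_comm, mul_assoc, ← mul_assoc (hx _), hx_mul_tor, wt_offUnit h,
    smul_mul_assoc, mul_smul_comm, smul_smul, mul_assoc (tor _) (hx _), ← mul_assoc (tor _) (tor _),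
    tor_mul_tor]

theorem hx_offUnit_self (i : Fin n) : (hx (offUnit i i) : TwHall n) = 1 := by
  rw [offUnit_self, hx_zero]

theorem hx_offUnit_of_lt {i j : Fin n} (h : i < j) : hx (offUnit i j) = rt i j := by
  rw [offUnit_of_lt h, rt_of_lt h]

/-- Each relation is a relation of root elements corrected by the powers of v from moving torus
parts past root elements; for instance q = v² becomes v² · v⁻¹ for two elements of a row. In `cross`
the intervals [i, a] and [j, b] may be disjoint, touch or overlap. When they touch, the commutator
E_{ib} appears as a multiple of t̄_{ib} t̄_{aa}. -/
theorem isRTT_tt : IsRTT vv⁻¹ (tt : Fin n → Fin n → TwHall n) where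
  zero i j h := tt_of_gt h
  row i a b hab := by
    rw [inv_inv]
    rcases lt_trichotomy i a with h | rfl | h
    · have e1 : del i b a - del i b i = -1 := by
        simp only [del_apply, Fin.ext_iff, Fin.lt_def] at *
        split_ifs <;> omega
      have e2 : del i a b - del i a i = 0 := by
        simp only [del_apply, Fin.ext_iff, Fin.lt_def] at *
        split_ifs <;> omega
      rw [tt_mul_tt h.le, tt_mul_tt (h.trans hab).le, hx_offUnit_of_lt h,
        hx_offUnit_of_lt (h.trans hab), rt_mul_rt_same_row h hab, e1, e2, mul_smul_comm, smul_smul,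
        smul_smul, add_comm (del i a)]
      congr 1
      have := vv_ne_zero
      field_simp
    · have e1 : del i b i - del i b i = 0 := sub_self _
      have e2 : del i i b - del i i i = -1 := by
        simp only [del_apply, Fin.ext_iff, Fin.lt_def] at *
        split_ifs <;> omega
      rw [tt_mul_tt le_rfl, tt_mul_tt hab.le, hx_offUnit_self, one_mul, mul_one, e1, e2, smul_smul,
        add_comm (del i i)]
      congr 1
      have := vv_ne_zero
      field_simp
    · rw [tt_of_gt h, zero_mul, mul_zero, smul_zero]
  col i j a hij := by
    rw [inv_inv]
    rcases lt_trichotomy j a with h | rfl | h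
    · have e1 : del j a a - del j a i = 0 := by
        simp only [del_apply, Fin.ext_iff, Fin.lt_def] at *
        split_ifs <;> omega
      have e2 : del i a a - del i a j = 1 := by
        simp only [del_apply, Fin.ext_iff, Fin.lt_def] at *
        split_ifs <;> omega
      rw [tt_mul_tt (hij.trans h).le, tt_mul_tt h.le, hx_offUnit_of_lt h,
        hx_offUnit_of_lt (hij.trans h), rt_mul_rt_of_lt_row (hij.trans h) h hij, e1, e2,
        mul_smul_comm, smul_smul, smul_smul, add_comm (del i a)]
      congr 1
      have := vv_ne_zero
      field_simp
    · have e1 : del j j j - del j j i = 1 := by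
        simp only [del_apply, Fin.ext_iff, Fin.lt_def] at *
        split_ifs <;> omega
      have e2 : del i j j - del i j j = 0 := sub_self _
      rw [tt_mul_tt hij.le, tt_mul_tt le_rfl, hx_offUnit_self, one_mul, mul_one, e1, e2, smul_smul,
        add_comm (del i j)]
      congr 1
      have := vv_ne_zero
      field_simp
    · rw [tt_of_gt h, zero_mul, mul_zero, smul_zero]
  comm i j a b hab hji := by
    rcases lt_or_ge a i with h | h
    · rw [tt_of_gt h, zero_mul, mul_zero]
    have hjb : j < b := (hji.trans_le h).trans hab
    have e1 : del j b a - del j b i = 0 := by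
      simp only [del_apply, Fin.ext_iff, Fin.lt_def, Fin.le_def] at *
      split_ifs <;> omega
    have e2 : del i a b - del i a j = 0 := by
      simp only [del_apply, Fin.ext_iff, Fin.lt_def, Fin.le_def] at *
      split_ifs <;> omega
    have hc : hx (offUnit i a) * hx (offUnit j b) = hx (offUnit j b) * hx (offUnit i a) := by
      rcases eq_or_lt_of_le h with rfl | h
      · rw [hx_offUnit_self, one_mul, mul_one]
      · rw [hx_offUnit_of_lt h, hx_offUnit_of_lt hjb, rt_comm_of_nested hji h hab]
    rw [tt_mul_tt h, tt_mul_tt hjb.le, e1, e2, hc, add_comm (del i a), mul_comm (tc i a)]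
  cross i j a b hab hij := by
    rw [inv_inv]
    rcases lt_or_ge a i with h | hia
    · rw [tt_of_gt h, tt_of_gt (h.trans hij), zero_mul, mul_zero, mul_zero, smul_zero, add_zero]
    rcases lt_or_ge b j with h | hjb
    · rw [tt_of_gt h, tt_of_gt (hab.trans h), zero_mul, mul_zero, mul_zero, smul_zero, add_zero]
    rcases lt_trichotomy a j with h | rfl | h
    · have e1 : del j b a - del j b i = 0 := by
        simp only [del_apply, Fin.ext_iff, Fin.lt_def, Fin.le_def] at *
        split_ifs <;> omega
      have e2 : del i a b - del i a j = 0 := by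
        simp only [del_apply, Fin.ext_iff, Fin.lt_def, Fin.le_def] at *
        split_ifs <;> omega
      have hc : hx (offUnit i a) * hx (offUnit j b) = hx (offUnit j b) * hx (offUnit i a) := by
        rcases eq_or_lt_of_le hia with rfl | hia
        · rw [hx_offUnit_self, one_mul, mul_one]
        rcases eq_or_lt_of_le hjb with rfl | hjb
        · rw [hx_offUnit_self, one_mul, mul_one]
        · rw [hx_offUnit_of_lt hia, hx_offUnit_of_lt hjb, rt_comm_of_lt hia h hjb]
      rw [tt_of_gt h, mul_zero, smul_zero, add_zero, tt_mul_tt hia, tt_mul_tt hjb, e1, e2, hc,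
        add_comm (del i a), mul_comm (tc i a)]
    · have e1 : del a b a - del a b i = 0 := by
        simp only [del_apply, Fin.ext_iff, Fin.lt_def, Fin.le_def] at *
        split_ifs <;> omega
      have e2 : del i a b - del i a a = 0 := by
        simp only [del_apply, Fin.ext_iff, Fin.lt_def, Fin.le_def] at *
        split_ifs <;> omega
      have e3 : del a a b - del a a i = 0 := by
        simp only [del_apply, Fin.ext_iff, Fin.lt_def, Fin.le_def] at *
        split_ifs <;> omega
      -- The torus parts of all three products agree, so the comparison reduces to root elements and
      -- scalars.
      have e4 : (del a b + del i a : Fin n → ℤ) = del i b + del a a := by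
        ext k
        simp only [Pi.add_apply, del_apply, Fin.ext_iff, Fin.lt_def, Fin.le_def] at *
        split_ifs <;> omega
      rw [tt_mul_tt hij.le, tt_mul_tt hab.le, tt_mul_tt (hij.trans hab).le, hx_offUnit_of_lt hij,
        hx_offUnit_of_lt hab, hx_offUnit_of_lt (hij.trans hab), hx_offUnit_self, e1, e2, e3,
        rt_mul_touching hij hab, add_comm (del i a), ← e4, mul_one, mul_add, smul_add, smul_smul,
        tc_of_lt hij, tc_of_lt hab, tc_of_lt (hij.trans hab), tc_self]
      congr 2
      ring
    · have hia := hij.trans h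
      have hjb := h.trans hab
      have e1 : del j b a - del j b i = -1 := by
        simp only [del_apply, Fin.ext_iff, Fin.lt_def, Fin.le_def] at *
        split_ifs <;> omega
      have e2 : del i a b - del i a j = 1 := by
        simp only [del_apply, Fin.ext_iff, Fin.lt_def, Fin.le_def] at *
        split_ifs <;> omega
      have e3 : del j a b - del j a i = 0 := by
        simp only [del_apply, Fin.ext_iff, Fin.lt_def, Fin.le_def] at *
        split_ifs <;> omega
      have e4 : (del j b + del i a : Fin n → ℤ) = del i b + del j a := by
        ext k
        simp only [Pi.add_apply, del_apply, Fin.ext_iff, Fin.lt_def, Fin.le_def] at *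
        split_ifs <;> omega
      rw [tt_mul_tt hia.le, tt_mul_tt hjb.le, tt_mul_tt (hia.trans hab).le, hx_offUnit_of_lt hia,
        hx_offUnit_of_lt hjb, hx_offUnit_of_lt (hia.trans hab), hx_offUnit_of_lt h, e1, e2, e3,
        rt_mul_crossing hij h hab, add_comm (del i a), ← e4, mul_add, smul_add, mul_smul_comm,
        mul_smul_comm, smul_smul, smul_smul, smul_smul, tc_of_lt hia, tc_of_lt hjb,
        tc_of_lt (hia.trans hab), tc_of_lt h]
      have := vv_ne_zero
      congr 2 <;> field_simp

/-! ### Ordered monomials in the `t̄_{ij}` -/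

/-- The index of the basis element that is proportional to `t̄_{ij}`. -/
def ttKey (i j : Fin n) : Idx n × (Fin n → ℤ) := (offUnit i j, del i j)

/-- Multiples of the basis element `k` by nonzero scalars. -/
def IsBasMultiple (x : TwHall n) (k : Idx n × (Fin n → ℤ)) : Prop :=
  ∃ c : Kv, c ≠ 0 ∧ x = c • bas k.1 k.2

/-- `A` vanishes in the columns to the left of `a`. -/
def ColGE (A : Idx n) (a : Fin n) : Prop := ∀ i b, b < a → ent A i b = 0

theorem ColGE.add_smul_offUnit {A : Idx n} {a : Fin n} (h : ColGE A a) (k : ℕ) (i : Fin n) :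
    ColGE (A + k • offUnit i a) a := by
  intro c b hb
  rw [ent_add, h c b hb, zero_add]
  unfold offUnit
  split_ifs with hia
  · rw [← Pi.single_smul, ent_single, if_neg fun h => hb.ne h.2]
  · simp

/-- By `hx_mul_root` no other basis elements appear as long as the columns come in decreasing order;
the scalar is nonzero because the quantum integers are nonzero at v². -/
theorem IsBasMultiple.mul_tt {x : TwHall n} {k : Idx n × (Fin n → ℤ)} (hx : IsBasMultiple x k)
    {i a : Fin n} (hia : i ≤ a) (hk : ColGE k.1 a) : IsBasMultiple (x * tt i a) (k + ttKey i a) := by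
  obtain ⟨c, hc, rfl⟩ := hx
  have key : ∃ e : Kv, e ≠ 0 ∧ hx k.1 * hx (offUnit i a) = e • hx (k.1 + offUnit i a) := by
    rcases eq_or_lt_of_le hia with rfl | h
    · exact ⟨1, one_ne_zero, by rw [offUnit_self, hx_zero, mul_one, add_zero, one_smul]⟩
    · exact ⟨_, qc_ne_zero _ _ _, by rw [offUnit_of_lt h, hx_mul_root h hk]⟩
  obtain ⟨e, he, hke⟩ := key
  refine ⟨c * tc i a * vv ^ dotProduct (wt k.1) (del i a) * e,
    mul_ne_zero (mul_ne_zero (mul_ne_zero hc (tc_ne_zero hia)) (zpow_ne_zero _ vv_ne_zero)) he, ?_⟩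
  rw [tt, smul_mul_smul_comm, ← mul_assoc, bas_mul_tor, smul_mul_assoc, ← tor_mul_hx, mul_assoc,
    hke, mul_smul_comm, tor_mul_hx, smul_smul, smul_smul]
  rfl

theorem IsBasMultiple.mul_tt_pow {x : TwHall n} {k : Idx n × (Fin n → ℤ)} (hx : IsBasMultiple x k)
    {i a : Fin n} (hk : ColGE k.1 a) (N : ℕ) (hN : a < i → N = 0) :
    IsBasMultiple (x * tt i a ^ N) (k + N • ttKey i a) := by
  rcases lt_or_ge a i with h | h
  · rw [hN h, pow_zero, mul_one, zero_smul, add_zero]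
    exact hx
  clear hN
  induction N with
  | zero =>
    rw [pow_zero, mul_one, zero_smul, add_zero]
    exact hx
  | succ N ih =>
    rw [pow_succ, ← mul_assoc, succ_nsmul, ← add_assoc]
    exact ih.mul_tt h (hk.add_smul_offUnit N i)

theorem IsBasMultiple.mul_column {x : TwHall n} {k : Idx n × (Fin n → ℤ)}
    (hx : IsBasMultiple x k) {a : Fin n} (hk : ColGE k.1 a) (N : Fin n → ℕ)
    (hN : ∀ i, a < i → N i = 0) (l : List (Fin n)) :
    IsBasMultiple (x * (l.map fun i => tt i a ^ N i).prod)
        (k + (l.map fun i => N i • ttKey i a).sum) ∧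
      ColGE (k + (l.map fun i => N i • ttKey i a).sum).1 a := by
  induction l generalizing x k with
  | nil => simpa using ⟨hx, hk⟩
  | cons i l ih =>
    simp only [List.map_cons, List.prod_cons, List.sum_cons]
    rw [← mul_assoc, ← add_assoc]
    exact ih (hx.mul_tt_pow hk _ (hN i)) (hk.add_smul_offUnit _ i)

theorem IsBasMultiple.mul_columns {x : TwHall n} {k : Idx n × (Fin n → ℤ)}
    (hx : IsBasMultiple x k) (M : Fin n → Fin n → ℕ) (hM : ∀ a i, a < i → M a i = 0)
    (l l' : List (Fin n)) (hl : l.Pairwise (· > ·)) (hk : ∀ a ∈ l, ColGE k.1 a) :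
    IsBasMultiple (x * (l.map fun a => (l'.map fun i => tt i a ^ M a i).prod).prod)
      (k + (l.map fun a => (l'.map fun i => M a i • ttKey i a).sum).sum) := by
  induction l generalizing x k with
  | nil => simpa using hx
  | cons a l ih =>
    rw [List.pairwise_cons] at hl
    simp only [List.map_cons, List.prod_cons, List.sum_cons]
    rw [← mul_assoc, ← add_assoc]
    obtain ⟨h1, h2⟩ := hx.mul_column (hk a List.mem_cons_self) (M a) (hM a) l'
    exact ih h1 hl.2 fun b hb c d hd => h2 c d (hd.trans (hl.1 b hb))

/-- The index of the basis element that is proportional to the monomial with the exponents `M`. -/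
def monoKey (M : Fin n → Fin n → ℕ) : Idx n × (Fin n → ℤ) := ∑ a, ∑ i, M a i • ttKey i a

theorem isBasMultiple_rttMonomial {M : Fin n → Fin n → ℕ} (hM : ∀ a i, a < i → M a i = 0) :
    IsBasMultiple (rttMonomial tt M) (monoKey M) := by
  have h1 : IsBasMultiple (1 : TwHall n) 0 := ⟨1, one_ne_zero, by rw [one_smul]; rfl⟩
  have h2 := h1.mul_columns M hM (List.finRange n).reverse (List.finRange n)
    (List.pairwise_reverse.2 (List.pairwise_lt_finRange n)) fun a _ i b _ => ent_zero i b
  have e : ((List.finRange n).reverse.map fun a =>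
      ((List.finRange n).map fun i => M a i • ttKey i a).sum).sum = monoKey M := by
    rw [List.map_reverse, List.sum_reverse]
    simp only [monoKey, Fin.sum_univ_def]
  rwa [one_mul, zero_add, e] at h2

theorem monoKey_fst (M : Fin n → Fin n → ℕ) {i a : Fin n} (h : i < a) :
    (monoKey M).1 (upair i a h) = M a i := by
  simp only [monoKey, Prod.fst_sum, Finset.sum_apply, Prod.smul_fst, ttKey, Pi.smul_apply]
  rw [Finset.sum_eq_single a, Finset.sum_eq_single i]
  · rw [offUnit_of_lt h, unitIdx, Pi.single_eq_same, smul_eq_mul, mul_one]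
  · intro j _ hj
    unfold offUnit
    split_ifs with hja
    · rw [unitIdx, Pi.single_eq_of_ne, smul_zero]
      exact fun h' => hj (congrArg (fun p => p.1.1) h').symm
    · rw [Pi.zero_apply, smul_zero]
  · simp
  · intro b _ hb
    refine Finset.sum_eq_zero fun j _ => ?_
    unfold offUnit
    split_ifs with hja
    · rw [unitIdx, Pi.single_eq_of_ne, smul_zero]
      exact fun h' => hb (congrArg (fun p => p.1.2) h').symm
    · rw [Pi.zero_apply, smul_zero]
  · simp

theorem monoKey_snd (M : Fin n → Fin n → ℕ) (a : Fin n) :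
    (monoKey M).2 a = M a a + ∑ b, ∑ i, if i = b then 0 else M b i • del i b a := by
  simp only [monoKey, Prod.snd_sum, Finset.sum_apply, Prod.smul_snd, ttKey, Pi.smul_apply]
  have : ∀ b i, M b i • del i b a = (if i = b then (if a = b then (M a a : ℤ) else 0) else 0) +
      if i = b then 0 else M b i • del i b a := by
    intro b i
    rw [del_apply]
    by_cases h : i = b
    · subst h
      by_cases h' : a = i
      · subst h'
        simp
      · simp [h']
    · simp [h]
  rw [Finset.sum_congr rfl fun b _ => Finset.sum_congr rfl fun i _ => this b i]
  simp only [Finset.sum_add_distrib]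
  simp

/-- The first component of the key displays the off-diagonal exponents. These determine the shifts
that the torus parts of the t̄_{ib} with i < b cause in the second component, so the diagonal
exponents can be read off from the rest. -/
theorem monoKey_injective {M M' : Fin n → Fin n → ℕ} (hM : ∀ a i, a < i → M a i = 0)
    (hM' : ∀ a i, a < i → M' a i = 0) (h : monoKey M = monoKey M') : M = M' := by
  have hoff : ∀ a i, i ≠ a → M a i = M' a i := by
    intro a i hia
    rcases lt_or_gt_of_ne hia with hlt | hlt
    · rw [← monoKey_fst M hlt, h, monoKey_fst M' hlt]
    · rw [hM a i hlt, hM' a i hlt]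
  funext a i
  by_cases hia : i = a
  · subst hia
    have h1 := monoKey_snd M i
    rw [h, monoKey_snd M' i] at h1
    have h2 : ∀ b j, (if j = b then 0 else M b j • del j b i) =
        if j = b then 0 else M' b j • del j b i := by
      intro b j
      split_ifs with hjb
      · rfl
      · rw [hoff b j hjb]
    simp only [h2, add_left_inj] at h1
    exact_mod_cast h1.symm
  · exact hoff a i hia

theorem linearIndependent_rttMonomial : LinearIndependent Kv
    fun M : {M : Fin n → Fin n → ℕ // ∀ a i, a < i → M a i = 0} => rttMonomial tt M.1 := by
  choose c hc hM using fun M : {M : Fin n → Fin n → ℕ // ∀ a i, a < i → M a i = 0} =>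
    isBasMultiple_rttMonomial M.2
  have h1 : LinearIndependent Kv fun k : Idx n × (Fin n → ℤ) => bas k.1 k.2 :=
    Finsupp.linearIndependent_single_one Kv _
  have h2 := (h1.comp (fun M : {M : Fin n → Fin n → ℕ // ∀ a i, a < i → M a i = 0} => monoKey M.1)
    fun M M' h => Subtype.ext (monoKey_injective M.2 M'.2 h)).units_smul
    fun M => Units.mk0 (c M) (hc M)
  convert h2 using 1
  funext M
  exact hM M

end TwHall

/-! ### The PBW argument -/

theorem map_rttMonomial {R S : Type*} [Ring R] [Algebra Kv R] [Ring S] [Algebra Kv S]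
    (f : R →ₐ[Kv] S) (x : Fin n → Fin n → R) (M : Fin n → Fin n → ℕ) :
    f (rttMonomial x M) = rttMonomial (fun i a => f (x i a)) M := by
  simp [rttMonomial, map_list_prod, Function.comp_def]

theorem IsRTT.rttMonomial_eq_zero {q : Kv} {R : Type*} [Ring R] [Algebra Kv R]
    {x : Fin n → Fin n → R} (hx : IsRTT q x) {M : Fin n → Fin n → ℕ} {a i : Fin n} (hai : a < i)
    (hM : M a i ≠ 0) : rttMonomial x M = 0 := by
  refine List.prod_eq_zero (List.mem_map.2 ⟨a, by simp, List.prod_eq_zero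
    (List.mem_map.2 ⟨i, by simp, ?_⟩)⟩)
  rw [hx.zero i a hai, zero_pow hM]

/-- The map from the algebra presented by the RTT relations to the twisted Hall algebra. -/
def RTTPlus.toTwHall (n : ℕ) : RTTPlus n vv⁻¹ →ₐ[Kv] TwHall n :=
  RTTPlus.lift (inv_ne_zero vv_ne_zero) TwHall.isRTT_tt

theorem RTTPlus.toTwHall_gen (i j : Fin n) :
    RTTPlus.toTwHall n (RTTPlus.gen vv⁻¹ i j) = TwHall.tt i j := RTTPlus.lift_gen _ _ _ _

/-- The sorted monomials with no factor below the diagonal span the presented algebra and are sent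
to linearly independent elements. -/
theorem RTTPlus.toTwHall_injective : Function.Injective (RTTPlus.toTwHall n) := by
  have hq := inv_ne_zero vv_ne_zero
  have hx := RTTPlus.isRTT_gen (n := n) hq
  have hspan : ∀ x : RTTPlus n vv⁻¹, x ∈ Submodule.span Kv (Set.range
      fun M : {M : Fin n → Fin n → ℕ // ∀ a i, a < i → M a i = 0} =>
        rttMonomial (RTTPlus.gen vv⁻¹) M.1) := by
    intro x
    have h1 : x ∈ Subalgebra.toSubmodule (Algebra.adjoin Kv
        (Set.range fun p : Fin n × Fin n => RTTPlus.gen vv⁻¹ p.1 p.2)) := by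
      rw [RTTPlus.adjoin_gen]
      trivial
    refine Submodule.span_le.2 ?_ (hx.span_rttMonomial hq h1)
    rintro _ ⟨M, rfl⟩
    by_cases hM : ∀ a i, a < i → M a i = 0
    · exact Submodule.subset_span ⟨⟨M, hM⟩, rfl⟩
    · push Not at hM
      obtain ⟨a, i, hai, h⟩ := hM
      rw [hx.rttMonomial_eq_zero hai h]
      exact Submodule.zero_mem _
  rw [injective_iff_map_eq_zero]
  intro x h0
  obtain ⟨l, rfl⟩ := Finsupp.mem_span_range_iff_exists_finsupp.1 (hspan x)
  have hli := linearIndependent_iff.1 (TwHall.linearIndependent_rttMonomial (n := n)) l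
  rw [hli, Finsupp.sum_zero_index]
  rw [← h0, Finsupp.linearCombination_apply, map_finsuppSum]
  refine Finsupp.sum_congr fun M _ => ?_
  rw [map_smul, map_rttMonomial]
  simp only [RTTPlus.toTwHall_gen]

/-! ### The subalgebra `U` -/

namespace RTTPlus

/-- The map from the algebra presented by the RTT relations to the completion. -/
def toKHat (n : ℕ) : RTTPlus n vv⁻¹ →ₗ[Kv] KHat n := TwHall.toKHat ∘ₗ (toTwHall n).toLinearMap

theorem toKHat_apply (x : RTTPlus n vv⁻¹) : toKHat n x = TwHall.toKHat (toTwHall n x) := rfl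

theorem toKHat_one : toKHat n 1 = 1 := by rw [toKHat_apply, map_one, TwHall.toKHat_one]

/-- Multiplicativity is stated apart from linearity because the completion is given only a
nonassociative ring structure; on U associativity follows from this very map. -/
theorem toKHat_mul (x y : RTTPlus n vv⁻¹) : toKHat n (x * y) = toKHat n x * toKHat n y := by
  rw [toKHat_apply, map_mul, TwHall.toKHat_mul]
  rfl

theorem toKHat_gen (i j : Fin n) : toKHat n (gen vv⁻¹ i j) = tBar i j := by
  rw [toKHat_apply, toTwHall_gen, TwHall.toKHat_tt]

theorem toKHat_injective : Function.Injective (toKHat n) :=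
  TwHall.toKHat_injective.comp toTwHall_injective

theorem toKHat_mem_calU (x : RTTPlus n vv⁻¹) : toKHat n x ∈ calU n := by
  have hx : x ∈ Algebra.adjoin Kv (Set.range fun p : Fin n × Fin n => gen vv⁻¹ p.1 p.2) := by
    rw [adjoin_gen]
    trivial
  induction hx using Algebra.adjoin_induction with
  | mem x hx =>
    obtain ⟨p, rfl⟩ := hx
    rw [toKHat_gen]
    exact NonUnitalAlgebra.subset_adjoin Kv (Or.inr ⟨p, rfl⟩)
  | algebraMap c =>
    rw [Algebra.algebraMap_eq_smul_one, map_smul, toKHat_one]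
    exact SMulMemClass.smul_mem c (NonUnitalAlgebra.subset_adjoin Kv (Or.inl rfl))
  | add x y _ _ h1 h2 =>
    rw [map_add]
    exact add_mem h1 h2
  | mul x y _ _ h1 h2 =>
    rw [toKHat_mul]
    exact mul_mem h1 h2

theorem exists_toKHat_eq {u : KHat n} (hu : u ∈ calU n) : ∃ x, toKHat n x = u := by
  induction hu using NonUnitalAlgebra.adjoin_induction with
  | mem u hu =>
    rcases hu with rfl | ⟨p, rfl⟩
    · exact ⟨1, toKHat_one⟩
    · exact ⟨gen vv⁻¹ p.1 p.2, toKHat_gen _ _⟩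
  | zero => exact ⟨0, map_zero _⟩
  | add u w _ _ h1 h2 =>
    obtain ⟨x, rfl⟩ := h1
    obtain ⟨y, rfl⟩ := h2
    exact ⟨x + y, map_add _ _ _⟩
  | mul u w _ _ h1 h2 =>
    obtain ⟨x, rfl⟩ := h1
    obtain ⟨y, rfl⟩ := h2
    exact ⟨x * y, toKHat_mul _ _⟩
  | smul c u _ h1 =>
    obtain ⟨x, rfl⟩ := h1
    exact ⟨c • x, map_smul _ _ _⟩

/-- The isomorphism of the algebra presented by the RTT relations with `U`. -/
def equivCalU (n : ℕ) : RTTPlus n vv⁻¹ ≃ₗ[Kv] calU n :=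
  LinearEquiv.ofBijective
    { toFun := fun x => (⟨toKHat n x, toKHat_mem_calU x⟩ : calU n)
      map_add' := fun x y => Subtype.ext (map_add _ x y)
      map_smul' := fun c x => Subtype.ext (map_smul _ c x) }
    ⟨fun _ _ h => toKHat_injective (congrArg Subtype.val h), fun u => by
      obtain ⟨x, hx⟩ := exists_toKHat_eq u.2
      exact ⟨x, Subtype.ext hx⟩⟩

end RTTPlus

/-! ### The positive part of `U_v(gl_n)` -/

theorem UPlus.isRTT_tbar : IsRTT vv (UPlus.tbar : Fin n → Fin n → UPlus n) :=
  IsRTT.of_rtt vv_ne_zero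
    (fun i j h => Subtype.ext <| by
      have := RingQuot.mkAlgHom_rel Kv (UvRel.tbar_zero j i h)
      rwa [map_zero] at this)
    fun i a j b => Subtype.ext <| by
      have := RingQuot.mkAlgHom_rel Kv (UvRel.bb i a j b)
      simp only [map_sub, map_smul, map_mul] at this
      exact this

theorem UPlus.isRTT_tbar_rev :
    IsRTT vv⁻¹ fun i j : Fin n => (UPlus.tbar j.rev i.rev : UPlus n) :=
  IsRTT.reflect vv_ne_zero UPlus.isRTT_tbar

/-- The map `x_{ij} ↦ t̄_{n+1-j,n+1-i}` to the positive part. -/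
def RTTPlus.toUPlus (n : ℕ) : RTTPlus n vv⁻¹ →ₐ[Kv] UPlus n :=
  RTTPlus.lift (inv_ne_zero vv_ne_zero) UPlus.isRTT_tbar_rev

theorem RTTPlus.toUPlus_gen (i j : Fin n) :
    RTTPlus.toUPlus n (RTTPlus.gen vv⁻¹ i j) = UPlus.tbar j.rev i.rev := RTTPlus.lift_gen _ _ _ _

theorem RTTPlus.toUPlus_surjective : Function.Surjective (RTTPlus.toUPlus n) := by
  intro y
  have h : UPlus n ≤ ((UPlus n).val.comp (RTTPlus.toUPlus n)).range := by
    refine Algebra.adjoin_le ?_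
    rintro _ ⟨⟨i, j⟩, rfl⟩
    refine ⟨RTTPlus.gen vv⁻¹ j.rev i.rev, ?_⟩
    change (UPlus n).val (RTTPlus.toUPlus n (RTTPlus.gen vv⁻¹ j.rev i.rev)) = _
    rw [RTTPlus.toUPlus_gen, Fin.rev_rev, Fin.rev_rev]
    rfl
  obtain ⟨x, hx⟩ := h y.2
  exact ⟨x, Subtype.ext hx⟩

/-- The retraction of `U_v(gl_n)` onto its positive part that sends all `t_{ij}` to `0`. -/
def UvGl.toRTTPlus (n : ℕ) : UvGl n →ₐ[Kv] RTTPlus n vv⁻¹ :=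
  RingQuot.liftAlgHom Kv ⟨FreeAlgebra.lift Kv fun g => match g with
    -- This is consistent because every term of the relations `tt` and `bt` contains some t_{ij},
    -- and no relation makes t_{ii} invertible.
    | .t _ _ => 0
    | .tbar i j => RTTPlus.gen vv⁻¹ j.rev i.rev, by
    have hx : IsRTT vv fun i j : Fin n => RTTPlus.gen vv⁻¹ j.rev i.rev := by
      simpa only [inv_inv] using (RTTPlus.isRTT_gen (n := n) (inv_ne_zero vv_ne_zero)).reflect
        (inv_ne_zero vv_ne_zero)
    intro a b h
    cases h with
    | t_zero i j h => simp [RTTGen.T]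
    | tbar_zero i j h => simpa [RTTGen.Tb] using hx.zero j i h
    | tt i a j b => simp [RTTGen.T]
    | bb i a j b => simpa [RTTGen.Tb] using hx.rtt vv_ne_zero i a j b
    | bt i a j b => simp [RTTGen.T]⟩

theorem UvGl.toRTTPlus_tbar (i j : Fin n) :
    UvGl.toRTTPlus n (UvGl.tbar i j) = RTTPlus.gen vv⁻¹ j.rev i.rev := by
  rw [UvGl.toRTTPlus, UvGl.tbar, RingQuot.liftAlgHom_mkAlgHom_apply, RTTGen.Tb,
    FreeAlgebra.lift_ι_apply]

/-- The retraction inverts the map on generators, so the larger algebra imposes no further relations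
on the t̄_{ij}. -/
theorem UvGl.toRTTPlus_toUPlus (x : RTTPlus n vv⁻¹) :
    UvGl.toRTTPlus n (RTTPlus.toUPlus n x) = x := by
  have h : ((UvGl.toRTTPlus n).comp (UPlus n).val).comp (RTTPlus.toUPlus n) = AlgHom.id Kv _ := by
    refine RTTPlus.algHom_ext fun i j => ?_
    rw [AlgHom.comp_apply, RTTPlus.toUPlus_gen, AlgHom.comp_apply]
    change UvGl.toRTTPlus n (UvGl.tbar j.rev i.rev) = _
    rw [UvGl.toRTTPlus_tbar, Fin.rev_rev, Fin.rev_rev]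
    rfl
  exact DFunLike.congr_fun h x

/-- The positive part is presented by the RTT relations. -/
def RTTPlus.equivUPlus (n : ℕ) : RTTPlus n vv⁻¹ ≃ₐ[Kv] UPlus n :=
  AlgEquiv.ofBijective (RTTPlus.toUPlus n)
    ⟨fun x y h => by
      rw [← UvGl.toRTTPlus_toUPlus x, h, UvGl.toRTTPlus_toUPlus],
      RTTPlus.toUPlus_surjective⟩

theorem RTTPlus.equivUPlus_symm_tbar (i j : Fin n) :
    (RTTPlus.equivUPlus n).symm (UPlus.tbar i j) = RTTPlus.gen vv⁻¹ j.rev i.rev := by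
  rw [AlgEquiv.symm_apply_eq]
  exact (by rw [RTTPlus.toUPlus_gen, Fin.rev_rev, Fin.rev_rev] :
    _ = RTTPlus.toUPlus n (RTTPlus.gen vv⁻¹ j.rev i.rev))

end

theorem mainTheorem1 (n : ℕ) (hn : 0 < n) :
    (∃ Ψ : UPlus n ≃ₗ[Kv] calU n,
      (∀ x y : UPlus n, Ψ (x * y) = Ψ x * Ψ y) ∧ ((Ψ 1 : calU n) : KHat n) = 1 ∧
      ∀ i j : Fin n, ((Ψ (UPlus.tbar i j) : calU n) : KHat n) = tBar j.rev i.rev) ∧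
    (∃ Φ : RTTPlus n vv⁻¹ ≃ₗ[Kv] calU n,
      (∀ x y : RTTPlus n vv⁻¹, Φ (x * y) = Φ x * Φ y) ∧ ((Φ 1 : calU n) : KHat n) = 1 ∧
      ∀ i j : Fin n, ((Φ (RTTPlus.gen vv⁻¹ i j) : calU n) : KHat n) = tBar i j) := by
  have hmul : ∀ x y : RTTPlus n vv⁻¹,
      RTTPlus.equivCalU n (x * y) = RTTPlus.equivCalU n x * RTTPlus.equivCalU n y :=
    fun x y => Subtype.ext (RTTPlus.toKHat_mul x y)
  refine ⟨⟨(RTTPlus.equivUPlus n).symm.toLinearEquiv.trans (RTTPlus.equivCalU n),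
    fun x y => ?_, ?_, fun i j => ?_⟩, RTTPlus.equivCalU n, hmul, RTTPlus.toKHat_one,
    RTTPlus.toKHat_gen⟩
  · simp only [LinearEquiv.trans_apply, AlgEquiv.toLinearEquiv_apply, map_mul, hmul]
  · simp only [LinearEquiv.trans_apply, AlgEquiv.toLinearEquiv_apply, map_one]
    exact RTTPlus.toKHat_one
  · simp only [LinearEquiv.trans_apply, AlgEquiv.toLinearEquiv_apply,
      RTTPlus.equivUPlus_symm_tbar]
    exact RTTPlus.toKHat_gen _ _
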